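/- **Conventions.** "Polynomial time" means uniform polynomial time; randomized algorithms use a polynomial number of fair coins. For $d\ge 0$ let $[2^d]=\{1,\dots,2^d\}$ be the plaintext space, identified with $\{0,1\}^d$. Put $\mathrm{fld}(x,x)=0$, $\mathrm{fld}(x,y)=\lfloor\log_2(x-y)\rfloor+1$ if $x>y$ and $\mathrm{fld}(x,y)=-\lfloor\log_2(y-x)\rfloor-1$ if $x<y$, and $$\mathrm{tfld}(x_0,x_1,x_2)=\bigl(\mathrm{Comp}(x_0,x_1),\mathrm{Comp}(x_1,x_2),\mathrm{Comp}(x_0,x_2),\mathbb I(|\mathrm{fld}(y_0,y_1)|<|\mathrm{fld}(y_1,y_2)|)\bigr),$$ where $\mathrm{Comp}$ returns $<$, $=$ or $>$, and $y_0\le y_1\le y_2$ are $x_0,x_1,x_2$ in sorted order. A *function-revealing encryption (FRE) scheme* consists of polynomial-time algorithms: randomized $\mathrm{Gen}(1^\lambda,1^d)=(\mathsf{sk},\mathsf{params})$ and $\mathrm{Enc}(\mathsf{sk},m)=c$, and deterministic $\mathrm{Dec}(\mathsf{sk},c)\in[2^d]\cup\{\bot\}$ and $\mathrm{Eval}(\mathsf{params},c_0,c_1,c_2)$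 (each may also use $1^\lambda,1^d$). Ciphertexts and public parameters belong to given sets of bit strings whose lengths are polynomially bounded in $\lambda+d$. * Decryption is *correct* if for all $\lambda,d,m$, $\Pr[\mathrm{Dec}(\mathsf{sk},\mathrm{Enc}(\mathsf{sk},m))=m]=1$. * Evaluation with leakage $\mathrm{tfld}$ is *perfectly and strongly correct* if for all $\lambda,d$ and all $c_0,c_1,c_2$ in the ciphertext space, well-formed or not, with probability $1$ over $(\mathsf{sk},\mathsf{params})\leftarrow\mathrm{Gen}(1^\lambda,1^d)$: $\mathrm{Eval}(\mathsf{params},c_0,c_1,c_2)$ equals $\bot$ if some $\mathrm{Dec}(\mathsf{sk},c_b)=\bot$, and equals $\mathrm{tfld}(\mathrm{Dec}(\mathsf{sk},c_0),\mathrm{Dec}(\mathsf{sk},c_1),\mathrm{Dec}(\mathsf{sk},c_2))$ otherwise. Let $\lambda=\lambda(d)$ be a security parameter polynomially related to $d$: $\lambda(d)\le p(d)$ and $d\le q(\lambda(d))$ for some polynomials $p,q$. The scheme is *statically secure* if for every probabilistic polynomial-time adversary $\mathcal A$ the quantity $|\Pr[W_0]-\Pr[W_1]|$ is negligible in $\lambda(d)$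 as $d\to\infty$, where $W_b$ is the event that $\mathcal A$ outputs $1$ in the following game: on input $1^{\lambda(d)},1^d$, $\mathcal A$ submits two sequences of messages $(m^{(0)}_i)_{i\le s}$, $(m^{(1)}_i)_{i\le s}$ in $[2^d]$ with $\mathrm{tfld}(m^{(0)}_i,m^{(0)}_j,m^{(0)}_k)=\mathrm{tfld}(m^{(1)}_i,m^{(1)}_j,m^{(1)}_k)$ for all $i,j,k$; then $(\mathsf{sk},\mathsf{params})\leftarrow\mathrm{Gen}(1^{\lambda(d)},1^d)$ is drawn, and $\mathcal A$ receives $\mathsf{params}$ and independent encryptions $\mathrm{Enc}(\mathsf{sk},m^{(b)}_i)$, $i\le s$, and outputs a bit. The class $\mathrm{LEncThr}$ has as instance space $X_d$ the set of all pairs $(c,\mathsf{params})$ of an element of the ciphertext space and an element of the parameter space for $(\lambda(d),d)$. Its concepts are the functions $f_{t,r}$ for $t\in[2^d]$ and $r$ a sequence of coins for $\mathrm{Gen}$. With $(\mathsf{sk}^r,\mathsf{params}^r)$ the output of $\mathrm{Gen}(1^{\lambda(d)},1^d)$ on the coins $r$, $f_{t,r}(c,\mathsf{params})=1$ if $\mathsf{params}=\mathsf{params}^r$,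 $\mathrm{Dec}(\mathsf{sk}^r,c)\ne\bot$ and $\mathrm{Dec}(\mathsf{sk}^r,c)<t$, and $f_{t,r}(c,\mathsf{params})=0$ otherwise. Learners are given $1^{\lambda(d)},1^d$. **Theorem.** Let an FRE scheme have correct decryption and perfectly and strongly correct evaluation with leakage $\mathrm{tfld}$, and let it be statically secure. Then: 1. $\mathrm{LEncThr}$ is online learnable in polynomial time with a polynomial mistake bound: there are a deterministic learner and a polynomial $p$ such that for every $d$, every target concept and every infinite sequence of examples, the learner (which predicts the label of each example, then sees the correct label and updates its state) takes time at most $p(d)$ in every round and makes at most $p(d)$ mistakes in total. 2. There is no efficient private PAC learner for $\mathrm{LEncThr}$: there is no polynomial-time randomized algorithm $L$ with polynomially bounded sample complexity $n=n(d)$ that outputs representations of hypotheses $h:X_d\to\{0,1\}$ from a class of Boolean functions that can be evaluated in polynomial time from their representations, and for every $d$ satisfies both of the following. * ($(\tfrac14,\tfrac14)$-accuracy) For every concept $f$ and every distribution $\mathcal D$ on $X_d$, if $x_1,\dots,x_n$ are drawn i.i.d. from $\mathcal D$ and $h\leftarrow L((x_i,f(x_i))_{i\le n})$, then $\Pr\bigl[\Pr_{x\sim\mathcal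 D}[h(x)\ne f(x)]\le\tfrac14\bigr]\ge\tfrac34$. * ($(1,\tfrac1{4n})$-differential privacy) For all $S,S'\in(X_d\times\{0,1\})^n$ that differ in exactly one entry and every set $T$ of Boolean functions on $X_d$, $\Pr[L(S)\in T]\le e\cdot\Pr[L(S')\in T]+\tfrac1{4n}$. -/

import Mathlib

noncomputable section

namespace LeakyThr

/-! ### Cost model: programs on binary trees -/

/-- Binary trees, the data on which programs operate. -/
inductive Tr : Type
  | leaf : Tr
  | node : Tr → Tr → Tr

/-- Number of vertices of a tree. -/
def Tr.size : Tr → ℕ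
  | .leaf => 1
  | .node a b => a.size + b.size + 1

/-- Programs; each one maps a tree to a tree. -/
inductive Code : Type
  /-- return the argument -/
  | id : Code
  /-- return the one-vertex tree -/
  | leaf : Code
  /-- left subtree (a leaf is mapped to a leaf) -/
  | fst : Code
  /-- right subtree (a leaf is mapped to a leaf) -/
  | snd : Code
  /-- run both programs on the argument and join the results -/
  | pair : Code → Code → Code
  /-- `comp f g` runs `g` and then `f` -/
  | comp : Code → Code → Code
  /-- `cond c f g`: if `c` returns a non-leaf then run `f`, otherwise run `g` -/
  | cond : Code → Code → Code → Code
  /-- `loop c f`: while `c` returns a non-leaf, replace the current value by its image under `f` -/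
  | loop : Code → Code → Code

/-- `Runs c x y t`: the program `c` halts on the argument `x` with result `y` in time `t`.
Every execution of an instruction on an argument `x` is charged `|x| + 1` time units, on top
of the time of the programs that it calls. So the time is at least the size of every tree that
occurs in the computation, and it agrees with Turing machine time up to a polynomial. -/
inductive Runs : Code → Tr → Tr → ℕ → Prop
  | id (x : Tr) : Runs .id x x (x.size + 1)
  | leaf (x : Tr) : Runs .leaf x .leaf (x.size + 1)
  | fst_leaf : Runs .fst .leaf .leaf (Tr.leaf.size + 1)
  | fst_node (a b : Tr) : Runs .fst (.node a b) a ((Tr.node a b).size + 1)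
  | snd_leaf : Runs .snd .leaf .leaf (Tr.leaf.size + 1)
  | snd_node (a b : Tr) : Runs .snd (.node a b) b ((Tr.node a b).size + 1)
  | pair {f g : Code} {x y z : Tr} {s t : ℕ} (hf : Runs f x y s) (hg : Runs g x z t) :
      Runs (.pair f g) x (.node y z) (s + t + (x.size + 1))
  | comp {f g : Code} {x y z : Tr} {s t : ℕ} (hg : Runs g x y s) (hf : Runs f y z t) :
      Runs (.comp f g) x z (s + t + (x.size + 1))
  | cond_true {c f g : Code} {x a b y : Tr} {s t : ℕ}
      (hc : Runs c x (.node a b) s) (hf : Runs f x y t) :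
      Runs (.cond c f g) x y (s + t + (x.size + 1))
  | cond_false {c f g : Code} {x y : Tr} {s t : ℕ}
      (hc : Runs c x .leaf s) (hg : Runs g x y t) :
      Runs (.cond c f g) x y (s + t + (x.size + 1))
  | loop_stop {c f : Code} {x : Tr} {s : ℕ} (hc : Runs c x .leaf s) :
      Runs (.loop c f) x x (s + (x.size + 1))
  | loop_step {c f : Code} {x a b y z : Tr} {s t u : ℕ}
      (hc : Runs c x (.node a b) s) (hf : Runs f x y t) (hl : Runs (.loop c f) y z u) :
      Runs (.loop c f) x z (s + t + u + (x.size + 1))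

/-- The program halts on `x` with result `y` in time at most `T`. -/
def RunsWithin (c : Code) (x y : Tr) (T : ℕ) : Prop := ∃ t ≤ T, Runs c x y t

/-- One program maps `inp i` to `out i` for every `i`, in time polynomial in the size of `inp i`.
Here `i` ranges over the admissible inputs, which `inp` and `out` write as trees. -/
def PolyTime {ι : Type} (inp out : ι → Tr) : Prop :=
  ∃ (c : Code) (p : Polynomial ℕ), ∀ i, RunsWithin c (inp i) (out i) (p.eval (inp i).size)

/-- The representation of data as trees. Numbers are written in unary. -/
class Encode (α : Type) where
  enc : α → Tr

open Encode (enc)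

instance : Encode Tr := ⟨fun x => x⟩

instance : Encode Bool := ⟨fun b => bif b then .node .leaf .leaf else .leaf⟩

instance : Encode ℕ := ⟨Nat.rec .leaf fun _ x => .node .leaf x⟩

instance : Encode Ordering :=
  ⟨fun
    | .lt => .leaf
    | .eq => .node .leaf .leaf
    | .gt => .node .leaf (.node .leaf .leaf)⟩

instance {α β : Type} [Encode α] [Encode β] : Encode (α × β) :=
  ⟨fun x => .node (enc x.1) (enc x.2)⟩

instance {α : Type} [Encode α] : Encode (Option α) :=
  ⟨fun
    | none => .leaf
    | some a => .node (enc a) .leaf⟩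

instance {α : Type} [Encode α] : Encode (List α) :=
  ⟨List.foldr (fun a x => .node (enc a) x) .leaf⟩

instance {α : Type} [Encode α] {P : α → Prop} : Encode {a // P a} := ⟨fun a => enc a.1⟩

instance {α : Type} [Encode α] {S : Set α} : Encode S := ⟨fun a => enc a.1⟩

/-- Coin sequences. -/
instance {k : ℕ} : Encode (Fin k → Bool) := ⟨fun r => enc (List.ofFn r)⟩

/-- Plaintexts of length `d`: the space `[2 ^ d]`, numbered from `0`. A plaintext is handed to
an algorithm as its `d` binary digits, the least significant one first. -/
abbrev Msg (d : ℕ) : Type := Fin (2 ^ d)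

instance {d : ℕ} : Encode (Msg d) := ⟨fun m => enc (List.ofFn fun i : Fin d => m.val.testBit i)⟩

/-! ### Finite probability -/

/-- Probability of an event. -/
def prob {α : Type} (μ : PMF α) (T : Set α) : ℝ := (μ.toOuterMeasure T).toReal

/-- `k` independent fair coin tosses. -/
def coinFlips (k : ℕ) : PMF (Fin k → Bool) := PMF.uniformOfFintype _

/-- Independent draws from the given distributions. -/
def indep {α : Type} : (n : ℕ) → (Fin n → PMF α) → PMF (Fin n → α)
  | 0, _ => PMF.pure Fin.elim0
  | n + 1, μ => (μ 0).bind fun a =>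
      (indep n fun i => μ i.succ).map fun v => (Fin.cons a v : Fin (n + 1) → α)

/-! ### Leakage functions -/

/-- The three comparisons and one further bit. -/
abbrev Leak : Type := Ordering × Ordering × Ordering × Bool

/-- The leakage function induced by a signed distance: the pairwise comparisons of the inputs
`x₀, x₁, x₂`, and whether `|dist y₀ y₁| < |dist y₁ y₂|` where `y₀ ≤ y₁ ≤ y₂` are the inputs in
sorted order. -/
def inducedLeak (dist : ℕ → ℕ → ℤ) (x₀ x₁ x₂ : ℕ) : Leak :=
  let y₀ := min x₀ (min x₁ x₂)
  let y₁ := max (min x₀ x₁) (min (max x₀ x₁) x₂)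
  let y₂ := max x₀ (max x₁ x₂)
  (compare x₀ x₁, compare x₁ x₂, compare x₀ x₂, decide (|dist y₀ y₁| < |dist y₁ y₂|))

/-- Signed floor-log distance (`Nat.log 2` is the rounded down binary logarithm). -/
def fld (x y : ℕ) : ℤ :=
  if x = y then 0
  else if y < x then (Nat.log 2 (x - y) : ℤ) + 1
  else -(Nat.log 2 (y - x) : ℤ) - 1

/-- Comparisons and comparison of the floor-log distances. -/
def tfld : ℕ → ℕ → ℕ → Leak := inducedLeak fld

/-! ### Function-revealing encryption -/

/-- A function-revealing encryption scheme with a leakage function of arity three. In all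
algorithms `l` is the security parameter and `d` the plaintext length, both given in unary. The
last argument of the randomized algorithms `Gen` and `Enc` is their sequence of coin tosses. -/
structure FRE where
  /-- the space of public parameters -/
  params : ℕ → ℕ → Set (List Bool)
  /-- the ciphertext space -/
  ciphers : ℕ → ℕ → Set (List Bool)
  genCoins : Polynomial ℕ
  encCoins : Polynomial ℕ
  /-- outputs the secret key and the public parameters -/
  Gen : (l d : ℕ) → (Fin (genCoins.eval (l + d)) → Bool) → List Bool × params l d
  Enc : (l d : ℕ) → List Bool → Msg d → (Fin (encCoins.eval (l + d)) → Bool) → ciphers l d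
  Dec : (l d : ℕ) → List Bool → ciphers l d → Option (Msg d)
  Eval : (l d : ℕ) → params l d → ciphers l d → ciphers l d → ciphers l d → Option Leak
  params_length : ∃ p : Polynomial ℕ, ∀ l d, ∀ q ∈ params l d, q.length ≤ p.eval (l + d)
  ciphers_length : ∃ p : Polynomial ℕ, ∀ l d, ∀ c ∈ ciphers l d, c.length ≤ p.eval (l + d)
  gen_polyTime : PolyTime
    (fun i : (l : ℕ) × (d : ℕ) × (Fin (genCoins.eval (l + d)) → Bool) =>
      enc (i.1, i.2.1, i.2.2))
    (fun i => enc (Gen i.1 i.2.1 i.2.2))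
  enc_polyTime : PolyTime
    (fun i : (l : ℕ) × (d : ℕ) × (List Bool × Msg d × (Fin (encCoins.eval (l + d)) → Bool)) =>
      enc (i.1, i.2.1, i.2.2))
    (fun i => enc (Enc i.1 i.2.1 i.2.2.1 i.2.2.2.1 i.2.2.2.2))
  dec_polyTime : PolyTime
    (fun i : (l : ℕ) × (d : ℕ) × (List Bool × ciphers l d) => enc (i.1, i.2.1, i.2.2))
    (fun i => enc (Dec i.1 i.2.1 i.2.2.1 i.2.2.2))
  eval_polyTime : PolyTime
    (fun i : (l : ℕ) × (d : ℕ) × (params l d × ciphers l d × ciphers l d × ciphers l d) =>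
      enc (i.1, i.2.1, i.2.2))
    (fun i => enc (Eval i.1 i.2.1 i.2.2.1 i.2.2.2.1 i.2.2.2.2.1 i.2.2.2.2.2))

namespace FRE

variable (F : FRE)

/-- The joint distribution of the secret key and the public parameters. -/
def genDist (l d : ℕ) : PMF (List Bool × F.params l d) :=
  (coinFlips (F.genCoins.eval (l + d))).map (F.Gen l d)

/-- The distribution of an encryption of `m`. -/
def encDist (l d : ℕ) (sk : List Bool) (m : Msg d) : PMF (F.ciphers l d) :=
  (coinFlips (F.encCoins.eval (l + d))).map (F.Enc l d sk m)

/-- Decryption succeeds with probability one. -/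
def CorrectDecryption : Prop :=
  ∀ (l d : ℕ) (m : Msg d),
    prob ((F.genDist l d).bind fun k => (F.encDist l d k.1 m).map (F.Dec l d k.1)) {some m} = 1

/-- Evaluation through decryption: `none` if some ciphertext does not decrypt, and otherwise the
leakage of the three plaintexts. -/
def evalCiph (leak : ℕ → ℕ → ℕ → Leak) (l d : ℕ) (sk : List Bool) (c₀ c₁ c₂ : F.ciphers l d) :
    Option Leak :=
  match F.Dec l d sk c₀, F.Dec l d sk c₁, F.Dec l d sk c₂ with
  | some m₀, some m₁, some m₂ => some (leak m₀ m₁ m₂)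
  | _, _, _ => none

/-- Perfectly and strongly correct evaluation: on all elements of the ciphertext space,
well-formed or not, `Eval` agrees with evaluation through decryption, with probability one. -/
def CorrectEvaluation (leak : ℕ → ℕ → ℕ → Leak) : Prop :=
  ∀ (l d : ℕ) (c₀ c₁ c₂ : F.ciphers l d),
    prob (F.genDist l d)
      {k | F.Eval l d k.2 c₀ c₁ c₂ = F.evalCiph leak l d k.1 c₀ c₁ c₂} = 1

/-- Polynomial-time adversaries in the static security game with leakage `leak`, where the
security parameter is `lam d` for plaintexts of length `d`. The adversary first submits a list of
pairs, that is, two message sequences of the same length, whose leakages agree; then it sees the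
public parameters and the ciphertexts and makes a guess. Its two stages use the same coins, so
the second stage can recompute whatever the first one has computed. -/
structure Adversary (lam : ℕ → ℕ) (leak : ℕ → ℕ → ℕ → Leak) where
  coins : Polynomial ℕ
  challenge : (d : ℕ) → (Fin (coins.eval d) → Bool) → List (Msg d × Msg d)
  guess : (d : ℕ) → (Fin (coins.eval d) → Bool) → F.params (lam d) d →
    List (F.ciphers (lam d) d) → Bool
  leak_eq : ∀ d r, ∀ x ∈ challenge d r, ∀ y ∈ challenge d r, ∀ z ∈ challenge d r,
    leak x.1 y.1 z.1 = leak x.2 y.2 z.2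
  challenge_polyTime : PolyTime
    (fun i : (d : ℕ) × (Fin (coins.eval d) → Bool) => enc (lam i.1, i.1, i.2))
    (fun i => enc (challenge i.1 i.2))
  guess_polyTime : PolyTime
    (fun i : (d : ℕ) × ((Fin (coins.eval d) → Bool) × F.params (lam d) d ×
        List (F.ciphers (lam d) d)) => enc (lam i.1, i.1, i.2))
    (fun i => enc (guess i.1 i.2.1 i.2.2.1 i.2.2.2))

/-- The output of the adversary in the game in which the first sequence (`b = false`) or the
second sequence (`b = true`) of messages is encrypted. -/
def game {F : FRE} {lam : ℕ → ℕ} {leak : ℕ → ℕ → ℕ → Leak} (A : F.Adversary lam leak)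
    (b : Bool) (d : ℕ) : PMF Bool :=
  (coinFlips (A.coins.eval d)).bind fun r =>
    (F.genDist (lam d) d).bind fun k =>
      (indep (A.challenge d r).length fun i =>
          F.encDist (lam d) d k.1
            (bif b then ((A.challenge d r).get i).2 else ((A.challenge d r).get i).1)).map
        fun c => A.guess d r k.2 (List.ofFn c)

/-- Static security: the advantage of every polynomial-time adversary is a negligible function of
the security parameter. -/
def StaticallySecure (lam : ℕ → ℕ) (leak : ℕ → ℕ → ℕ → Leak) : Prop :=
  ∀ A : F.Adversary lam leak,
    Asymptotics.SuperpolynomialDecay Filter.atTop (fun d => (lam d : ℝ))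
      fun d => |prob (game A false d) {true} - prob (game A true d) {true}|

end FRE

/-! ### Learning -/

/-- A sequence of learning problems: instance spaces of increasing dimension `d`, and a set of
concepts on each. -/
structure ConceptClass where
  Inst : ℕ → Type
  /-- the representation of instances as trees -/
  encInst : (d : ℕ) → Encode (Inst d)
  concepts : (d : ℕ) → Set (Inst d → Bool)
  /-- the size parameters handed to a learner -/
  desc : ℕ → Tr

instance (C : ConceptClass) (d : ℕ) : Encode (C.Inst d) := C.encInst d

/-- Polynomial-time online learnability with a polynomial mistake bound. The learner keeps a
state. In round `i` it predicts a label for the example `x i` and, when the correct label is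
revealed, updates its state; in every round, its time is at most `p d`. For every target concept
and every sequence of examples (as the learner is deterministic, these are all the possible
plays), it makes at most `p d` mistakes in total. -/
def EfficientlyOnlineLearnable (C : ConceptClass) : Prop :=
  ∃ (initial predict update : Code) (p : Polynomial ℕ),
    ∀ d, ∀ f ∈ C.concepts d, ∀ x : ℕ → C.Inst d,
      ∃ (state : ℕ → Tr) (guess : ℕ → Bool),
        RunsWithin initial (C.desc d) (state 0) (p.eval d) ∧
        (∀ i, RunsWithin predict (enc (state i, x i)) (enc (guess i)) (p.eval d)) ∧
        (∀ i, RunsWithin update (enc (state i, x i, f (x i))) (state (i + 1)) (p.eval d)) ∧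
        {i | guess i ≠ f (x i)}.encard ≤ ((p.eval d : ℕ) : ℕ∞)

/-- `M` is `(ε, δ)`-differentially private. -/
def DifferentiallyPrivate {Z R : Type} {n : ℕ} (ε δ : ℝ) (M : (Fin n → Z) → PMF R) : Prop :=
  ∀ S S' : Fin n → Z, (∃! i, S i ≠ S' i) →
    ∀ T : Set R, prob (M S) T ≤ Real.exp ε * prob (M S') T + δ

/-- `L` is an `(α, β)`-accurate PAC learner with sample complexity `n`. -/
def AccuratePAC {X : Type} {n : ℕ} (α β : ℝ) (concepts : Set (X → Bool))
    (L : (Fin n → X × Bool) → PMF (X → Bool)) : Prop :=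
  ∀ f ∈ concepts, ∀ D : PMF X,
    1 - β ≤ prob ((indep n fun _ => D).bind fun x => L fun i => (x i, f (x i)))
      {h | prob D {x | h x ≠ f x} ≤ α}

/-- Polynomial-time randomized learners. From a labelled sample and its coins the learner
computes a representation of a hypothesis; `hyp` is the hypothesis class, in which hypotheses are
evaluated in polynomial time from their representations. -/
structure EfficientLearner (C : ConceptClass) where
  /-- the sample complexity -/
  samples : ℕ → ℕ
  coins : Polynomial ℕ
  learn : (d : ℕ) → List (C.Inst d × Bool) → (Fin (coins.eval d) → Bool) → Tr
  hyp : (d : ℕ) → Tr → C.Inst d → Bool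
  samples_le : ∃ p : Polynomial ℕ, ∀ d, samples d ≤ p.eval d
  learn_polyTime : PolyTime
    (fun i : (d : ℕ) × (List (C.Inst d × Bool) × (Fin (coins.eval d) → Bool)) =>
      enc (C.desc i.1, i.2))
    (fun i => learn i.1 i.2.1 i.2.2)
  hyp_polyTime : PolyTime
    (fun i : (d : ℕ) × (Tr × C.Inst d) => enc (C.desc i.1, i.2))
    (fun i => enc (hyp i.1 i.2.1 i.2.2))

/-- The distribution of the hypothesis, a Boolean function, learned from the sample `S`. -/
def EfficientLearner.output {C : ConceptClass} (L : EfficientLearner C) (d : ℕ)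
    (S : Fin (L.samples d) → C.Inst d × Bool) : PMF (C.Inst d → Bool) :=
  (coinFlips (L.coins.eval d)).map fun r => L.hyp d (L.learn d (List.ofFn S) r)

/-- The concept `f_{t,r}`: an example is a ciphertext together with public parameters, and its
label is `1` if the parameters are those that `Gen` outputs on the coins `r` and the ciphertext
decrypts, under the secret key for `r`, to a plaintext below `t`. -/
def encThreshold (F : FRE) (l d : ℕ) (t : Msg d) (r : Fin (F.genCoins.eval (l + d)) → Bool)
    (x : F.ciphers l d × F.params l d) : Bool :=
  open Classical in
  decide (x.2 = (F.Gen l d r).2 ∧ ∃ m, F.Dec l d (F.Gen l d r).1 x.1 = some m ∧ m < t)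

/-- The class of encrypted thresholds, with security parameter `lam d` for plaintexts of
length `d`. -/
def LEncThr (F : FRE) (lam : ℕ → ℕ) : ConceptClass where
  Inst d := F.ciphers (lam d) d × F.params (lam d) d
  encInst _ := inferInstance
  concepts d := {f | ∃ t r, f = encThreshold F (lam d) d t r}
  desc d := enc (lam d, d)

end LeakyThr

end

/-!
Thresholds on encrypted messages are easy to learn online and cannot be learned privately, if the
encryption reveals comparisons and comparisons of floor-log distances, but hides everything else.

*Online learning.* The learner remembers the public parameters, the ciphertext of a message `a`
below the threshold and the ciphertext of a message `b` not below it, and compares a new example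
with these by `Eval`. A message between `a` and `b` gets the label of the closer one. If this is
wrong, the message replaces the farther one, and the squared distance of `a` and `b` halves
(`log_sq_lt`). So the logarithm of the squared distance bounds the number of mistakes
(`update_spec`, `encard_le_of_potential`). Strong correctness makes the comparisons right for every
element of the ciphertext space, well-formed or not. The resulting bound is
`efficientlyOnlineLearnable`.

*No private learning.* Divide the `2 ^ d` messages into `N` blocks of equal length, where `N` is a
large enough power of two of polynomial size, and take a learner's hypothesis `h` for the threshold
in the middle. Let `p v` be the probability that `h` accepts an encryption of `v`, and let `g j` be
the change of the mean of `p` from block `j` to the next one (`blockDrop`). There are three facts.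

* If `h` is accurate, then the `g j` add up to at least `1 / 2` (`half_le_sum_blockDrop`).
* Call block `j` clean for a message `s` if the floor-log distance to `s` is the same all over the
  blocks `j` and `j + 1` and exceeds the distances within them (`Clean.spec`). If `j` is clean for
  the whole sample, then a pair `u₁ < u₂` from one of the two blocks may be replaced by `w₁`, `w₂`
  from the one and from the other without changing the leakage (`tfld_eq_of_clean`). An adversary
  that tests whether `h` accepts both messages distinguishes the two cases with advantage about
  `(g j) ^ 2 / 2`: with `σ` and `σ'` for the means of `p` on the two blocks, the acceptance
  probabilities are `(σ ^ 2 + σ' ^ 2) / 2` and `σ * σ'` (`expect_gate_ge`). Such choices are made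
  with inverse polynomial probability, so security makes `g j` small on the clean blocks
  (`cleanDrops_le`).
* Only logarithmically many blocks are unclean for a message (`card_not_clean_right_le`), and a
  block is unclean only for a small fraction of the messages (`card_not_clean_left_le`).

Therefore, with constant probability, the sum of `g j` over the blocks that are unclean for some
sample entry is at least `1 / 4`, and for one of the `n` entries the sum over the blocks that are
unclean for this entry is at least `1 / (4 * n)`. By differential privacy this remains likely if
that entry is replaced by an independent message. But then the unclean blocks have nothing to do
with `h`, and the event has small probability by Markov's inequality (`false_of_private`).

Running times are handled by closure properties of `PolyTime`, in particular under case distinction,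
iteration over lists and arithmetic of numbers in unary. Probabilities over uniform coins are
written as finite averages `𝔼`.
-/

open Finset
open scoped BigOperators

namespace LeakyThr

open Encode (enc)


/-! ### Polynomial-time functions: closure properties -/

theorem eval_mono (p : Polynomial ℕ) {a b : ℕ} (h : a ≤ b) : p.eval a ≤ p.eval b := by
  rw [Polynomial.eval_eq_sum, Polynomial.eval_eq_sum]
  exact Finset.sum_le_sum fun i _ => Nat.mul_le_mul_left _ (Nat.pow_le_pow_left h i)

/-- Left subtree, where a leaf is its own left subtree. -/
def Tr.left : Tr → Tr
  | .leaf => .leaf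
  | .node a _ => a

/-- Right subtree, where a leaf is its own right subtree. -/
def Tr.right : Tr → Tr
  | .leaf => .leaf
  | .node _ b => b

@[simp] theorem Tr.left_node (a b : Tr) : (Tr.node a b).left = a := rfl
@[simp] theorem Tr.right_node (a b : Tr) : (Tr.node a b).right = b := rfl

/-- A program produces no more output than its running time allows. -/
theorem Runs.size_le {c : Code} {x y : Tr} {t : ℕ} (h : Runs c x y t) : y.size ≤ t := by
  induction h <;> (try simp only [Tr.size] at *) <;> omega

theorem PolyTime.size_le {ι : Type} {inp out : ι → Tr} (h : PolyTime inp out) :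
    ∃ p : Polynomial ℕ, ∀ i, (out i).size ≤ p.eval (inp i).size := by
  obtain ⟨c, p, h⟩ := h
  refine ⟨p, fun i => ?_⟩
  obtain ⟨t, ht, hr⟩ := h i
  exact hr.size_le.trans ht

section closure

variable {ι : Type} {inp : ι → Tr}

theorem PolyTime.reindex {κ : Type} {out : ι → Tr} (h : PolyTime inp out) (φ : κ → ι) :
    PolyTime (fun k => inp (φ k)) (fun k => out (φ k)) := by
  obtain ⟨c, p, h⟩ := h
  exact ⟨c, p, fun k => h (φ k)⟩

theorem PolyTime.refl : PolyTime inp inp :=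
  ⟨.id, Polynomial.X + 1, fun i => ⟨_, by simp, .id _⟩⟩

theorem PolyTime.congr {f g : ι → Tr} (hf : PolyTime inp f) (h : ∀ i, f i = g i) :
    PolyTime inp g := by
  rwa [show g = f from funext fun i => (h i).symm]

theorem PolyTime.leaf : PolyTime inp fun _ => .leaf :=
  ⟨.leaf, Polynomial.X + 1, fun i => ⟨_, by simp, .leaf _⟩⟩

theorem PolyTime.trans {mid out : ι → Tr} (hf : PolyTime inp mid) (hg : PolyTime mid out) :
    PolyTime inp out := by
  obtain ⟨c, p, hf⟩ := hf
  obtain ⟨c', p', hg⟩ := hg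
  refine ⟨.comp c' c, p + p'.comp p + (Polynomial.X + 1), fun i => ?_⟩
  obtain ⟨s, hs, hr⟩ := hf i
  obtain ⟨t, ht, hr'⟩ := hg i
  refine ⟨_, ?_, .comp hr hr'⟩
  have := eval_mono p' (hr.size_le.trans hs)
  simp only [Polynomial.eval_add, Polynomial.eval_comp, Polynomial.eval_X, Polynomial.eval_one]
  omega

theorem PolyTime.node {f g : ι → Tr} (hf : PolyTime inp f) (hg : PolyTime inp g) :
    PolyTime inp fun i => .node (f i) (g i) := by
  obtain ⟨c, p, hf⟩ := hf
  obtain ⟨c', p', hg⟩ := hg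
  refine ⟨.pair c c', p + p' + (Polynomial.X + 1), fun i => ?_⟩
  obtain ⟨s, hs, hr⟩ := hf i
  obtain ⟨t, ht, hr'⟩ := hg i
  refine ⟨_, ?_, .pair hr hr'⟩
  simp only [Polynomial.eval_add, Polynomial.eval_X, Polynomial.eval_one]
  omega

theorem PolyTime.left {f : ι → Tr} (hf : PolyTime inp f) : PolyTime inp fun i => (f i).left := by
  refine hf.trans ⟨.fst, Polynomial.X + 1, fun i => ⟨(f i).size + 1, by simp, ?_⟩⟩
  dsimp only
  cases f i
  exacts [.fst_leaf, .fst_node _ _]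

theorem PolyTime.right {f : ι → Tr} (hf : PolyTime inp f) :
    PolyTime inp fun i => (f i).right := by
  refine hf.trans ⟨.snd, Polynomial.X + 1, fun i => ⟨(f i).size + 1, by simp, ?_⟩⟩
  dsimp only
  cases f i
  exacts [.snd_leaf, .snd_node _ _]

/-- Case distinction by a tree `c i`. Each branch has to be computed only on the inputs that
lead to it. -/
theorem PolyTime.split {c out : ι → Tr} (hc : PolyTime inp c)
    (hf : PolyTime (fun i : {i // c i ≠ .leaf} => inp i.1) (fun i => out i.1))
    (hg : PolyTime (fun i : {i // c i = .leaf} => inp i.1) (fun i => out i.1)) :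
    PolyTime inp out := by
  obtain ⟨c₀, p₀, hc⟩ := hc
  obtain ⟨c₁, p₁, hf⟩ := hf
  obtain ⟨c₂, p₂, hg⟩ := hg
  refine ⟨.cond c₀ c₁ c₂, p₀ + p₁ + p₂ + (Polynomial.X + 1), fun i => ?_⟩
  simp only [Polynomial.eval_add, Polynomial.eval_X, Polynomial.eval_one]
  obtain ⟨s, hs, hr⟩ := hc i
  cases h : c i with
  | leaf =>
    obtain ⟨t, ht, hr'⟩ := hg ⟨i, h⟩
    rw [h] at hr
    exact ⟨_, by dsimp only at *; omega, .cond_false hr hr'⟩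
  | node a b =>
    obtain ⟨t, ht, hr'⟩ := hf ⟨i, by simp [h]⟩
    rw [h] at hr
    exact ⟨_, by dsimp only at *; omega, .cond_true hr hr'⟩

theorem PolyTime.splitBool {c : ι → Bool} {out : ι → Tr} (hc : PolyTime inp fun i => enc (c i))
    (hf : PolyTime (fun i : {i // c i = true} => inp i.1) (fun i => out i.1))
    (hg : PolyTime (fun i : {i // c i = false} => inp i.1) (fun i => out i.1)) :
    PolyTime inp out := by
  refine hc.split (hf.reindex fun i : {i // enc (c i) ≠ .leaf} => ⟨i.1, ?_⟩)
    (hg.reindex fun i : {i // enc (c i) = .leaf} => ⟨i.1, ?_⟩)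
  · have := i.2
    cases h : c i.1
    · rw [h] at this; exact (this rfl).elim
    · rfl
  · have := i.2
    cases h : c i.1
    · rfl
    · rw [h] at this; cases this

/-- A loop that passes through the states `st i 0, …, st i (len i)`, if their number and their
sizes are polynomially bounded. -/
theorem PolyTime.loop {len : ι → ℕ} {st cnd : ι → ℕ → Tr} (q : Polynomial ℕ)
    (hlen : ∀ i, len i ≤ q.eval (st i 0).size)
    (hsize : ∀ i, ∀ k ≤ len i, (st i k).size ≤ q.eval (st i 0).size)
    (hc : PolyTime (fun x : {x : ι × ℕ // x.2 ≤ len x.1} => st x.1.1 x.1.2)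
      fun x => cnd x.1.1 x.1.2)
    (hc0 : ∀ i, cnd i (len i) = .leaf) (hc1 : ∀ i, ∀ k < len i, cnd i k ≠ .leaf)
    (hs : PolyTime (fun x : {x : ι × ℕ // x.2 < len x.1} => st x.1.1 x.1.2)
      fun x => st x.1.1 (x.1.2 + 1)) :
    PolyTime (fun i => st i 0) fun i => st i (len i) := by
  obtain ⟨c, p, hc⟩ := hc
  obtain ⟨f, p', hs⟩ := hs
  refine ⟨.loop c f, (q + 1) * (p.comp q + p'.comp q + q + 1), fun i => ?_⟩
  set B := (p.comp q + p'.comp q + q + 1).eval (st i 0).size with hB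
  have hB' : B = p.eval (q.eval (st i 0).size) + p'.eval (q.eval (st i 0).size)
      + q.eval (st i 0).size + 1 := by
    simp [hB]
  have key : ∀ m ≤ len i, RunsWithin (.loop c f) (st i (len i - m)) (st i (len i))
      ((m + 1) * B) := by
    intro m
    induction m with
    | zero =>
      intro _
      obtain ⟨s, hs', hr⟩ := hc ⟨(i, len i), le_rfl⟩
      simp only [hc0] at hr
      have h_end : Runs (.loop c f) (st i (len i)) (st i (len i))
          (s + ((st i (len i)).size + 1)) := by
        constructor
        exact hr
      refine ⟨_, ?_, h_end⟩
      have h1 := hsize i _ le_rfl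
      have h2 := eval_mono p h1
      dsimp only [Nat.sub_zero] at *
      omega
    | succ m ih =>
      intro hm
      obtain ⟨u, hu, hru⟩ := ih (by omega)
      have hk : len i - (m + 1) < len i := by omega
      obtain ⟨s, hs', hr⟩ := hc ⟨(i, len i - (m + 1)), hk.le⟩
      obtain ⟨t, ht, hrt⟩ := hs ⟨(i, len i - (m + 1)), hk⟩
      have hne := hc1 i _ hk
      dsimp only at *
      rw [show len i - (m + 1) + 1 = len i - m by omega] at hrt
      cases h : cnd i (len i - (m + 1)) with
      | leaf => exact absurd h hne
      | node a b =>
        rw [h] at hr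
        refine ⟨_, ?_, .loop_step hr hrt hru⟩
        have h1 := hsize i _ hk.le
        have h2 := eval_mono p h1
        have h3 := eval_mono p' h1
        rw [show (m + 1 + 1) * B = (m + 1) * B + B by ring]
        omega
  obtain ⟨t, ht, hr⟩ := key (len i) le_rfl
  refine ⟨t, ht.trans ?_, by simpa using hr⟩
  rw [Polynomial.eval_mul, ← hB, Polynomial.eval_add, Polynomial.eval_one]
  exact Nat.mul_le_mul_right _ (Nat.succ_le_succ (hlen i))

end closure

/-! ### Polynomial-time functions between encoded types -/

section typed

variable {ι : Type} {inp : ι → Tr} {α β γ : Type} [Encode α] [Encode β] [Encode γ]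

/-- `f` is computed in polynomial time from the input `inp`. The input is kept as a tree-valued
function of an index, so that the admissible inputs can be restricted by changing the index type. -/
def PolyComp (inp : ι → Tr) (f : ι → α) : Prop := PolyTime inp fun i => enc (f i)

theorem PolyComp.reindex {κ : Type} {f : ι → α} (h : PolyComp inp f) (φ : κ → ι) :
    PolyComp (fun k => inp (φ k)) (fun k => f (φ k)) := PolyTime.reindex h φ

theorem PolyComp.congr {f g : ι → α} (hf : PolyComp inp f) (h : ∀ i, f i = g i) :
    PolyComp inp g := by
  rwa [show g = f from funext fun i => (h i).symm]

theorem PolyComp.pair {f : ι → α} {g : ι → β} (hf : PolyComp inp f) (hg : PolyComp inp g) :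
    PolyComp inp fun i => (f i, g i) := PolyTime.node hf hg

theorem PolyComp.fst {f : ι → α × β} (hf : PolyComp inp f) :
    PolyComp inp fun i => (f i).1 := PolyTime.left hf

theorem PolyComp.snd {f : ι → α × β} (hf : PolyComp inp f) :
    PolyComp inp fun i => (f i).2 := PolyTime.right hf

theorem polyTime_const (t : Tr) : PolyTime inp fun _ => t := by
  induction t with
  | leaf => exact .leaf
  | node a b iha ihb => exact .node iha ihb

theorem PolyComp.const (a : α) : PolyComp inp fun _ => a := polyTime_const (enc a)

theorem PolyComp.cons {f : ι → α} {g : ι → List α} (hf : PolyComp inp f)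
    (hg : PolyComp inp g) : PolyComp inp fun i => f i :: g i := PolyTime.node hf hg

theorem PolyComp.tail {f : ι → List α} (hf : PolyComp inp f) :
    PolyComp inp fun i => (f i).tail := by
  refine (PolyTime.right hf).congr fun i => ?_
  dsimp only
  cases f i <;> rfl

theorem PolyComp.succ {f : ι → ℕ} (hf : PolyComp inp f) :
    PolyComp inp fun i => f i + 1 := PolyTime.node .leaf hf

/-- Case distinction in which each branch has to be computed only on the inputs that lead to
it. -/
theorem PolyComp.split {c : ι → Bool} {out : ι → α} (hc : PolyComp inp c)
    (hf : PolyComp (fun i : {i // c i = true} => inp i.1) (fun i => out i.1))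
    (hg : PolyComp (fun i : {i // c i = false} => inp i.1) (fun i => out i.1)) :
    PolyComp inp out := PolyTime.splitBool hc hf hg

theorem PolyComp.cond {c : ι → Bool} {f g : ι → α} (hc : PolyComp inp c)
    (hf : PolyComp inp f) (hg : PolyComp inp g) :
    PolyComp inp fun i => bif c i then f i else g i := by
  refine hc.split ((hf.reindex _).congr fun i => ?_) ((hg.reindex _).congr fun i => ?_)
  · simp [i.2]
  · simp [i.2]

theorem PolyComp.not {c : ι → Bool} (hc : PolyComp inp c) : PolyComp inp fun i => !c i :=
  (hc.cond (.const false) (.const true)).congr fun i => by cases c i <;> rfl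

theorem PolyComp.and {c c' : ι → Bool} (hc : PolyComp inp c) (hc' : PolyComp inp c') :
    PolyComp inp fun i => c i && c' i :=
  (hc.cond hc' (.const false)).congr fun i => by cases c i <;> rfl

theorem PolyComp.or {c c' : ι → Bool} (hc : PolyComp inp c) (hc' : PolyComp inp c') :
    PolyComp inp fun i => c i || c' i :=
  (hc.cond (.const true) hc').congr fun i => by cases c i <;> rfl

/-- Whether an encoding is a leaf can be tested. -/
theorem PolyComp.ofLeaf {f : ι → α} (hf : PolyComp inp f) (c : ι → Bool)
    (h : ∀ i, c i = false ↔ enc (f i) = .leaf) : PolyComp inp c := by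
  refine PolyTime.split hf ?_ ?_
  · refine PolyComp.congr (f := fun _ => true) (.const true) fun i => ?_
    have := mt (h i.1).1 i.2
    simpa using this
  · refine PolyComp.congr (f := fun _ => false) (.const false) fun i => ?_
    exact ((h i.1).2 i.2).symm

theorem PolyComp.isSome {f : ι → Option α} (hf : PolyComp inp f) :
    PolyComp inp fun i => (f i).isSome := by
  refine hf.ofLeaf _ fun i => ?_
  cases f i
  · exact ⟨fun _ => rfl, fun _ => rfl⟩
  · exact ⟨fun h => (by cases h), fun h => (by cases h)⟩

theorem PolyComp.isEmpty {f : ι → List α} (hf : PolyComp inp f) :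
    PolyComp inp fun i => (f i).isEmpty := by
  refine PolyComp.not (c := fun i => !(f i).isEmpty) (hf.ofLeaf _ fun i => ?_) |>.congr
    fun i => by simp
  cases f i
  · exact ⟨fun _ => rfl, fun _ => rfl⟩
  · exact ⟨fun h => (by cases h), fun h => (by cases h)⟩

/-- Case distinction on an optional value. -/
theorem PolyComp.optionCases {o : ι → Option α} {out : ι → β} (ho : PolyComp inp o)
    (hn : PolyComp (fun i : {i // o i = none} => inp i.1) (fun i => out i.1))
    (hs : PolyComp (fun x : {x : ι × α // o x.1 = Option.some x.2} => Tr.node (inp x.1.1) (enc x.1.2))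
      (fun x => out x.1.1)) :
    PolyComp inp out := by
  refine ho.isSome.split ?_ (hn.reindex fun i : {i // (o i).isSome = false} => ⟨i.1, by simpa using i.2⟩)
  have h := hs.reindex fun i : {i // (o i).isSome = true} =>
    (⟨(i.1, (o i.1).get i.2), by simp⟩ : {x : ι × α // o x.1 = Option.some x.2})
  refine PolyTime.trans ?_ h
  refine PolyTime.node .refl ?_
  have h2 := (PolyTime.left ho).reindex fun i : {i // (o i).isSome = true} => i.1
  refine h2.congr fun i => ?_
  obtain ⟨i, hi⟩ := i
  obtain ⟨a, ha⟩ := Option.isSome_iff_exists.1 hi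
  simp only [ha, Option.get_some]
  rfl

/-- The head of a list, as an optional value. -/
theorem PolyComp.head? {l : ι → List α} (hl : PolyComp inp l) :
    PolyComp inp fun i => (l i).head? := by
  refine hl.isEmpty.split ((PolyComp.const none).congr fun i => ?_) ?_
  · have := i.2
    simp only [List.isEmpty_iff] at this
    simp [this]
  · have h := PolyTime.node ((PolyTime.left hl).reindex fun i : {i // (l i).isEmpty = false} => i.1)
      .leaf
    refine h.congr fun i => ?_
    obtain ⟨i, hi⟩ := i
    cases h : l i with
    | nil => simp [h] at hi
    | cons a t => simp only [h]; rfl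

theorem enc_cons (a : α) (l : List α) : enc (a :: l) = Tr.node (enc a) (enc l) := rfl

theorem size_enc_mem {l : List α} {a : α} (h : a ∈ l) : (enc a).size ≤ (enc l).size := by
  induction l with
  | nil => simp at h
  | cons b l ih =>
    rw [enc_cons, Tr.size]
    rcases List.mem_cons.1 h with rfl | h
    · omega
    · have := ih h; omega

theorem size_enc_drop (l : List α) (k : ℕ) : (enc (l.drop k)).size ≤ (enc l).size := by
  induction l generalizing k with
  | nil => simp
  | cons b l ih =>
    cases k with
    | zero => simp
    | succ k =>
      have := ih k
      rw [enc_cons, Tr.size, List.drop_succ_cons]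
      omega

theorem length_le_size (l : List α) : l.length ≤ (enc l).size := by
  induction l with
  | nil => simp
  | cons b l ih => rw [enc_cons, Tr.size, List.length_cons]; omega

/-- Iteration over a list, if the sizes of the intermediate results are polynomially bounded. The
step may use the whole input. -/
theorem PolyComp.foldl {l : ι → List α} {b₀ : ι → β} {step : ι → β → α → β}
    (hl : PolyComp inp l) (hb : PolyComp inp b₀)
    (hstep : PolyComp (fun x : {x : ι × β × α // x.2.2 ∈ l x.1} =>
      Tr.node (inp x.1.1) (enc x.1.2)) fun x => step x.1.1 x.1.2.1 x.1.2.2)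
    (hsize : ∃ q : Polynomial ℕ, ∀ i k,
      (enc (((l i).take k).foldl (step i) (b₀ i))).size ≤ q.eval (inp i).size) :
    PolyComp inp fun i => (l i).foldl (step i) (b₀ i) := by
  obtain ⟨q, hq⟩ := hsize
  let st : ι → ℕ → Tr := fun i k =>
    .node (inp i) (.node (enc (((l i).take k).foldl (step i) (b₀ i))) (enc ((l i).drop k)))
  have h0 : PolyTime inp fun i => st i 0 := PolyTime.node .refl (PolyTime.node hb hl)
  have hloop : PolyTime (fun i => st i 0) fun i => st i (l i).length := by
    refine PolyTime.loop (cnd := fun i k => enc ((l i).drop k))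
      (q + Polynomial.X + Polynomial.X + 2) ?_ ?_ ?_ ?_ ?_ ?_
    · intro i
      have := length_le_size (l i)
      simp only [st, Polynomial.eval_add, Polynomial.eval_X, Tr.size, List.drop_zero]
      omega
    · intro i k _
      have h1 := hq i k
      have h2 := eval_mono q (show (inp i).size ≤ (st i 0).size by simp only [st, Tr.size]; omega)
      have h3 := size_enc_drop (l i) k
      simp only [Polynomial.eval_add, Polynomial.eval_X, Polynomial.eval_ofNat]
      have h4 : (st i k).size = (inp i).size + ((enc (((l i).take k).foldl (step i) (b₀ i))).size
        + (enc ((l i).drop k)).size + 1) + 1 := rfl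
      have h5 : (inp i).size + (enc (l i)).size ≤ (st i 0).size := by
        simp only [st, Tr.size, List.drop_zero]; omega
      omega
    · exact (PolyTime.refl (inp := fun x : {x : ι × ℕ // x.2 ≤ (l x.1).length} =>
        st x.1.1 x.1.2)).right.right
    · intro i; simp only [List.drop_length]; rfl
    · intro i k hk
      simp only [List.drop_eq_getElem_cons hk]
      exact fun h => (by cases h)
    · have hid := PolyTime.refl (inp := fun x : {x : ι × ℕ // x.2 < (l x.1).length} =>
        st x.1.1 x.1.2)
      have hh : ∀ x : {x : ι × ℕ // x.2 < (l x.1).length}, enc ((l x.1.1).drop x.1.2) =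
          Tr.node (enc ((l x.1.1)[x.1.2]'x.2)) (enc ((l x.1.1).drop (x.1.2 + 1))) := fun x => by
        rw [List.drop_eq_getElem_cons x.2]; rfl
      have e1 : PolyTime (fun x : {x : ι × ℕ // x.2 < (l x.1).length} => st x.1.1 x.1.2)
          (fun x => enc ((l x.1.1)[x.1.2]'x.2)) := by
        refine hid.right.right.left.congr fun x => ?_
        simp only [st, Tr.right_node, hh, Tr.left_node]
      have e2 : PolyTime (fun x : {x : ι × ℕ // x.2 < (l x.1).length} => st x.1.1 x.1.2)
          (fun x => enc ((l x.1.1).drop (x.1.2 + 1))) := by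
        refine hid.right.right.right.congr fun x => ?_
        simp only [st, Tr.right_node, hh]
      refine PolyTime.node hid.left (PolyTime.node ?_ e2)
      have h := hstep.reindex fun x : {x : ι × ℕ // x.2 < (l x.1).length} =>
        (⟨(x.1.1, ((l x.1.1).take x.1.2).foldl (step x.1.1) (b₀ x.1.1), (l x.1.1)[x.1.2]'x.2),
          List.getElem_mem _⟩ : {x : ι × β × α // x.2.2 ∈ l x.1})
      have h' := PolyTime.trans (PolyTime.node hid.left (PolyTime.node hid.right.left e1)) h
      refine h'.congr fun x => ?_
      simp only
      rw [List.take_succ_eq_append_getElem x.2, List.foldl_append]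
      rfl
  refine (h0.trans hloop).right.left.congr fun i => ?_
  simp only [st, Tr.right_node, Tr.left_node, List.take_length]

/-- Iteration over a list, if every step increases the size by a polynomially bounded amount. -/
theorem PolyComp.foldl_of_step_le {l : ι → List α} {b₀ : ι → β} {step : ι → β → α → β}
    (hl : PolyComp inp l) (hb : PolyComp inp b₀)
    (hstep : PolyComp (fun x : {x : ι × β × α // x.2.2 ∈ l x.1} =>
      Tr.node (inp x.1.1) (enc x.1.2)) fun x => step x.1.1 x.1.2.1 x.1.2.2)
    (hsize : ∃ q : Polynomial ℕ, ∀ i b, ∀ a ∈ l i,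
      (enc (step i b a)).size ≤ (enc b).size + q.eval (inp i).size) :
    PolyComp inp fun i => (l i).foldl (step i) (b₀ i) := by
  refine hl.foldl hb hstep ?_
  obtain ⟨q, hq⟩ := hsize
  obtain ⟨r, hr⟩ := PolyTime.size_le hb
  obtain ⟨r', hr'⟩ := PolyTime.size_le hl
  refine ⟨r + r' * q, fun i k => ?_⟩
  have key : ∀ (l' : List α), (∀ a ∈ l', a ∈ l i) → ∀ b,
      (enc (l'.foldl (step i) b)).size ≤ (enc b).size + l'.length * q.eval (inp i).size := by
    intro l'
    induction l' with
    | nil => intro _ b; simp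
    | cons a l' ih =>
      intro h b
      have h1 := ih (fun a ha => h a (List.mem_cons_of_mem _ ha)) (step i b a)
      have h2 := hq i b a (h a List.mem_cons_self)
      rw [List.foldl_cons, List.length_cons, add_mul, one_mul]
      omega
  have h1 := key ((l i).take k) (fun a ha => List.mem_of_mem_take ha) (b₀ i)
  have h2 : ((l i).take k).length ≤ r'.eval (inp i).size := by
    rw [List.length_take]
    exact (min_le_right _ _).trans ((length_le_size (l i)).trans (hr' i))
  have h3 := hr i
  have h4 := Nat.mul_le_mul_right (q.eval (inp i).size) h2
  simp only [Polynomial.eval_add, Polynomial.eval_mul]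
  omega

end typed

/-! ### Polynomial-time list and number operations -/

section sizes

variable {α β : Type} [Encode α] [Encode β]

theorem size_pair (a : α) (b : β) : (enc (a, b)).size = (enc a).size + (enc b).size + 1 := rfl

theorem size_cons (a : α) (l : List α) :
    (enc (a :: l)).size = (enc a).size + (enc l).size + 1 := rfl

theorem size_nil : (enc ([] : List α)).size = 1 := rfl

theorem size_bool (b : Bool) : (enc b).size ≤ 3 := by cases b <;> decide

theorem size_ordering (o : Ordering) : (enc o).size ≤ 5 := by cases o <;> decide

theorem size_nat (n : ℕ) : (enc n).size = 2 * n + 1 := by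
  induction n with
  | zero => rfl
  | succ n ih =>
    rw [show enc (n + 1) = Tr.node .leaf (enc n) from rfl, Tr.size, ih, Tr.size]; ring

theorem enc_replicate (n : ℕ) : enc (List.replicate n false) = enc n := by
  induction n with
  | zero => rfl
  | succ n ih => rw [List.replicate_succ, enc_cons, ih]; rfl

theorem size_take_add_drop (l : List α) (k : ℕ) :
    (enc (l.take k)).size + (enc (l.drop k)).size = (enc l).size + 1 := by
  induction l generalizing k with
  | nil => simp [size_nil]
  | cons a l ih =>
    cases k with
    | zero => simp [size_nil]; omega
    | succ k => rw [List.take_succ_cons, List.drop_succ_cons, size_cons, size_cons]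
                have := ih k; omega

end sizes

theorem foldl_cons_eq {α β : Type} (g : α → β) (l : List α) (r : List β) :
    l.foldl (fun b a => g a :: b) r = (l.map g).reverse ++ r := by
  induction l generalizing r with
  | nil => rfl
  | cons a l ih => simp [ih]

/-- One step in pairing the members of two lists. The state consists of the members of the second
list not yet used and of the pairs found so far. -/
def zipStep {α β : Type} (s : List β × List (α × β)) (a : α) : List β × List (α × β) :=
  match s.1.head? with
  | none => s
  | some b => (s.1.tail, (a, b) :: s.2)

theorem foldl_zipStep {α β : Type} (l : List α) (l' : List β) (o : List (α × β)) :
    (l.foldl zipStep (l', o)).2.reverse = o.reverse ++ l.zip l' := by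
  induction l generalizing l' o with
  | nil => simp
  | cons a l ih =>
    cases l' with
    | nil =>
      rw [List.foldl_cons, show zipStep ([], o) a = ([], o) from rfl, ih]
      simp
    | cons b l' =>
      rw [List.foldl_cons, show zipStep (b :: l', o) a = (l', (a, b) :: o) from rfl, ih]
      simp

section ops

variable {ι : Type} {inp : ι → Tr} {α β γ : Type} [Encode α] [Encode β] [Encode γ]

/-- The steps of iterations and the branches of case distinctions get the input `inp i` next to
further values. What is computed from `inp i` alone is still available there. -/
theorem PolyComp.atInput {κ : Type} {P : ι × κ → Prop} {r : κ → Tr} {f : ι → α}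
    (hf : PolyComp inp f) :
    PolyComp (fun x : {x : ι × κ // P x} => Tr.node (inp x.1.1) (r x.1.2)) fun x => f x.1.1 :=
  PolyTime.trans (PolyTime.refl.left.congr fun _ => rfl)
    (PolyTime.reindex hf fun x : {x : ι × κ // P x} => x.1.1)

theorem PolyComp.atValue {P : ι × α → Prop} :
    PolyComp (fun x : {x : ι × α // P x} => Tr.node (inp x.1.1) (enc x.1.2)) fun x => x.1.2 :=
  PolyTime.refl.right.congr fun _ => rfl

theorem PolyComp.atAcc {P : ι × α × β → Prop} :
    PolyComp (fun x : {x : ι × α × β // P x} => Tr.node (inp x.1.1) (enc x.1.2))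
      fun x => x.1.2.1 := PolyComp.atValue.fst

theorem PolyComp.atElem {P : ι × α × β → Prop} :
    PolyComp (fun x : {x : ι × α × β // P x} => Tr.node (inp x.1.1) (enc x.1.2))
      fun x => x.1.2.2 := PolyComp.atValue.snd

/-- The size of the results of an auxiliary computation on `inp i` and an element of a list that
is computed from `inp i`. -/
theorem PolyComp.size_elem_le {l : ι → List α} {g : ι → α → β} (hl : PolyComp inp l)
    (hg : PolyComp (fun x : {x : ι × α // x.2 ∈ l x.1} => Tr.node (inp x.1.1) (enc x.1.2))
      fun x => g x.1.1 x.1.2) :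
    ∃ q : Polynomial ℕ, ∀ i, ∀ a ∈ l i, (enc (g i a)).size ≤ q.eval (inp i).size := by
  obtain ⟨p, hp⟩ := PolyTime.size_le hl
  obtain ⟨q, hq⟩ := PolyTime.size_le hg
  refine ⟨q.comp (Polynomial.X + p + 1), fun i a ha => (hq ⟨(i, a), ha⟩).trans ?_⟩
  rw [Polynomial.eval_comp]
  refine eval_mono q ?_
  have h1 := hp i
  have h2 := size_enc_mem ha
  simp only [Polynomial.eval_add, Polynomial.eval_X, Polynomial.eval_one, Tr.size]
  omega

/-- The images of the members of a list, in reverse order. -/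
theorem PolyComp.mapReverse {l : ι → List α} {g : ι → α → β} (hl : PolyComp inp l)
    (hg : PolyComp (fun x : {x : ι × α // x.2 ∈ l x.1} => Tr.node (inp x.1.1) (enc x.1.2))
      fun x => g x.1.1 x.1.2) : PolyComp inp fun i => ((l i).map (g i)).reverse := by
  refine (hl.foldl_of_step_le (b₀ := fun _ => ([] : List β))
    (step := fun i b a => g i a :: b) (.const _) ?_ ?_).congr fun i => by
      rw [foldl_cons_eq, List.append_nil]
  · refine PolyComp.cons ?_ .atAcc
    have h := hg.reindex fun x : {x : ι × List β × α // x.2.2 ∈ l x.1} =>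
      (⟨(x.1.1, x.1.2.2), x.2⟩ : {x : ι × α // x.2 ∈ l x.1})
    exact PolyTime.trans (PolyTime.node PolyTime.refl.left (PolyComp.atElem)) h
  · obtain ⟨q, hq⟩ := hl.size_elem_le hg
    refine ⟨q + 1, fun i b a ha => ?_⟩
    have := hq i a ha
    rw [size_cons, Polynomial.eval_add, Polynomial.eval_one]
    omega

theorem PolyComp.reverse {l : ι → List α} (hl : PolyComp inp l) :
    PolyComp inp fun i => (l i).reverse :=
  (hl.mapReverse (g := fun _ a => a) .atValue).congr fun i => by simp

theorem PolyComp.map {l : ι → List α} {g : ι → α → β} (hl : PolyComp inp l)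
    (hg : PolyComp (fun x : {x : ι × α // x.2 ∈ l x.1} => Tr.node (inp x.1.1) (enc x.1.2))
      fun x => g x.1.1 x.1.2) : PolyComp inp fun i => (l i).map (g i) :=
  (hl.mapReverse hg).reverse.congr fun i => by simp

theorem PolyComp.append {l l' : ι → List α} (hl : PolyComp inp l) (hl' : PolyComp inp l') :
    PolyComp inp fun i => l i ++ l' i := by
  refine (hl.reverse.foldl_of_step_le (b₀ := l') (step := fun _ b a => a :: b) hl'
    (PolyComp.cons .atElem .atAcc) ?_).congr fun i => by
      rw [foldl_cons_eq (fun a => a)]; simp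
  obtain ⟨q, hq⟩ := PolyTime.size_le hl
  refine ⟨q + 1, fun i b a ha => ?_⟩
  have h1 := hq i
  have h2 := size_enc_mem (List.mem_reverse.1 ha)
  rw [size_cons, Polynomial.eval_add, Polynomial.eval_one]
  omega

theorem PolyComp.all {l : ι → List α} {g : ι → α → Bool} (hl : PolyComp inp l)
    (hg : PolyComp (fun x : {x : ι × α // x.2 ∈ l x.1} => Tr.node (inp x.1.1) (enc x.1.2))
      fun x => g x.1.1 x.1.2) : PolyComp inp fun i => (l i).all (g i) := by
  have h (i : ι) (l : List α) (b : Bool) :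
      l.foldl (fun b a => b && g i a) b = (b && l.all (g i)) := by
    induction l generalizing b with
    | nil => simp
    | cons a l ih => simp [ih, Bool.and_assoc]
  refine (hl.foldl_of_step_le (b₀ := fun _ => true) (step := fun i b a => b && g i a)
    (.const _) ?_ ⟨3, fun i b a _ => ?_⟩).congr fun _ => by rw [h]; simp
  · refine PolyComp.and .atAcc ?_
    have h := hg.reindex fun x : {x : ι × Bool × α // x.2.2 ∈ l x.1} =>
      (⟨(x.1.1, x.1.2.2), x.2⟩ : {x : ι × α // x.2 ∈ l x.1})
    exact PolyTime.trans (PolyTime.node PolyTime.refl.left (PolyComp.atElem)) h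
  · have := size_bool (b && g i a)
    simp only [Polynomial.eval_ofNat]
    omega

theorem PolyComp.replicate {n : ι → ℕ} (hn : PolyComp inp n) :
    PolyComp inp fun i => List.replicate (n i) false :=
  PolyTime.congr hn fun _ => (enc_replicate _).symm

theorem PolyComp.ofReplicate {n : ι → ℕ} (hn : PolyComp inp fun i => List.replicate (n i) false) :
    PolyComp inp n := PolyTime.congr hn fun _ => enc_replicate _

theorem PolyComp.length {l : ι → List α} (hl : PolyComp inp l) :
    PolyComp inp fun i => (l i).length :=
  .ofReplicate ((hl.map (g := fun _ _ => false) (.const false)).congr fun _ => by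
    rw [List.map_const'])

/-- Iteration of a step that increases the size by a polynomially bounded amount. -/
theorem PolyComp.iterate {n : ι → ℕ} {b₀ : ι → β} {step : ι → β → β} (hn : PolyComp inp n)
    (hb : PolyComp inp b₀)
    (hstep : PolyComp (fun x : {_x : ι × β // True} => Tr.node (inp x.1.1) (enc x.1.2))
      fun x => step x.1.1 x.1.2)
    (hsize : ∃ q : Polynomial ℕ, ∀ i b,
      (enc (step i b)).size ≤ (enc b).size + q.eval (inp i).size) :
    PolyComp inp fun i => (step i)^[n i] (b₀ i) := by
  have h (i : ι) (k : ℕ) (b : β) :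
      (List.replicate k false).foldl (fun b _ => step i b) b = (step i)^[k] b := by
    induction k generalizing b with
    | zero => rfl
    | succ k ih => simp [List.replicate_succ, ih]
  refine (hn.replicate.foldl_of_step_le (step := fun i b _ => step i b) hb ?_ ?_).congr
    fun i => h _ _ _
  · have h := hstep.reindex
      fun x : {x : ι × β × Bool // x.2.2 ∈ List.replicate (n x.1) false} =>
      (⟨(x.1.1, x.1.2.1), trivial⟩ : {x : ι × β // True})
    exact PolyTime.trans (PolyTime.node PolyTime.refl.left (PolyComp.atAcc)) h
  · obtain ⟨q, hq⟩ := hsize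
    exact ⟨q, fun i b _ _ => hq i b⟩

theorem size_tail_le (l : List α) : (enc l.tail).size ≤ (enc l).size := by
  rw [← List.drop_one]; exact size_enc_drop l 1

theorem PolyComp.drop {n : ι → ℕ} {l : ι → List α} (hn : PolyComp inp n) (hl : PolyComp inp l) :
    PolyComp inp fun i => (l i).drop (n i) := by
  refine (hn.iterate (step := fun _ b => b.tail) hl (PolyComp.tail .atValue)
    ⟨0, fun i b => (size_tail_le b).trans (Nat.le_add_right _ _)⟩).congr fun i => ?_
  generalize n i = k
  generalize l i = l
  induction k generalizing l with
  | zero => rfl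
  | succ k ih => rw [Function.iterate_succ_apply, ih]; cases l <;> simp

theorem PolyComp.sub {n m : ι → ℕ} (hn : PolyComp inp n) (hm : PolyComp inp m) :
    PolyComp inp fun i => n i - m i :=
  .ofReplicate ((hm.drop hn.replicate).congr fun i => by rw [List.drop_replicate])

theorem PolyComp.take {n : ι → ℕ} {l : ι → List α} (hn : PolyComp inp n) (hl : PolyComp inp l) :
    PolyComp inp fun i => (l i).take (n i) := by
  refine ((hl.length.sub hn).drop hl.reverse).reverse.congr fun i => ?_
  rw [List.reverse_drop, List.reverse_reverse, List.length_reverse]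
  by_cases h : n i ≤ (l i).length
  · rw [Nat.sub_sub_self h]
  · rw [List.take_of_length_le (by omega), List.take_of_length_le (by omega)]

theorem PolyComp.add {n m : ι → ℕ} (hn : PolyComp inp n) (hm : PolyComp inp m) :
    PolyComp inp fun i => n i + m i :=
  .ofReplicate ((hn.replicate.append hm.replicate).congr fun i => by
    rw [List.replicate_append_replicate])

theorem PolyComp.mul {n m : ι → ℕ} (hn : PolyComp inp n) (hm : PolyComp inp m) :
    PolyComp inp fun i => n i * m i := by
  obtain ⟨q, hq⟩ := PolyTime.size_le hm
  refine (hn.iterate (b₀ := fun _ => 0) (step := fun i b => b + m i) (.const 0)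
    (PolyComp.add .atValue hm.atInput) ⟨q, fun i b => ?_⟩).congr fun i => ?_
  · have := hq i
    rw [size_nat] at *
    rw [size_nat]
    omega
  · generalize n i = k
    induction k with
    | zero => simp
    | succ k ih => rw [Function.iterate_succ_apply', ih]; ring

theorem PolyComp.evalPoly {n : ι → ℕ} (hn : PolyComp inp n) (p : Polynomial ℕ) :
    PolyComp inp fun i => p.eval (n i) := by
  induction p using Polynomial.induction_on' with
  | add p q hp hq => exact (hp.add hq).congr fun i => by simp
  | monomial k a =>
    have h : PolyComp inp fun i => n i ^ k := by
      induction k with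
      | zero => exact (PolyComp.const 1).congr fun i => by simp
      | succ k ih => exact (ih.mul hn).congr fun i => by rw [pow_succ]
    exact ((PolyComp.const a).mul h).congr fun i => by simp

theorem PolyComp.decideLt {n m : ι → ℕ} (hn : PolyComp inp n) (hm : PolyComp inp m) :
    PolyComp inp fun i => decide (n i < m i) := by
  refine (hm.sub hn).ofLeaf _ fun i => ?_
  cases h : m i - n i with
  | zero => exact ⟨fun _ => rfl, fun _ => by simp; omega⟩
  | succ k =>
    refine ⟨fun h' => ?_, fun h' => by cases h'⟩
    simp only [decide_eq_false_iff_not] at h'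
    omega

theorem PolyComp.decideEq {n m : ι → ℕ} (hn : PolyComp inp n) (hm : PolyComp inp m) :
    PolyComp inp fun i => decide (n i = m i) := by
  refine ((hn.decideLt hm).or (hm.decideLt hn)).not.congr fun i => ?_
  rw [Bool.eq_iff_iff]
  simp
  omega

theorem PolyComp.half {n : ι → ℕ} (hn : PolyComp inp n) : PolyComp inp fun i => n i / 2 := by
  refine PolyComp.snd (f := fun i => (fun b : Bool × ℕ => (!b.1, bif b.1 then b.2 + 1 else b.2))^[n i]
    (false, 0)) (hn.iterate (.const _) ?_ ⟨4, fun i b => ?_⟩) |>.congr fun i => ?_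
  · exact PolyComp.pair (PolyComp.not (PolyComp.fst .atValue))
      (PolyComp.cond (PolyComp.fst .atValue) (PolyComp.succ (PolyComp.snd .atValue))
        (PolyComp.snd .atValue))
  · obtain ⟨b, m⟩ := b
    cases b <;> simp [size_pair, size_nat, show (enc true).size = 3 from rfl,
      show (enc false).size = 1 from rfl] <;> omega
  · have key : ∀ k : ℕ, (fun b : Bool × ℕ => (!b.1, bif b.1 then b.2 + 1 else b.2))^[k]
        (false, 0) = (decide (k % 2 = 1), k / 2) := by
      intro k
      induction k with
      | zero => rfl
      | succ k ih =>
        rw [Function.iterate_succ_apply', ih]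
        rcases Nat.mod_two_eq_zero_or_one k with h | h
        · simp [h]; omega
        · simp [h]; omega
    rw [key]

/-- One step of the computation of the rounded down binary logarithm by halving. -/
def logStep (b : ℕ × ℕ) : ℕ × ℕ := bif decide (1 < b.1) then (b.1 / 2, b.2 + 1) else b

theorem logStep_iterate (k n : ℕ) (b : ℕ) (h : n ≤ k + 1) :
    (logStep^[k] (n, b)).2 = b + Nat.log 2 n := by
  induction k generalizing n b with
  | zero => simp [Nat.log_of_lt (show n < 2 by omega)]
  | succ k ih =>
    rw [Function.iterate_succ_apply]
    by_cases h1 : 1 < n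
    · rw [show logStep (n, b) = (n / 2, b + 1) by simp [logStep, h1], ih _ _ (by omega),
        Nat.log_of_one_lt_of_le (by norm_num) (show 2 ≤ n by omega)]
      ring
    · rw [show logStep (n, b) = (n, b) by simp [logStep, h1], ih _ _ (by omega)]

theorem PolyComp.log {n : ι → ℕ} (hn : PolyComp inp n) :
    PolyComp inp fun i => Nat.log 2 (n i) := by
  refine PolyComp.snd (f := fun i => logStep^[n i] (n i, 0))
    (hn.iterate (hn.pair (.const 0)) ?_ ⟨2, fun i b => ?_⟩) |>.congr fun i => ?_
  · have h1 : PolyComp (fun x : {x : ι × ℕ × ℕ // True} => Tr.node (inp x.1.1) (enc x.1.2))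
      fun x => x.1.2 := .atValue
    exact PolyComp.cond (PolyComp.decideLt (.const 1) h1.fst)
      (PolyComp.pair h1.fst.half h1.snd.succ) h1
  · obtain ⟨a, b⟩ := b
    by_cases h : 1 < a
    · simp [logStep, h, size_pair, size_nat]; omega
    · simp [logStep, h]
  · rw [logStep_iterate _ _ _ (Nat.le_succ _), zero_add]

/-! ### Polynomial-time operations on bit strings -/

/-- The number with the given binary digits, the least significant one first. -/
def bitsVal : List Bool → ℕ
  | [] => 0
  | b :: l => b.toNat + 2 * bitsVal l

theorem bitsVal_lt (l : List Bool) : bitsVal l < 2 ^ l.length := by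
  induction l with
  | nil => simp [bitsVal]
  | cons b l ih => simp only [bitsVal, List.length_cons, pow_succ]; cases b <;> (simp; omega)

theorem bitsVal_drop (l : List Bool) (k : ℕ) : bitsVal (l.drop k) = bitsVal l / 2 ^ k := by
  induction l generalizing k with
  | nil => simp [bitsVal]
  | cons b l ih =>
    cases k with
    | zero => simp
    | succ k =>
      rw [List.drop_succ_cons, ih, bitsVal, pow_succ', ← Nat.div_div_eq_div_mul]
      congr 1
      cases b
      · simp
      · simp
        omega

theorem bitsVal_eq_foldl (l : List Bool) :
    l.reverse.foldl (fun (n : ℕ) b => b.toNat + (n + n)) 0 = bitsVal l := by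
  induction l with
  | nil => rfl
  | cons b l ih => rw [List.reverse_cons, List.foldl_append, ih, bitsVal]; simp; ring

/-- Binary numbers of logarithmic length can be written in unary. -/
theorem PolyComp.bitsVal {l : ι → List Bool} (hl : PolyComp inp l)
    (h : ∃ q : Polynomial ℕ, ∀ i, 2 ^ (l i).length ≤ q.eval (inp i).size) :
    PolyComp inp fun i => bitsVal (l i) := by
  refine (hl.reverse.foldl (b₀ := fun _ => (0 : ℕ)) (step := fun _ n b => b.toNat + (n + n))
    (.const 0) ?_ ?_).congr fun i => bitsVal_eq_foldl _
  · refine PolyComp.add ?_ (PolyComp.add .atAcc .atAcc)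
    refine (PolyComp.cond PolyComp.atElem (.const 1) (.const 0)).congr fun i => ?_
    cases i.1.2.2 <;> rfl
  · obtain ⟨q, hq⟩ := h
    refine ⟨q + q + 1, fun i k => ?_⟩
    have h1 := bitsVal_eq_foldl ((l i).reverse.take k).reverse
    rw [List.reverse_reverse] at h1
    rw [h1, size_nat]
    have h2 := bitsVal_lt ((l i).reverse.take k).reverse
    have h3 : 2 ^ ((l i).reverse.take k).reverse.length ≤ 2 ^ (l i).length :=
      Nat.pow_le_pow_right (by norm_num) (by simp)
    have h4 := hq i
    simp only [Polynomial.eval_add, Polynomial.eval_one]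
    omega

theorem PolyComp.isLt {f : ι → Ordering} (hf : PolyComp inp f) :
    PolyComp inp fun i => f i == .lt := by
  refine PolyComp.not (c := fun i => !(f i == .lt)) (hf.ofLeaf _ fun i => ?_) |>.congr
    fun i => by simp
  cases f i
  · exact ⟨fun _ => rfl, fun _ => rfl⟩
  · exact ⟨fun h => (by cases h), fun h => (by cases h)⟩
  · exact ⟨fun h => (by cases h), fun h => (by cases h)⟩

theorem PolyComp.isEq {f : ι → Ordering} (hf : PolyComp inp f) :
    PolyComp inp fun i => f i == .eq := by
  have h : PolyComp inp fun i => f i == .gt := by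
    refine PolyComp.ofLeaf (α := Tr) (f := fun i => (enc (f i)).right) (PolyTime.right hf) _
      fun i => ?_
    cases f i
    · exact ⟨fun _ => rfl, fun _ => rfl⟩
    · exact ⟨fun _ => rfl, fun _ => rfl⟩
    · exact ⟨fun h => (by cases h), fun h => (by cases h)⟩
  exact (hf.isLt.or h).not.congr fun i => by cases f i <;> rfl

/-- One step in the comparison of two bit strings. The state consists of the part of the second
string not yet read and of the result of the comparison of the parts that were read. -/
def cmpStep (s : List Bool × Ordering) (a : Bool) : List Bool × Ordering :=
  match s.1.head? with
  | none => ([], .gt)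
  | some b => (s.1.tail, bif a then (bif b then s.2 else .gt) else bif b then .lt else s.2)

/-- Comparison of bit strings, where later bits are more significant. -/
def cmpBits (l l' : List Bool) : Ordering :=
  bif (l.foldl cmpStep (l', .eq)).1.isEmpty then (l.foldl cmpStep (l', .eq)).2 else .lt

theorem cmpStep_foldl_nil (l : List Bool) : l.foldl cmpStep ([], .gt) = ([], .gt) := by
  induction l with
  | nil => rfl
  | cons a l ih => exact ih

theorem foldl_cmpStep_eq (l l' : List Bool) (o : Ordering) :
    l.foldl cmpStep (l', o) = ([], .eq) ↔ l = l' ∧ o = .eq := by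
  induction l generalizing l' o with
  | nil => simp [eq_comm]
  | cons a l ih =>
    cases l' with
    | nil =>
      rw [List.foldl_cons, show cmpStep ([], o) a = ([], .gt) from rfl, cmpStep_foldl_nil]
      simp
    | cons b l' =>
      rw [List.foldl_cons, cmpStep]
      simp only [List.head?_cons, List.tail_cons]
      rw [ih]
      cases a <;> cases b <;> simp

theorem cmpBits_eq (l l' : List Bool) : cmpBits l l' = .eq ↔ l = l' := by
  have := foldl_cmpStep_eq l l' .eq
  rw [cmpBits]
  generalize l.foldl cmpStep (l', .eq) = s at *
  obtain ⟨r, o⟩ := s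
  cases r <;> simp_all

theorem foldl_cmpStep_lt (l l' : List Bool) (h : l.length = l'.length) (o : Ordering) :
    (l.foldl cmpStep (l', o)).1 = [] ∧ ((l.foldl cmpStep (l', o)).2 = .lt ↔
      bitsVal l < bitsVal l' ∨ (bitsVal l = bitsVal l' ∧ o = .lt)) := by
  induction l generalizing l' o with
  | nil =>
    obtain rfl : l' = [] := by simpa using h.symm
    simp
  | cons a l ih =>
    cases l' with
    | nil => simp at h
    | cons b l' =>
      rw [List.foldl_cons, cmpStep]
      simp only [List.head?_cons, List.tail_cons]
      refine ⟨(ih l' (by simpa using h) _).1, ?_⟩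
      rw [(ih l' (by simpa using h) _).2, bitsVal, bitsVal]
      cases a <;> cases b <;> simp <;> omega

theorem cmpBits_lt (l l' : List Bool) (h : l.length = l'.length) :
    cmpBits l l' = .lt ↔ bitsVal l < bitsVal l' := by
  have := foldl_cmpStep_lt l l' h .eq
  rw [cmpBits, this.1]
  simp [this.2]

theorem PolyComp.cmpBits {l l' : ι → List Bool} (hl : PolyComp inp l) (hl' : PolyComp inp l') :
    PolyComp inp fun i => cmpBits (l i) (l' i) := by
  have hf : PolyComp inp fun i => (l i).foldl cmpStep (l' i, .eq) := by
    refine hl.foldl_of_step_le (step := fun _ => cmpStep) (hl'.pair (.const _)) ?_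
      ⟨5, fun i b a _ => ?_⟩
    · have hacc : PolyComp (fun x : {x : ι × (List Bool × Ordering) × Bool // x.2.2 ∈ l x.1} =>
          Tr.node (inp x.1.1) (enc x.1.2)) fun x => x.1.2.1 := .atAcc
      refine hacc.fst.head?.optionCases ((PolyComp.const ([], Ordering.gt)).congr fun x => ?_) ?_
      · simp only [cmpStep, x.2]
      · have hb := PolyComp.atValue (inp := fun x : {x : ι × (List Bool × Ordering) × Bool //
            x.2.2 ∈ l x.1} => Tr.node (inp x.1.1) (enc x.1.2)) (P := fun x :
            {x : ι × (List Bool × Ordering) × Bool // x.2.2 ∈ l x.1} × Bool =>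
              x.1.1.2.1.1.head? = Option.some x.2)
        refine (hacc.fst.tail.atInput.pair (PolyComp.cond (PolyComp.atElem.atInput)
          (hb.cond hacc.snd.atInput (.const Ordering.gt))
          (hb.cond (.const Ordering.lt) hacc.snd.atInput))).congr fun x => ?_
        simp only [cmpStep, x.2]
    · obtain ⟨r, o⟩ := b
      cases r with
      | nil =>
        rw [show cmpStep ([], o) a = ([], .gt) from rfl, size_pair, size_pair]
        have := size_ordering Ordering.gt
        simp only [Polynomial.eval_ofNat]; omega
      | cons b r =>
        rw [cmpStep]
        simp only [List.head?_cons, List.tail_cons, size_pair, size_cons, Polynomial.eval_ofNat]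
        have := size_ordering (bif a then (bif b then o else Ordering.gt) else bif b then Ordering.lt else o)
        omega
  exact hf.fst.isEmpty.cond hf.snd (.const Ordering.lt)

/-- The first `n` consecutive pieces of length `d` of a list. -/
def chunks (d : ℕ) : ℕ → List α → List (List α)
  | 0, _ => []
  | n + 1, l => l.take d :: chunks d n (l.drop d)

theorem PolyComp.chunks {d n : ι → ℕ} {l : ι → List α} (hd : PolyComp inp d)
    (hn : PolyComp inp n) (hl : PolyComp inp l) :
    PolyComp inp fun i => chunks (d i) (n i) (l i) := by
  refine (PolyComp.reverse (PolyComp.snd (hn.iterate (b₀ := fun i => (l i, ([] : List (List α))))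
    (step := fun i b => (b.1.drop (d i), b.1.take (d i) :: b.2)) (hl.pair (.const [])) ?_
    ⟨2, fun i b => ?_⟩))).congr fun i => ?_
  · have h1 : PolyComp (fun x : {x : ι × List α × List (List α) // True} =>
      Tr.node (inp x.1.1) (enc x.1.2)) fun x => x.1.2 := .atValue
    exact (hd.atInput.drop h1.fst).pair ((hd.atInput.take h1.fst).cons h1.snd)
  · have := size_take_add_drop b.1 (d i)
    obtain ⟨a, b⟩ := b
    simp only [size_pair, size_cons, Polynomial.eval_ofNat] at *
    omega
  · have key : ∀ (k : ℕ) (r : List α) (o : List (List α)),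
        (((fun b : List α × List (List α) => (b.1.drop (d i), b.1.take (d i) :: b.2))^[k]
          (r, o)).2).reverse = o.reverse ++ LeakyThr.chunks (d i) k r := by
      intro k
      induction k with
      | zero => intro r o; simp [LeakyThr.chunks]
      | succ k ih =>
        intro r o
        rw [Function.iterate_succ_apply, ih, LeakyThr.chunks]
        simp
    simpa using key (n i) (l i) []

theorem PolyComp.zip {l : ι → List α} {l' : ι → List β} (hl : PolyComp inp l)
    (hl' : PolyComp inp l') : PolyComp inp fun i => (l i).zip (l' i) := by
  obtain ⟨q, hq⟩ := PolyTime.size_le hl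
  refine (PolyComp.reverse (PolyComp.snd (hl.foldl_of_step_le
    (b₀ := fun i => (l' i, ([] : List (α × β)))) (step := fun _ => zipStep)
    (hl'.pair (.const [])) ?_ ⟨q + 2, fun i b a ha => ?_⟩))).congr fun i => by
      rw [foldl_zipStep]; simp
  · have hacc : PolyComp (fun x : {x : ι × (List β × List (α × β)) × α // x.2.2 ∈ l x.1} =>
        Tr.node (inp x.1.1) (enc x.1.2)) fun x => x.1.2.1 := .atAcc
    refine hacc.fst.head?.optionCases ((hacc.reindex _).congr fun x => ?_) ?_
    · simp only [zipStep, x.2]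
    · have hb := PolyComp.atValue (inp := fun x : {x : ι × (List β × List (α × β)) × α //
          x.2.2 ∈ l x.1} => Tr.node (inp x.1.1) (enc x.1.2)) (P := fun x :
          {x : ι × (List β × List (α × β)) × α // x.2.2 ∈ l x.1} × β =>
            x.1.1.2.1.1.head? = Option.some x.2)
      refine (hacc.fst.tail.atInput.pair
        ((PolyComp.atElem.atInput.pair hb).cons hacc.snd.atInput)).congr fun x => ?_
      simp only [zipStep, x.2]
  · have h1 := hq i
    have h2 := size_enc_mem ha
    obtain ⟨r, o⟩ := b
    cases r with
    | nil => rw [show zipStep ([], o) a = ([], o) from rfl]; omega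
    | cons b r =>
      rw [show zipStep (b :: r, o) a = (r, (a, b) :: o) from rfl]
      simp only [size_pair, size_cons, Polynomial.eval_ofNat, Polynomial.eval_add]
      omega

end ops

/-! ### Probabilities as finite averages -/

section prob

open Classical in
/-- Indicator of a proposition. -/
noncomputable def ind (p : Prop) : ℝ := if p then 1 else 0

theorem ind_true {p : Prop} (h : p) : ind p = 1 := by simp [ind, h]
theorem ind_false {p : Prop} (h : ¬ p) : ind p = 0 := by simp [ind, h]
theorem of_ind_eq_one {p : Prop} (h : ind p = 1) : p := by
  by_contra hp
  rw [ind_false hp] at h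
  norm_num at h

theorem ind_nonneg (p : Prop) : 0 ≤ ind p := by unfold ind; split_ifs <;> norm_num
theorem ind_le_one (p : Prop) : ind p ≤ 1 := by unfold ind; split_ifs <;> norm_num

variable {A B M : Type} [Fintype A] [Fintype B]

theorem prob_pure {α : Type} (a : α) (T : Set α) : prob (PMF.pure a) T = ind (a ∈ T) := by
  classical
  rw [prob, PMF.toOuterMeasure_pure_apply, ind]
  split_ifs <;> simp

theorem prob_nonneg {α : Type} (μ : PMF α) (T : Set α) : 0 ≤ prob μ T := ENNReal.toReal_nonneg

theorem toOuterMeasure_le_one {α : Type} (μ : PMF α) (T : Set α) : μ.toOuterMeasure T ≤ 1 :=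
  (MeasureTheory.measure_mono (Set.subset_univ T)).trans
    (by rw [PMF.toOuterMeasure_apply]; simp [μ.tsum_coe])

theorem prob_le_one {α : Type} (μ : PMF α) (T : Set α) : prob μ T ≤ 1 :=
  ENNReal.toReal_le_of_le_ofReal zero_le_one (by simpa using toOuterMeasure_le_one μ T)

theorem prob_uniform_bind [Nonempty A] {α : Type} (f : A → PMF α) (T : Set α) :
    prob ((PMF.uniformOfFintype A).bind f) T = 𝔼 a, prob (f a) T := by
  rw [prob, PMF.toOuterMeasure_bind_apply, tsum_fintype, ENNReal.toReal_sum,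
    Fintype.expect_eq_sum_div_card, Finset.sum_div]
  · refine Finset.sum_congr rfl fun a _ => ?_
    rw [ENNReal.toReal_mul, PMF.uniformOfFintype_apply, ENNReal.toReal_inv,
      ENNReal.toReal_natCast, prob, div_eq_inv_mul]
  · intro a _
    refine ENNReal.mul_ne_top ?_ ?_
    · exact PMF.apply_ne_top _ _
    · exact ((toOuterMeasure_le_one _ _).trans_lt ENNReal.one_lt_top).ne

theorem prob_uniform_map [Nonempty A] {α : Type} (f : A → α) (T : Set α) :
    prob ((PMF.uniformOfFintype A).map f) T = 𝔼 a, ind (f a ∈ T) := by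
  rw [← PMF.bind_pure_comp, prob_uniform_bind]
  simp [prob_pure]

theorem prob_uniform_map_bind [Nonempty A] {α β : Type} (f : A → α) (g : α → PMF β) (T : Set β) :
    prob (((PMF.uniformOfFintype A).map f).bind g) T = 𝔼 a, prob (g (f a)) T := by
  rw [PMF.bind_map, prob_uniform_bind]
  rfl

theorem expect_prod (f : A × B → ℝ) : 𝔼 x, f x = 𝔼 a, 𝔼 b, f (a, b) := by
  rw [← Finset.expect_product, Finset.univ_product_univ]

theorem expect_cons {n : ℕ} (f : (Fin (n + 1) → A) → ℝ) :
    𝔼 v, f v = 𝔼 a, 𝔼 v : Fin n → A, f (Fin.cons a v) := by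
  rw [← expect_prod fun x : A × (Fin n → A) => f (Fin.cons x.1 x.2)]
  exact (Fintype.expect_equiv (Fin.consEquiv fun _ => A) _ _ fun _ => rfl).symm

theorem expect_mono {f g : A → ℝ} (h : ∀ a, f a ≤ g a) : 𝔼 a, f a ≤ 𝔼 a, g a :=
  Finset.expect_le_expect fun a _ => h a

theorem expect_nonneg' {f : A → ℝ} (h : ∀ a, 0 ≤ f a) : 0 ≤ 𝔼 a, f a :=
  Finset.expect_nonneg fun a _ => h a

theorem eq_one_of_expect [Nonempty A] {f : A → ℝ} (h1 : ∀ a, f a ≤ 1) (h : 𝔼 a, f a = 1) (a : A) :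
    f a = 1 := by
  have h2 : 𝔼 a, (1 - f a) = 0 := by
    rw [Finset.expect_sub_distrib, h, Fintype.expect_const]; norm_num
  rw [Fintype.expect_eq_sum_div_card, div_eq_zero_iff] at h2
  have h3 : (Fintype.card A : ℝ) ≠ 0 := by exact_mod_cast Fintype.card_ne_zero
  have h4 := (Finset.sum_eq_zero_iff_of_nonneg fun a _ => by linarith [h1 a]).1
    (h2.resolve_right h3) a (Finset.mem_univ _)
  linarith

theorem prob_indep_bind [Nonempty A] {α β : Type} {n : ℕ} (g : Fin n → A → α) (F : (Fin n → α) → PMF β)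
    (T : Set β) :
    prob ((indep n fun i => (PMF.uniformOfFintype A).map (g i)).bind F) T =
      𝔼 v : Fin n → A, prob (F fun i => g i (v i)) T := by
  induction n with
  | zero =>
    rw [indep, PMF.pure_bind]
    have : ∀ v : Fin 0 → A, prob (F fun i => g i (v i)) T = prob (F Fin.elim0) T := fun v => by
      congr 2
      exact Subsingleton.elim _ _
    simp only [this, Fintype.expect_const]
  | succ n ih =>
    rw [indep, PMF.bind_bind, prob_uniform_map_bind, expect_cons]
    refine Finset.expect_congr rfl fun a _ => ?_
    rw [PMF.bind_map, ih (fun i => g i.succ)]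
    refine Finset.expect_congr rfl fun v _ => ?_
    rw [Function.comp_apply]
    congr 2
    funext i
    refine Fin.cases ?_ (fun i => ?_) i <;> simp

/-- Average of `F` over lists that arise from a list `l` by applying `E` with independent uniform
coins to the members. -/
noncomputable def listAvg {α : Type} (E : M → A → α) : List M → (List α → ℝ) → ℝ
  | [], F => F []
  | m :: l, F => 𝔼 a, listAvg E l fun c => F (E m a :: c)

theorem prob_indep_list [Nonempty A] {α β : Type} (E : M → A → α) (l : List M) (G : List α → β) (T : Set β) :
    prob ((indep l.length fun i => (PMF.uniformOfFintype A).map (E (l.get i))).map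
      fun c => G (List.ofFn c)) T = listAvg E l fun c => ind (G c ∈ T) := by
  induction l generalizing G with
  | nil =>
    rw [listAvg]
    change prob (PMF.map _ (PMF.pure Fin.elim0)) T = _
    rw [PMF.pure_map, prob_pure]
    rfl
  | cons m l ih =>
    change prob (PMF.map _ (PMF.bind _ _)) T = _
    rw [PMF.map_bind, prob_uniform_map_bind, listAvg]
    refine Finset.expect_congr rfl fun a _ => ?_
    rw [PMF.map_comp]
    have := ih fun c => G (E m a :: c)
    rw [← this]
    congr 2
    funext v
    simp [List.ofFn_succ]

theorem listAvg_map {α M' : Type} (E : M → A → α) (g : M' → M) (l : List M')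
    (F : List α → ℝ) : listAvg E (l.map g) F = listAvg (fun m => E (g m)) l F := by
  induction l generalizing F with
  | nil => rfl
  | cons m l ih => simp only [List.map_cons, listAvg, ih]

theorem listAvg_ofFn {α : Type} (E : M → A → α) {n : ℕ} (v : Fin n → M) (F : List α → ℝ) :
    listAvg E (List.ofFn v) F = 𝔼 w : Fin n → A, F (List.ofFn fun i => E (v i) (w i)) := by
  induction n generalizing F with
  | zero => simp [listAvg]
  | succ n ih =>
    rw [List.ofFn_succ, listAvg, expect_cons]
    refine Finset.expect_congr rfl fun a _ => ?_
    rw [ih]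
    refine Finset.expect_congr rfl fun w _ => ?_
    rw [List.ofFn_succ]
    simp

end prob

/-! ### Correctness for all coins -/

namespace FRE

variable {F : FRE}

theorem CorrectDecryption.dec_enc (h : F.CorrectDecryption) (l d : ℕ) (m : Msg d)
    (r : Fin (F.genCoins.eval (l + d)) → Bool) (s : Fin (F.encCoins.eval (l + d)) → Bool) :
    F.Dec l d (F.Gen l d r).1 (F.Enc l d (F.Gen l d r).1 m s) = some m := by
  have h1 := h l d m
  rw [genDist, coinFlips, prob_uniform_map_bind] at h1
  have h2 := eq_one_of_expect (fun r => prob_le_one _ _) h1 r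
  rw [encDist, coinFlips, PMF.map_comp, prob_uniform_map] at h2
  exact of_ind_eq_one (eq_one_of_expect (fun r => ind_le_one _) h2 s)

theorem CorrectEvaluation.eval_eq {leak : ℕ → ℕ → ℕ → Leak} (h : F.CorrectEvaluation leak)
    (l d : ℕ) (r : Fin (F.genCoins.eval (l + d)) → Bool) (c₀ c₁ c₂ : F.ciphers l d) :
    F.Eval l d (F.Gen l d r).2 c₀ c₁ c₂ = F.evalCiph leak l d (F.Gen l d r).1 c₀ c₁ c₂ := by
  have h1 := h l d c₀ c₁ c₂
  rw [genDist, coinFlips, prob_uniform_map] at h1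
  exact of_ind_eq_one (eq_one_of_expect (fun r => ind_le_one _) h1 r)

end FRE

/-! ### The online learner -/

theorem PolyTime.congrInput {ι : Type} {inp inp' out : ι → Tr} (h : PolyTime inp out)
    (he : ∀ i, inp i = inp' i) : PolyTime inp' out := by
  rwa [show inp' = inp from funext fun i => (he i).symm]

section online

variable (F : FRE) (lam : ℕ → ℕ)

/-- Memory of the online learner: nothing before the first positive example. After it, the public
parameters of the target, a ciphertext that is known to decrypt to a plaintext below the
threshold and, possibly, one that is known to decrypt to a plaintext not below the threshold. -/
abbrev Memory (d : ℕ) : Type :=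
  Option (F.params (lam d) d × F.ciphers (lam d) d × Option (F.ciphers (lam d) d))

/-- The prediction after the first positive example. Between the two known ciphertexts, the
label of the one that is closer in floor-log distance is predicted. -/
def guessKnown (d : ℕ)
    (m : F.params (lam d) d × F.ciphers (lam d) d × Option (F.ciphers (lam d) d))
    (x : F.ciphers (lam d) d × F.params (lam d) d) : Bool :=
  bif cmpBits x.2.1 m.1.1 == .eq then
    match F.Eval (lam d) d m.1 m.2.1 x.1 (m.2.2.getD x.1) with
    | none => false
    | some k => !(k.1 == .lt) || (!m.2.2.isSome || ((k.2.1 == .lt) && k.2.2.2))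
  else false

/-- The prediction of the online learner. -/
def onlineGuess (d : ℕ) (s : Memory F lam d) (x : F.ciphers (lam d) d × F.params (lam d) d) :
    Bool :=
  match s with
  | none => false
  | some m => guessKnown F lam d m x

/-- The online learner changes its memory only when it has made a mistake. -/
def onlineUpdate (d : ℕ) (s : Memory F lam d) (x : F.ciphers (lam d) d × F.params (lam d) d)
    (y : Bool) : Memory F lam d :=
  bif onlineGuess F lam d s x == y then s else
    match s with
    | none => some (x.2, x.1, none)
    | some m => bif y then some (m.1, x.1, m.2.2) else some (m.1, m.2.1, some x.1)

/-- Inputs to `guessKnown`. -/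
abbrev GuessIdx : Type := (d : ℕ) ×
  ((F.params (lam d) d × F.ciphers (lam d) d × Option (F.ciphers (lam d) d)) ×
    (F.ciphers (lam d) d × F.params (lam d) d))

theorem guessKnown_polyTime : PolyComp
    (fun j : GuessIdx F lam =>
      Tr.node (.node (enc (lam j.1, j.1)) (.node (enc j.2.1) .leaf)) (enc j.2.2))
    (fun j => guessKnown F lam j.1 j.2.1 j.2.2) := by
  set inp : GuessIdx F lam → Tr := fun j =>
    Tr.node (.node (enc (lam j.1, j.1)) (.node (enc j.2.1) .leaf)) (enc j.2.2) with hinp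
  have hid : PolyTime inp inp := .refl
  have hl : PolyComp inp fun j => lam j.1 := hid.left.left.left.congr fun _ => rfl
  have hd : PolyComp inp fun j => j.1 := hid.left.left.right.congr fun _ => rfl
  have hq : PolyComp inp fun j => j.2.1.1.1 := hid.left.right.left.left.congr fun _ => rfl
  have hlo : PolyComp inp fun j => j.2.1.2.1.1 :=
    hid.left.right.left.right.left.congr fun _ => rfl
  have hhi : PolyComp inp fun j => j.2.1.2.2.map Subtype.val :=
    hid.left.right.left.right.right.congr fun j => by
      simp only [hinp]
      cases h : j.2.1.2.2 <;>
      · rw [show j.2.1 = (j.2.1.1, j.2.1.2.1, j.2.1.2.2) from rfl, h]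
        rfl
  have hx : PolyComp inp fun j => j.2.2.1.1 := hid.right.left.congr fun _ => rfl
  have hxq : PolyComp inp fun j => j.2.2.2.1 := hid.right.right.congr fun _ => rfl
  have hhi' : PolyComp inp fun j => (j.2.1.2.2.getD j.2.2.1).1 := by
    refine hhi.optionCases ((hx.reindex _).congr fun j => ?_) (PolyComp.atValue.congr fun x => ?_)
    · have := j.2
      simp only [Option.map_eq_none_iff] at this
      simp [this]
    · have := x.2
      obtain ⟨c, hc, hc'⟩ := Option.map_eq_some_iff.1 this
      simp [hc, hc']
  have heval : PolyComp inp fun j =>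
      F.Eval (lam j.1) j.1 j.2.1.1 j.2.1.2.1 j.2.2.1 (j.2.1.2.2.getD j.2.2.1) :=
    PolyTime.trans (hl.pair (hd.pair (hq.pair (hlo.pair (hx.pair hhi')))))
      (F.eval_polyTime.reindex fun j : GuessIdx F lam =>
        ⟨lam j.1, j.1, j.2.1.1, j.2.1.2.1, j.2.2.1, j.2.1.2.2.getD j.2.2.1⟩)
  refine PolyComp.cond (hxq.cmpBits hq).isEq ?_ (.const false)
  refine heval.optionCases ((PolyComp.const false).congr fun j => by simp only [j.2]) ?_
  have hk := PolyComp.atValue (inp := inp) (P := fun x : GuessIdx F lam × Leak =>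
    F.Eval (lam x.1.1) x.1.1 x.1.2.1.1 x.1.2.1.2.1 x.1.2.2.1 (x.1.2.1.2.2.getD x.1.2.2.1) =
      some x.2)
  refine (hk.fst.isLt.not.or (hhi.isSome.atInput.not.or
    (hk.snd.fst.isLt.and hk.snd.snd.snd))).congr fun x => ?_
  simp only [x.2, Option.isSome_map]

theorem onlineGuess_polyTime : PolyComp
    (fun i : (d : ℕ) × (Memory F lam d × (F.ciphers (lam d) d × F.params (lam d) d)) =>
      Tr.node (.node (enc (lam i.1, i.1)) (enc i.2.1)) (enc i.2.2))
    (fun i => onlineGuess F lam i.1 i.2.1 i.2.2) := by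
  refine PolyTime.split PolyTime.refl.left.right ?_ ?_
  · have hne (i : {i : (d : ℕ) × (Memory F lam d × (F.ciphers (lam d) d × F.params (lam d) d)) //
        enc i.2.1 ≠ Tr.leaf}) : i.1.2.1.isSome := by
      obtain ⟨⟨d, s, x⟩, h⟩ := i
      cases s
      · exact (h rfl).elim
      · rfl
    refine (((guessKnown_polyTime F lam).reindex fun i =>
      ⟨i.1.1, i.1.2.1.get (hne i), i.1.2.2⟩).congr fun i => ?_).congrInput fun i => ?_
    all_goals
      obtain ⟨⟨d, s, x⟩, h⟩ := i
      cases s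
      · exact (h rfl).elim
      · rfl
  · refine (polyTime_const (enc false)).congr fun i => ?_
    obtain ⟨⟨d, s, x⟩, h⟩ := i
    cases s
    · rfl
    · cases h

theorem onlineUpdate_polyTime : PolyTime
    (fun i : (d : ℕ) × (Memory F lam d × (F.ciphers (lam d) d × F.params (lam d) d) × Bool) =>
      Tr.node (.node (enc (lam i.1, i.1)) (enc i.2.1)) (enc i.2.2))
    (fun i => Tr.node (enc (lam i.1, i.1)) (enc (onlineUpdate F lam i.1 i.2.1 i.2.2.1 i.2.2.2))) := by
  set inp := fun i : (d : ℕ) × (Memory F lam d × (F.ciphers (lam d) d × F.params (lam d) d) ×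
    Bool) => Tr.node (.node (enc (lam i.1, i.1)) (enc i.2.1)) (enc i.2.2) with hinp
  have hid : PolyTime inp inp := .refl
  have hg : PolyComp inp fun i => onlineGuess F lam i.1 i.2.1 i.2.2.1 :=
    PolyTime.trans (.node hid.left hid.right.left)
      ((onlineGuess_polyTime F lam).reindex fun i : (d : ℕ) × (Memory F lam d ×
        (F.ciphers (lam d) d × F.params (lam d) d) × Bool) => ⟨i.1, i.2.1, i.2.2.1⟩)
  have hy : PolyComp inp fun i => i.2.2.2 := hid.right.right.congr fun _ => rfl
  have hs : PolyTime inp fun i => enc i.2.1 := hid.left.right.congr fun _ => rfl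
  have hx : PolyTime inp fun i => enc i.2.2.1.1 := hid.right.left.left.congr fun _ => rfl
  have hxq : PolyTime inp fun i => enc i.2.2.1.2 := hid.right.left.right.congr fun _ => rfl
  refine PolyTime.node (hid.left.left.congr fun _ => rfl) ?_
  refine PolyTime.splitBool (c := fun i => onlineGuess F lam i.1 i.2.1 i.2.2.1 == i.2.2.2)
    ((hg.cond hy hy.not).congr fun i => ?_) ((hs.reindex _).congr fun i => ?_) ?_
  · cases onlineGuess F lam i.1 i.2.1 i.2.2.1 <;> cases i.2.2.2 <;> rfl
  · obtain ⟨⟨d, s, x, y⟩, h⟩ := i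
    dsimp only at h
    simp only [onlineUpdate, h]
    rfl
  refine PolyTime.split (hs.reindex _) ?_ ?_
  · refine PolyTime.splitBool ((hy.reindex _).reindex _) ?_ ?_
    · have h := PolyTime.node (PolyTime.node hs.left.left (PolyTime.node hx hs.left.right.right))
        .leaf
      refine (((h.reindex _).reindex _).reindex _).congr fun i => ?_
      obtain ⟨⟨⟨⟨d, s, x, y⟩, h1⟩, h2⟩, h3⟩ := i
      cases s with
      | none => exact (h2 rfl).elim
      | some m =>
        dsimp only at h3 h1
        subst h3
        simp only [onlineUpdate, h1]
        rfl
    · have h := PolyTime.node (PolyTime.node hs.left.left (PolyTime.node hs.left.right.left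
        (PolyTime.node hx .leaf))) .leaf
      refine (((h.reindex _).reindex _).reindex _).congr fun i => ?_
      obtain ⟨⟨⟨⟨d, s, x, y⟩, h1⟩, h2⟩, h3⟩ := i
      cases s with
      | none => exact (h2 rfl).elim
      | some m =>
        dsimp only at h3 h1
        subst h3
        simp only [onlineUpdate, h1]
        rfl
  · have h := PolyTime.node (PolyTime.node hxq (PolyTime.node hx .leaf)) .leaf
    refine ((h.reindex _).reindex _).congr fun i => ?_
    obtain ⟨⟨⟨d, s, x, y⟩, h1⟩, h2⟩ := i
    cases s with
    | none =>
      dsimp only at h1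
      simp only [onlineUpdate, h1]
      rfl
    | some m => cases h2

end online

/-! ### The mistake bound -/

/-- Unsigned floor-log distance. -/
def flogDist (x y : ℕ) : ℕ := if x = y then 0 else Nat.log 2 (max x y - min x y) + 1

theorem abs_fld (x y : ℕ) : |fld x y| = (flogDist x y : ℤ) := by
  unfold fld flogDist
  split_ifs with h1 h2
  · rfl
  · rw [max_eq_left h2.le, min_eq_right h2.le, abs_of_nonneg (by positivity)]; push_cast; rfl
  · have h3 : x ≤ y := by omega
    rw [max_eq_right h3, min_eq_left h3, abs_of_nonpos (by
      have : (0 : ℤ) ≤ Nat.log 2 (y - x) := by positivity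
      linarith)]
    push_cast; ring

theorem flogDist_of_lt {x y : ℕ} (h : x < y) : flogDist x y = Nat.log 2 (y - x) + 1 := by
  rw [flogDist, if_neg h.ne, max_eq_right h.le, min_eq_left h.le]

theorem flogDist_self (x : ℕ) : flogDist x x = 0 := if_pos rfl

theorem flogDist_comm (x y : ℕ) : flogDist x y = flogDist y x := by
  unfold flogDist
  rw [max_comm, min_comm]
  simp only [eq_comm]

theorem tfld_of_lt_of_lt {x y z : ℕ} (h : x < y) (h' : y < z) :
    tfld x y z = (.lt, .lt, .lt, decide (Nat.log 2 (y - x) < Nat.log 2 (z - y))) := by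
  have e0 : min x (min y z) = x := by omega
  have e1 : max (min x y) (min (max x y) z) = y := by omega
  have e2 : max x (max y z) = z := by omega
  simp only [tfld, inducedLeak, e0, e1, e2, abs_fld, flogDist_of_lt h, flogDist_of_lt h',
    compare_lt_iff_lt.2 h, compare_lt_iff_lt.2 h', compare_lt_iff_lt.2 (h.trans h')]
  simp

/-- If `m` divides an interval so that the part of length `A` is not longer in the floor-log sense
than the part of length `B`, then passing to the former decreases the logarithm of the squared
length. -/
theorem log_sq_lt {A B : ℕ} (hA : 0 < A) (h : Nat.log 2 A ≤ Nat.log 2 B) (hB : 0 < B) :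
    Nat.log 2 (A ^ 2) < Nat.log 2 ((A + B) ^ 2) := by
  have h1 : A < 2 * B := by
    calc A < 2 ^ (Nat.log 2 A + 1) := Nat.lt_pow_succ_log_self (by norm_num) _
      _ ≤ 2 ^ (Nat.log 2 B + 1) := Nat.pow_le_pow_right (by norm_num) (by omega)
      _ = 2 * 2 ^ Nat.log 2 B := by rw [pow_succ']
      _ ≤ 2 * B := Nat.mul_le_mul_left _ (Nat.pow_log_le_self 2 hB.ne')
  have h2 : A ^ 2 * 2 ≤ (A + B) ^ 2 := by nlinarith
  calc Nat.log 2 (A ^ 2) < Nat.log 2 (A ^ 2 * 2) := by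
        rw [Nat.log_mul_base (by norm_num) (by positivity)]; omega
    _ ≤ _ := Nat.log_mono_right h2

section mistakes

variable {F : FRE} {lam : ℕ → ℕ} {d : ℕ}

/-- What the learner knows about the target with threshold `t`, secret key `sk` and parameters
`q` is true. -/
def Consistent (t : Msg d) (sk : List Bool) (q : F.params (lam d) d) : Memory F lam d → Prop
  | none => True
  | some m => m.1 = q ∧ (∃ a, F.Dec (lam d) d sk m.2.1 = some a ∧ a < t) ∧
      ∀ h, m.2.2 = some h → ∃ b, F.Dec (lam d) d sk h = some b ∧ t ≤ b

/-- A bound on the number of mistakes still to be made: basically, the logarithm of the squared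
distance of the known plaintexts on both sides of the threshold. -/
def potential (sk : List Bool) : Memory F lam d → ℕ
  | none => 2 * d + 2
  | some (_, _, none) => 2 * d + 1
  | some (_, lo, some hi) =>
    match F.Dec (lam d) d sk lo, F.Dec (lam d) d sk hi with
    | some a, some b => Nat.log 2 ((b.val - a.val) ^ 2)
    | _, _ => 0

theorem log_sq_le (a b : Msg d) : Nat.log 2 ((b.val - a.val) ^ 2) ≤ 2 * d := by
  calc Nat.log 2 ((b.val - a.val) ^ 2) ≤ Nat.log 2 ((2 ^ d) ^ 2) := by
        refine Nat.log_mono_right (Nat.pow_le_pow_left ?_ 2)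
        have := b.2; omega
    _ = 2 * d := by rw [← pow_mul, Nat.log_pow (by norm_num)]; ring

/-- A mistake keeps the memory consistent with the target and decreases the potential: a plaintext
strictly between the two known ones was closer to the side whose label it did not get, and now
replaces the known plaintext on the other side. -/
theorem update_spec (heval : F.CorrectEvaluation tfld)
    (r : Fin (F.genCoins.eval (lam d + d)) → Bool) (t : Msg d) (s : Memory F lam d)
    (hs : Consistent t (F.Gen (lam d) d r).1 (F.Gen (lam d) d r).2 s)
    (x : F.ciphers (lam d) d × F.params (lam d) d)
    (hne : onlineGuess F lam d s x ≠ encThreshold F (lam d) d t r x) :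
    Consistent t (F.Gen (lam d) d r).1 (F.Gen (lam d) d r).2
        (onlineUpdate F lam d s x (encThreshold F (lam d) d t r x)) ∧
      potential (F.Gen (lam d) d r).1
        (onlineUpdate F lam d s x (encThreshold F (lam d) d t r x)) <
      potential (F.Gen (lam d) d r).1 s := by
  set sk := (F.Gen (lam d) d r).1 with hsk
  set q := (F.Gen (lam d) d r).2 with hq
  obtain ⟨c, xq⟩ := x
  have hlab : encThreshold F (lam d) d t r (c, xq) = true ↔
      xq = q ∧ ∃ m, F.Dec (lam d) d sk c = some m ∧ m < t := by simp [encThreshold, hsk, hq]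
  set y := encThreshold F (lam d) d t r (c, xq) with hy
  have hbeq : (onlineGuess F lam d s (c, xq) == y) = false := by simpa using hne
  cases s with
  | none =>
    have hy1 : y = true := by simpa [onlineGuess] using hne
    obtain ⟨h1, m, hm, hmt⟩ := hlab.1 hy1
    simp only [onlineUpdate, hbeq, cond_false]
    exact ⟨⟨h1, ⟨m, hm, hmt⟩, by simp⟩, by simp [potential]⟩
  | some m =>
    obtain ⟨q', lo, hi⟩ := m
    obtain ⟨h1, ⟨a, ha, hat⟩, hhi⟩ := hs
    dsimp only at h1 ha hhi
    subst h1
    simp only [onlineUpdate, hbeq, cond_false]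
    simp only [onlineGuess, guessKnown] at hbeq
    by_cases hxq : xq = q
    swap
    · -- under foreign parameters both the prediction and the label are `0`
      have h2 : cmpBits xq.1 q.1 ≠ .eq := fun h => hxq (Subtype.ext ((cmpBits_eq _ _).1 h))
      have h3 : y = false := by
        rw [Bool.eq_false_iff]; exact fun h => hxq (hlab.1 h).1
      simp [h2, h3] at hbeq
    subst hxq
    simp only [(cmpBits_eq _ _).2 rfl, beq_self_eq_true, cond_true] at hbeq
    rw [hq, heval.eval_eq] at hbeq
    rw [FRE.evalCiph] at hbeq
    simp only [← hsk, ha] at hbeq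
    cases hm : F.Dec (lam d) d sk c with
    | none =>
      -- strong correctness: an ill-formed ciphertext is recognized, and its label is `0`
      have h3 : y = false := by
        rw [Bool.eq_false_iff]
        intro h
        obtain ⟨m, hm', -⟩ := (hlab.1 h).2
        rw [hm] at hm'; cases hm'
      simp [hm, h3] at hbeq
    | some m =>
      have hyv : y = decide (m < t) := by
        rw [Bool.eq_iff_iff, hlab, decide_eq_true_iff]
        simp [hm]
      simp only [hm] at hbeq
      cases hi with
      | none =>
        simp [hm] at hbeq
        simp only [hbeq, cond_false]
        have htm : t ≤ m := by
          rw [hbeq] at hyv; simpa using hyv.symm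
        refine ⟨⟨rfl, ⟨a, ha, hat⟩, fun h hh => ?_⟩, ?_⟩
        · obtain rfl : c = h := by simpa using hh
          exact ⟨m, hm, htm⟩
        · simp only [potential, ha, hm]
          exact Nat.lt_succ_of_le (log_sq_le a m)
      | some hi =>
        obtain ⟨b, hb, htb⟩ := hhi hi rfl
        simp only [Option.getD_some, hb, Option.isSome_some, Bool.not_true, Bool.false_or] at hbeq
        by_cases ham : a.val < m.val
        swap
        · -- `m ≤ a < t`, so the prediction `1` was right
          have h4 : m < t := lt_of_le_of_lt (show m ≤ a from not_lt.1 ham) hat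
          have h5 : compare a.val m.val ≠ .lt := by rwa [Ne, compare_lt_iff_lt]
          simp [hyv, h4, tfld, inducedLeak, h5] at hbeq
        by_cases hmb : m.val < b.val
        swap
        · -- `t ≤ b ≤ m`, so the prediction `0` was right
          have h4 : ¬ m < t := not_lt.2 (htb.trans (show b ≤ m from not_lt.1 hmb))
          have h5 : compare m.val b.val ≠ .lt := by rwa [Ne, compare_lt_iff_lt]
          simp [hyv, h4, tfld, inducedLeak, h5, compare_lt_iff_lt.2 ham] at hbeq
        rw [tfld_of_lt_of_lt ham hmb] at hbeq
        simp only [beq_self_eq_true, Bool.not_true, Bool.true_and, Bool.false_or] at hbeq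
        have hd : b.val - a.val = (m.val - a.val) + (b.val - m.val) := by omega
        cases hyy : y with
        | false =>
          have h4 : t ≤ m := by rw [hyy] at hyv; simpa using hyv.symm
          have h5 : Nat.log 2 (m.val - a.val) < Nat.log 2 (b.val - m.val) := by
            simpa [hyy] using hbeq
          simp only [cond_false]
          refine ⟨⟨rfl, ⟨a, ha, hat⟩, fun h hh => ?_⟩, ?_⟩
          · obtain rfl : c = h := by simpa using hh
            exact ⟨m, hm, h4⟩
          · simp only [potential, ha, hb, hm]
            rw [hd]
            exact log_sq_lt (by omega) h5.le (by omega)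
        | true =>
          have h4 : m < t := by rw [hyy] at hyv; simpa using hyv.symm
          have h5 : Nat.log 2 (b.val - m.val) ≤ Nat.log 2 (m.val - a.val) := by
            simpa [hyy] using hbeq
          simp only [cond_true]
          refine ⟨⟨rfl, ⟨m, hm, h4⟩, fun h hh => ⟨b, ?_, htb⟩⟩, ?_⟩
          · obtain rfl : hi = h := by simpa using hh
            exact hb
          · simp only [potential, ha, hb, hm]
            rw [hd, add_comm]
            exact log_sq_lt (by omega) h5 (by omega)

end mistakes

/-- A natural number that decreases at every element of a set of times can do so only as often as
its initial value says. -/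
theorem encard_le_of_potential (φ : ℕ → ℕ) (B : Set ℕ) (h1 : ∀ i, φ (i + 1) ≤ φ i)
    (h2 : ∀ i ∈ B, φ (i + 1) < φ i) : B.encard ≤ (φ 0 : ℕ∞) := by
  classical
  have key : ∀ n, ((Finset.range n).filter (· ∈ B)).card + φ n ≤ φ 0 := by
    intro n
    induction n with
    | zero => simp
    | succ n ih =>
      rw [Finset.range_add_one, Finset.filter_insert]
      split_ifs with h
      · have h3 := h2 n h
        rw [Finset.card_insert_of_notMem (by simp)]
        omega
      · have := h1 n
        omega
  by_contra hlt
  rw [not_le] at hlt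
  obtain ⟨T, hT, hc⟩ := Set.exists_subset_encard_eq (Order.add_one_le_of_lt hlt)
  have hfin : T.Finite := Set.finite_of_encard_eq_coe (k := φ 0 + 1) (by rw [hc]; push_cast; rfl)
  obtain ⟨n, hn⟩ := hfin.bddAbove
  have h3 : hfin.toFinset ⊆ (Finset.range (n + 1)).filter (· ∈ B) := by
    intro i hi
    rw [Set.Finite.mem_toFinset] at hi
    simp only [Finset.mem_filter, Finset.mem_range]
    exact ⟨Nat.lt_succ_of_le (hn hi), hT hi⟩
  have h4 := Finset.card_le_card h3
  rw [hfin.encard_eq_coe_toFinset_card] at hc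
  have h5 : hfin.toFinset.card = φ 0 + 1 := by exact_mod_cast hc
  have := key (n + 1)
  omega

/-! ### Running time of the online learner -/

theorem size_bits_le (l : List Bool) : (enc l).size ≤ 4 * l.length + 1 := by
  induction l with
  | nil => simp [size_nil]
  | cons b l ih =>
    have := size_bool b
    rw [size_cons, List.length_cons]
    omega

section sizes

variable (F : FRE) (lam : ℕ → ℕ) (hlam : ∃ p : Polynomial ℕ, ∀ d, lam d ≤ p.eval d)
include hlam

theorem exists_params_bound :
    ∃ p : Polynomial ℕ, ∀ d, ∀ q : F.params (lam d) d, (enc q).size ≤ p.eval d := by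
  obtain ⟨p, hp⟩ := F.params_length
  obtain ⟨p', hp'⟩ := hlam
  refine ⟨4 * p.comp (p' + Polynomial.X) + 1, fun d q => (size_bits_le q.1).trans ?_⟩
  have h1 := hp (lam d) d q.1 q.2
  have h2 := eval_mono p (Nat.add_le_add_right (hp' d) d)
  simp only [Polynomial.eval_add, Polynomial.eval_mul, Polynomial.eval_comp, Polynomial.eval_X,
    Polynomial.eval_one, Polynomial.eval_ofNat]
  omega

theorem exists_ciphers_bound :
    ∃ p : Polynomial ℕ, ∀ d, ∀ c : F.ciphers (lam d) d, (enc c).size ≤ p.eval d := by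
  obtain ⟨p, hp⟩ := F.ciphers_length
  obtain ⟨p', hp'⟩ := hlam
  refine ⟨4 * p.comp (p' + Polynomial.X) + 1, fun d q => (size_bits_le q.1).trans ?_⟩
  have h1 := hp (lam d) d q.1 q.2
  have h2 := eval_mono p (Nat.add_le_add_right (hp' d) d)
  simp only [Polynomial.eval_add, Polynomial.eval_mul, Polynomial.eval_comp, Polynomial.eval_X,
    Polynomial.eval_one, Polynomial.eval_ofNat]
  omega

theorem exists_memory_bound :
    ∃ p : Polynomial ℕ, ∀ d, ∀ s : Memory F lam d, (enc s).size ≤ p.eval d := by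
  obtain ⟨p, hp⟩ := exists_params_bound F lam hlam
  obtain ⟨p', hp'⟩ := exists_ciphers_bound F lam hlam
  refine ⟨p + p' + p' + 6, fun d s => ?_⟩
  simp only [Polynomial.eval_add, Polynomial.eval_ofNat]
  match s with
  | none =>
    have : (enc (none : Memory F lam d)).size = 1 := rfl
    omega
  | some (q, lo, none) =>
    have h1 : (enc (some (q, lo, none) : Memory F lam d)).size =
      ((enc q).size + ((enc lo).size + 1 + 1) + 1) + 1 + 1 := rfl
    have h2 := hp d q
    have h3 := hp' d lo
    omega
  | some (q, lo, some hi) =>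
    have h1 : (enc (some (q, lo, some hi) : Memory F lam d)).size =
      ((enc q).size + ((enc lo).size + ((enc hi).size + 1 + 1) + 1) + 1) + 1 + 1 := rfl
    have h2 := hp d q
    have h3 := hp' d lo
    have h4 := hp' d hi
    omega

end sizes

theorem RunsWithin.mono {c : Code} {x y : Tr} {s t : ℕ} (h : RunsWithin c x y s) (hst : s ≤ t) :
    RunsWithin c x y t := by
  obtain ⟨u, hu, hr⟩ := h
  exact ⟨u, hu.trans hst, hr⟩

theorem efficientlyOnlineLearnable (F : FRE) (heval : F.CorrectEvaluation tfld) (lam : ℕ → ℕ)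
    (hlam : ∃ p : Polynomial ℕ, ∀ d, lam d ≤ p.eval d) :
    EfficientlyOnlineLearnable (LEncThr F lam) := by
  obtain ⟨b₁, hb₁⟩ := exists_params_bound F lam hlam
  obtain ⟨b₂, hb₂⟩ := exists_ciphers_bound F lam hlam
  obtain ⟨b₃, hb₃⟩ := exists_memory_bound F lam hlam
  obtain ⟨b₄, hb₄⟩ := hlam
  have hdesc : PolyTime (fun d : ℕ => enc (lam d, d))
      (fun d => Tr.node (enc (lam d, d)) (enc (none : Memory F lam d))) := .node .refl .leaf
  obtain ⟨c₀, p₀, h₀⟩ := hdesc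
  obtain ⟨c₁, p₁, h₁⟩ := onlineGuess_polyTime F lam
  obtain ⟨c₂, p₂, h₂⟩ := onlineUpdate_polyTime F lam
  -- a bound on the size of every input
  set b : Polynomial ℕ := b₁ + b₂ + b₃ + (2 * b₄ + 2 * Polynomial.X + 12) with hb
  have hbd (d : ℕ) : b.eval d = b₁.eval d + b₂.eval d + b₃.eval d +
      (2 * b₄.eval d + 2 * d + 12) := by simp [hb]
  refine ⟨c₀, c₁, c₂, p₀.comp b + p₁.comp b + p₂.comp b + (2 * Polynomial.X + 2),
    fun d f hf x => ?_⟩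
  obtain ⟨t, r, rfl⟩ := hf
  let S : ℕ → Memory F lam d := fun n => Nat.rec none
    (fun i s => onlineUpdate F lam d s (x i) (encThreshold F (lam d) d t r (x i))) n
  have hS (i : ℕ) : S (i + 1) =
      onlineUpdate F lam d (S i) (x i) (encThreshold F (lam d) d t r (x i)) := rfl
  have hsize : (enc (lam d, d)).size ≤ 2 * b₄.eval d + 2 * d + 3 := by
    have := hb₄ d
    rw [size_pair, size_nat, size_nat]
    omega
  have hev (d : ℕ) : (p₀.comp b + p₁.comp b + p₂.comp b + (2 * Polynomial.X + 2)).eval d =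
      p₀.eval (b.eval d) + p₁.eval (b.eval d) + p₂.eval (b.eval d) + (2 * d + 2) := by simp
  have hcons : ∀ i, Consistent t (F.Gen (lam d) d r).1 (F.Gen (lam d) d r).2 (S i) := by
    intro i
    induction i with
    | zero => trivial
    | succ i ih =>
      rw [hS]
      by_cases h : onlineGuess F lam d (S i) (x i) = encThreshold F (lam d) d t r (x i)
      · simp only [onlineUpdate, h, beq_self_eq_true, cond_true]; exact ih
      · exact (update_spec heval r t _ ih _ h).1
  refine ⟨fun i => .node (enc (lam d, d)) (enc (S i)), fun i => onlineGuess F lam d (S i) (x i),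
    ?_, fun i => ?_, fun i => ?_, ?_⟩
  · refine (h₀ d).mono ?_
    rw [hev]
    have := eval_mono p₀ (show (enc (lam d, d)).size ≤ b.eval d by rw [hbd]; omega)
    exact this.trans (by omega)
  · refine (h₁ ⟨d, S i, x i⟩).mono ?_
    rw [hev]
    have h3 := hb₃ d (S i)
    have h4 := hb₂ d (x i).1
    have h5 := hb₁ d (x i).2
    have := eval_mono p₁ (show (Tr.node (.node (enc (lam d, d)) (enc (S i)))
      (Tr.node (enc (x i).1) (enc (x i).2))).size ≤ b.eval d by
        rw [hbd]; simp only [Tr.size]; omega)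
    exact this.trans (by omega)
  · refine (h₂ ⟨d, S i, x i, encThreshold F (lam d) d t r (x i)⟩).mono ?_
    rw [hev]
    have h3 := hb₃ d (S i)
    have h4 := hb₂ d (x i).1
    have h5 := hb₁ d (x i).2
    have h6 := size_bool (encThreshold F (lam d) d t r (x i))
    have := eval_mono p₂ (show (Tr.node (.node (enc (lam d, d)) (enc (S i)))
      (Tr.node (Tr.node (enc (x i).1) (enc (x i).2))
        (enc (encThreshold F (lam d) d t r (x i))))).size ≤ b.eval d by
        rw [hbd]; simp only [Tr.size]; omega)
    exact this.trans (by omega)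
  · refine (encard_le_of_potential (fun i => potential (F.Gen (lam d) d r).1 (S i)) _
      (fun i => ?_) (fun i hi => ?_)).trans ?_
    · rw [hS]
      by_cases h : onlineGuess F lam d (S i) (x i) = encThreshold F (lam d) d t r (x i)
      · simp only [onlineUpdate, h, beq_self_eq_true, cond_true, le_refl]
      · exact (update_spec heval r t _ (hcons i) _ h).2.le
    · exact (update_spec heval r t _ (hcons i) _ hi).2
    · rw [hev]
      exact_mod_cast (show 2 * d + 2 ≤ _ by omega)


/-! ### Messages with equal leakage -/

/-- The binary logarithm does not change between `x` and `x + 2`. -/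
def logStable (x : ℕ) : Prop := Nat.log 2 x = Nat.log 2 (x + 2)

instance (x : ℕ) : Decidable (logStable x) := inferInstanceAs (Decidable (_ = _))

/-- No floor-log distance to a message in block `s` distinguishes messages in the blocks `j` and
`j + 1`, or comes close to the distances between these. In truncated subtraction,
`j - s - 1` and `s - j - 2` are zero, hence not `logStable`, if `s` is on the other side. -/
def Clean (s j : ℕ) : Prop := logStable (j - s - 1) ∨ logStable (s - j - 2)

instance (s j : ℕ) : Decidable (Clean s j) := inferInstanceAs (Decidable (_ ∨ _))

theorem logStable.two_le {x : ℕ} (h : logStable x) : 2 ≤ x := by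
  by_contra hx
  have : x = 0 ∨ x = 1 := by omega
  unfold logStable at h
  rcases this with rfl | rfl <;> norm_num at h

theorem logStable.log_eq {x y a : ℕ} (h : logStable x) (h1 : x * 2 ^ a ≤ y)
    (h2 : y < (x + 3) * 2 ^ a) : Nat.log 2 y = Nat.log 2 x + a := by
  have hx := h.two_le
  have hp : 0 < 2 ^ a := by positivity
  have hy : x ≤ y / 2 ^ a := (Nat.le_div_iff_mul_le hp).2 h1
  have hy' : y / 2 ^ a < x + 3 := (Nat.div_lt_iff_lt_mul hp).2 h2
  have h3 : Nat.log 2 (y / 2 ^ a) = Nat.log 2 x := by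
    refine le_antisymm ?_ (Nat.log_mono_right hy)
    rw [h]
    exact Nat.log_mono_right (by omega)
  rw [Nat.log_div_base_pow] at h3
  have h4 : 1 ≤ Nat.log 2 x := Nat.log_pos (by norm_num) hx
  omega

theorem logStable.one_le_log {x : ℕ} (h : logStable x) : 1 ≤ Nat.log 2 x :=
  Nat.log_pos (by norm_num) h.two_le

/-- Membership in one of two consecutive blocks of length `2 ^ a`. -/
def InBlocks (a j t : ℕ) : Prop := j * 2 ^ a ≤ t ∧ t < (j + 2) * 2 ^ a

theorem inBlocks_of_div {a j t : ℕ} (h : t / 2 ^ a = j ∨ t / 2 ^ a = j + 1) : InBlocks a j t := by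
  have hp : 0 < 2 ^ a := by positivity
  have h1 := Nat.div_mul_le_self t (2 ^ a)
  have h2 := Nat.lt_div_mul_add (a := t) hp
  constructor
  · rcases h with h | h <;> rw [h] at h1 <;> nlinarith
  · rcases h with h | h <;> rw [h] at h2 <;> nlinarith

theorem Clean.spec {a j s t t' : ℕ} (h : Clean (s / 2 ^ a) j) (ht : InBlocks a j t)
    (ht' : InBlocks a j t') :
    flogDist t s = flogDist t' s ∧ a + 1 < flogDist t s ∧ t ≠ s ∧ (t < s ↔ t' < s) := by
  have hp : 0 < 2 ^ a := by positivity
  have h1 := Nat.div_mul_le_self s (2 ^ a)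
  have h2 := Nat.lt_div_mul_add (a := s) hp
  set σ := s / 2 ^ a
  rcases h with h | h
  · have key : ∀ t, InBlocks a j t → s < t ∧ flogDist t s = Nat.log 2 (j - σ - 1) + a + 1 := by
      intro t ⟨h3, h4⟩
      have h5 := h.two_le
      obtain ⟨x, hx⟩ : ∃ x, j = σ + 1 + x := ⟨j - σ - 1, by omega⟩
      rw [show j - σ - 1 = x by omega] at *
      subst hx
      have h6 : s < t := by nlinarith
      refine ⟨h6, ?_⟩
      rw [flogDist_comm, flogDist_of_lt h6, h.log_eq (y := t - s) (a := a)]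
      · refine Nat.le_sub_of_add_le ?_
        nlinarith
      · rw [Nat.sub_lt_iff_lt_add h6.le]
        nlinarith
    obtain ⟨k1, k2⟩ := key t ht
    obtain ⟨k3, k4⟩ := key t' ht'
    have := h.one_le_log
    exact ⟨by rw [k2, k4], by omega, by omega, by omega⟩
  · have key : ∀ t, InBlocks a j t → t < s ∧ flogDist t s = Nat.log 2 (σ - j - 2) + a + 1 := by
      intro t ⟨h3, h4⟩
      have h5 := h.two_le
      obtain ⟨x, hx⟩ : ∃ x, σ = j + 2 + x := ⟨σ - j - 2, by omega⟩
      rw [show σ - j - 2 = x by omega] at *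
      rw [hx] at h1 h2
      have h6 : t < s := by nlinarith
      refine ⟨h6, ?_⟩
      rw [flogDist_of_lt h6, h.log_eq (y := s - t) (a := a)]
      · refine Nat.le_sub_of_add_le ?_
        nlinarith
      · rw [Nat.sub_lt_iff_lt_add h6.le]
        nlinarith
    obtain ⟨k1, k2⟩ := key t ht
    obtain ⟨k3, k4⟩ := key t' ht'
    have := h.one_le_log
    exact ⟨by rw [k2, k4], by omega, by omega, by omega⟩

theorem InBlocks.flogDist_le {a j t t' : ℕ} (ht : InBlocks a j t) (ht' : InBlocks a j t') :
    flogDist t t' ≤ a + 1 := by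
  wlog h : t ≤ t' generalizing t t'
  · rw [flogDist_comm]; exact this ht' ht (by omega)
  rcases h.eq_or_lt with rfl | h
  · rw [flogDist_self]; omega
  · rw [flogDist_of_lt h]
    have h1 : t' - t < 2 ^ (a + 1) := by
      rw [pow_succ, Nat.sub_lt_iff_lt_add h.le]
      have h1 := ht.1
      have h2 := ht'.2
      nlinarith
    have := Nat.log_lt_of_lt_pow (by omega) h1
    omega

/-- The leakage of three messages is determined by their comparisons and by the comparison of the
two consecutive distances in the sorted triple. -/
theorem tfld_congr (P : ℕ × ℕ → Prop)
    (hc : ∀ x y, P x → P y → compare x.1 y.1 = compare x.2 y.2)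
    (hd : ∀ x y z, P x → P y → P z → x.1 ≤ y.1 → y.1 ≤ z.1 →
      (flogDist x.1 y.1 < flogDist y.1 z.1 ↔ flogDist x.2 y.2 < flogDist y.2 z.2))
    {x y z : ℕ × ℕ} (hx : P x) (hy : P y) (hz : P z) :
    tfld x.1 y.1 z.1 = tfld x.2 y.2 z.2 := by
  have hle : ∀ x y, P x → P y → x.1 ≤ y.1 → x.2 ≤ y.2 := by
    intro x y hx hy h
    have h1 := hc x y hx hy
    rw [← not_lt, ← compare_gt_iff_gt, ← h1, compare_gt_iff_gt]
    exact not_lt.2 h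
  simp only [tfld, inducedLeak, hc x y hx hy, hc y z hy hz, hc x z hx hz, abs_fld]
  refine Prod.ext rfl (Prod.ext rfl (Prod.ext rfl ?_))
  dsimp only
  rw [decide_eq_decide, Nat.cast_lt, Nat.cast_lt]
  rcases le_total x.1 y.1 with h1 | h1 <;> rcases le_total y.1 z.1 with h2 | h2 <;>
    rcases le_total x.1 z.1 with h3 | h3
  all_goals first
    | (have e1 := hle _ _ hx hy h1) | (have e1 := hle _ _ hy hx h1)
  all_goals first
    | (have e2 := hle _ _ hy hz h2) | (have e2 := hle _ _ hz hy h2)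
  all_goals first
    | (have e3 := hle _ _ hx hz h3) | (have e3 := hle _ _ hz hx h3)
  all_goals simp only [min_eq_left, min_eq_right, max_eq_left, max_eq_right, h1, h2, h3, e1, e2, e3]
  · exact hd _ _ _ hx hy hz h1 h2
  · simp [show x.1 = y.1 by omega, show x.2 = y.2 by omega]
  · exact hd _ _ _ hx hz hy h3 h2
  · exact hd _ _ _ hz hx hy h3 h1
  · exact hd _ _ _ hy hx hz h1 h3
  · exact hd _ _ _ hy hz hx h2 h3
  · simp [show x.1 = y.1 by omega, show x.2 = y.2 by omega]
  · exact hd _ _ _ hz hy hx h2 h1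

/-- Two messages in a pair of consecutive blocks can be replaced by two others in the same order
and in the same pair of blocks: relative to messages in clean blocks, this does not change the
leakage. -/
theorem tfld_eq_of_clean {a j u₁ u₂ w₁ w₂ : ℕ} (hu : u₁ < u₂) (hw : w₁ < w₂)
    (hu₁ : InBlocks a j u₁) (hu₂ : InBlocks a j u₂) (hw₁ : InBlocks a j w₁)
    (hw₂ : InBlocks a j w₂) (P : ℕ × ℕ → Prop)
    (hP : ∀ x, P x → (x.1 = x.2 ∧ Clean (x.1 / 2 ^ a) j) ∨ x = (u₁, w₁) ∨ x = (u₂, w₂))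
    {x y z : ℕ × ℕ} (hx : P x) (hy : P y) (hz : P z) :
    tfld x.1 y.1 z.1 = tfld x.2 y.2 z.2 := by
  have hP' : ∀ x, P x → (x.1 = x.2 ∧ Clean (x.1 / 2 ^ a) j) ∨
      ((x = (u₁, w₁) ∨ x = (u₂, w₂)) ∧ InBlocks a j x.1 ∧ InBlocks a j x.2) := by
    intro x hx
    rcases hP x hx with h | rfl | rfl
    · exact .inl h
    · exact .inr ⟨.inl rfl, hu₁, hw₁⟩
    · exact .inr ⟨.inr rfl, hu₂, hw₂⟩
  -- distances to a message in a clean block do not change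
  have hds : ∀ x s : ℕ × ℕ, InBlocks a j x.1 → InBlocks a j x.2 → s.1 = s.2 → Clean (s.1 / 2 ^ a) j →
      flogDist x.1 s.1 = flogDist x.2 s.2 ∧ flogDist s.1 x.1 = flogDist s.2 x.2 ∧
      a + 1 < flogDist x.1 s.1 ∧ a + 1 < flogDist s.1 x.1 ∧ compare x.1 s.1 = compare x.2 s.2 ∧
      compare s.1 x.1 = compare s.2 x.2 ∧ x.1 ≠ s.1 := by
    intro x s h1 h2 h3 h4
    obtain ⟨k1, k2, k3, k4⟩ := h4.spec h1 h2
    have k5 := (h4.spec h2 h1).2.2.1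
    rw [← h3, flogDist_comm s.1 x.1, flogDist_comm s.1 x.2]
    refine ⟨k1, k1, k2, k2, ?_, ?_, k3⟩
    · rcases lt_or_gt_of_ne k3 with h | h
      · rw [compare_lt_iff_lt.2 h, compare_lt_iff_lt.2 (k4.1 h)]
      · rw [compare_gt_iff_gt.2 h, compare_gt_iff_gt.2 (by omega)]
    · rcases lt_or_gt_of_ne k3 with h | h
      · rw [compare_gt_iff_gt.2 h, compare_gt_iff_gt.2 (k4.1 h)]
      · rw [compare_lt_iff_lt.2 h, compare_lt_iff_lt.2 (by omega)]
  refine tfld_congr P ?_ ?_ hx hy hz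
  · intro x y hx hy
    rcases hP' x hx with ⟨h1, h2⟩ | ⟨h1, h2, h2'⟩ <;> rcases hP' y hy with ⟨h3, h4⟩ | ⟨h3, h4, h4'⟩
    · rw [h1, h3]
    · exact (hds y x h4 h4' h1 h2).2.2.2.2.2.1
    · exact (hds x y h2 h2' h3 h4).2.2.2.2.1
    · rcases h1 with rfl | rfl <;> rcases h3 with rfl | rfl
      · simp
      · dsimp only; rw [compare_lt_iff_lt.2 hu, compare_lt_iff_lt.2 hw]
      · dsimp only; rw [compare_gt_iff_gt.2 hu, compare_gt_iff_gt.2 hw]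
      · simp
  · intro x y z hx hy hz hxy hyz
    rcases hP' x hx with ⟨h1, h2⟩ | ⟨h1, h2, h2'⟩ <;>
      rcases hP' y hy with ⟨h3, h4⟩ | ⟨h3, h4, h4'⟩ <;>
      rcases hP' z hz with ⟨h5, h6⟩ | ⟨h5, h6, h6'⟩
    · rw [h1, h3, h5]
    · rw [(hds z y h6 h6' h3 h4).2.1, h1, h3]
    · rw [(hds y x h4 h4' h1 h2).2.1, (hds y z h4 h4' h5 h6).1]
    · have k1 := hds y x h4 h4' h1 h2
      have k2 := h4.flogDist_le h6
      have k3 := h4'.flogDist_le h6'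
      have k4 := k1.2.1
      omega
    · rw [(hds x y h2 h2' h3 h4).1, h3, h5]
    · rw [(hds x y h2 h2' h3 h4).1, (hds z y h6 h6' h3 h4).2.1]
    · have k1 := hds y z h4 h4' h5 h6
      have k2 := h2.flogDist_le h4
      have k3 := h2'.flogDist_le h4'
      omega
    · have e : ∀ s t : ℕ, s ≠ t → 0 < flogDist s t := fun s t h => by
        rw [flogDist, if_neg h]; omega
      rcases h1 with rfl | rfl <;> rcases h3 with rfl | rfl <;> rcases h5 with rfl | rfl <;>
        simp only [flogDist_self] at * <;> try omega
      · simp [e _ _ hu.ne, e _ _ hw.ne]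

/-! ### Counting the blocks that are not clean -/

theorem card_not_logStable_le (n : ℕ) :
    ((Finset.range n).filter fun x => ¬ logStable x).card ≤ Nat.log 2 n + Nat.log 2 (n + 1) := by
  induction n with
  | zero => simp
  | succ n ih =>
    rw [Finset.range_add_one, Finset.filter_insert]
    have h1 : Nat.log 2 n ≤ Nat.log 2 (n + 2) := Nat.log_mono_right (by omega)
    by_cases h : logStable n
    · rw [if_neg (not_not.2 h), show n + 1 + 1 = n + 2 from rfl]
      omega
    · have h2 : Nat.log 2 n ≠ Nat.log 2 (n + 2) := h
      rw [if_pos h, Finset.card_insert_of_notMem (by simp), show n + 1 + 1 = n + 2 from rfl]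
      omega

theorem card_not_logStable_two_pow_le (ν : ℕ) :
    ((Finset.range (2 ^ ν)).filter fun x => ¬ logStable x).card ≤ 2 * ν + 1 := by
  refine (card_not_logStable_le _).trans ?_
  have h1 : Nat.log 2 (2 ^ ν) = ν := Nat.log_pow (by norm_num) ν
  have h2 : Nat.log 2 (2 ^ ν + 1) < ν + 2 :=
    Nat.log_lt_of_lt_pow (Nat.succ_ne_zero _) (by
      have : 0 < 2 ^ ν := by positivity
      rw [show 2 ^ (ν + 2) = 4 * 2 ^ ν by ring]; omega)
  omega

/-- A bound for the number of blocks `j` for which a given block is not clean, and conversely. -/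
def uncleanBound (ν : ℕ) : ℕ := 4 * ν + 4

theorem card_not_clean_left_le (ν j : ℕ) (hj : j < 2 ^ ν) :
    ((Finset.range (2 ^ ν)).filter fun s => ¬ Clean s j).card ≤ uncleanBound ν := by
  set C := (Finset.range (2 ^ ν)).filter fun x => ¬ logStable x with hC
  have hsub : ((Finset.range (2 ^ ν)).filter fun s => ¬ Clean s j) ⊆
      (C.image fun x => j - 1 - x) ∪ (C.image fun x => j + 2 + x) ∪ {j, j + 1} := by
    intro s hs
    simp only [Finset.mem_filter, Finset.mem_range, Clean, not_or] at hs
    simp only [Finset.mem_union, Finset.mem_image, Finset.mem_insert, Finset.mem_singleton, hC,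
      Finset.mem_filter, Finset.mem_range]
    obtain ⟨h1, h2, h3⟩ := hs
    rcases lt_trichotomy s j with h | h | h
    · exact .inl (.inl ⟨j - s - 1, ⟨by omega, h2⟩, by omega⟩)
    · exact .inr (.inl h)
    · by_cases h' : s = j + 1
      · exact .inr (.inr h')
      · exact .inl (.inr ⟨s - j - 2, ⟨by omega, h3⟩, by omega⟩)
  have h1 := Finset.card_le_card hsub
  have h2 := Finset.card_union_le ((C.image fun x => j - 1 - x) ∪ (C.image fun x => j + 2 + x))
    {j, j + 1}
  have h3 := Finset.card_union_le (C.image fun x => j - 1 - x) (C.image fun x => j + 2 + x)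
  have h4 : (C.image fun x => j - 1 - x).card ≤ C.card := Finset.card_image_le
  have h5 : (C.image fun x => j + 2 + x).card ≤ C.card := Finset.card_image_le
  have h6 : ({j, j + 1} : Finset ℕ).card ≤ 2 := Finset.card_le_two
  have h7 := card_not_logStable_two_pow_le ν
  rw [← hC] at h7
  rw [uncleanBound]
  omega

theorem card_not_clean_right_le (ν s : ℕ) (hs : s < 2 ^ ν) :
    ((Finset.range (2 ^ ν)).filter fun j => ¬ Clean s j).card ≤ uncleanBound ν := by
  set C := (Finset.range (2 ^ ν)).filter fun x => ¬ logStable x with hC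
  have hsub : ((Finset.range (2 ^ ν)).filter fun j => ¬ Clean s j) ⊆
      (C.image fun x => s + 1 + x) ∪ (C.image fun x => s - 2 - x) ∪ {s - 1, s} := by
    intro j hj
    simp only [Finset.mem_filter, Finset.mem_range, Clean, not_or] at hj
    simp only [Finset.mem_union, Finset.mem_image, Finset.mem_insert, Finset.mem_singleton, hC,
      Finset.mem_filter, Finset.mem_range]
    obtain ⟨h1, h2, h3⟩ := hj
    rcases lt_trichotomy s j with h | h | h
    · exact .inl (.inl ⟨j - s - 1, ⟨by omega, h2⟩, by omega⟩)
    · exact .inr (.inr h.symm)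
    · by_cases h' : s = j + 1
      · exact .inr (.inl (by omega))
      · exact .inl (.inr ⟨s - j - 2, ⟨by omega, h3⟩, by omega⟩)
  have h1 := Finset.card_le_card hsub
  have h2 := Finset.card_union_le ((C.image fun x => s + 1 + x) ∪ (C.image fun x => s - 2 - x))
    {s - 1, s}
  have h3 := Finset.card_union_le (C.image fun x => s + 1 + x) (C.image fun x => s - 2 - x)
  have h4 : (C.image fun x => s + 1 + x).card ≤ C.card := Finset.card_image_le
  have h5 : (C.image fun x => s - 2 - x).card ≤ C.card := Finset.card_image_le
  have h6 : ({s - 1, s} : Finset ℕ).card ≤ 2 := Finset.card_le_two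
  have h7 := card_not_logStable_two_pow_le ν
  rw [← hC] at h7
  rw [uncleanBound]
  omega


/-! ### Messages as bit strings -/

/-- The message with the given binary digits. -/
def msgOf (d : ℕ) (l : List Bool) : Msg d := ⟨bitsVal l % 2 ^ d, Nat.mod_lt _ (by positivity)⟩

theorem msgOf_val {d : ℕ} {l : List Bool} (h : l.length = d) : (msgOf d l).val = bitsVal l := by
  subst h
  exact Nat.mod_eq_of_lt (bitsVal_lt l)

theorem ofFn_testBit_bitsVal (l : List Bool) :
    (List.ofFn fun i : Fin l.length => (bitsVal l).testBit i) = l := by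
  induction l with
  | nil => rfl
  | cons b l ih =>
    change (List.ofFn fun i : Fin (l.length + 1) => (bitsVal (b :: l)).testBit i) = b :: l
    rw [List.ofFn_succ]
    have h0 : (bitsVal (b :: l)).testBit 0 = b := by
      rw [Nat.testBit_zero, bitsVal]
      cases b <;> simp
    have h1 (i : ℕ) : (bitsVal (b :: l)).testBit (i + 1) = (bitsVal l).testBit i := by
      rw [Nat.testBit_succ, bitsVal]
      congr 1
      cases b <;> simp
      omega
    simp only [Fin.val_zero, Fin.val_succ, h0, h1, ih]

theorem enc_msgOf {d : ℕ} {l : List Bool} (h : l.length = d) : enc (msgOf d l) = enc l := by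
  subst h
  change enc (List.ofFn fun i : Fin l.length => (msgOf l.length l).val.testBit i) = enc l
  rw [msgOf_val rfl, ofFn_testBit_bitsVal]

theorem enc_list_map {α β : Type} [Encode α] [Encode β] (f : α → β) (h : ∀ a, enc (f a) = enc a)
    (l : List α) : enc (l.map f) = enc l := by
  induction l with
  | nil => rfl
  | cons a l ih => rw [List.map_cons, enc_cons, enc_cons, h, ih]

theorem enc_list_map_congr {α β γ : Type} [Encode α] [Encode β] (f : γ → α) (g : γ → β)
    (l : List γ) (h : ∀ a ∈ l, enc (f a) = enc (g a)) : enc (l.map f) = enc (l.map g) := by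
  induction l with
  | nil => rfl
  | cons a l ih =>
    rw [List.map_cons, List.map_cons, enc_cons, enc_cons, h a List.mem_cons_self,
      ih fun b hb => h b (List.mem_cons_of_mem _ hb)]

theorem length_of_mem_chunks {α : Type} {d n : ℕ} {l s : List α} (hl : n * d ≤ l.length)
    (h : s ∈ chunks d n l) : s.length = d := by
  induction n generalizing l with
  | zero => simp [chunks] at h
  | succ n ih =>
    rw [add_mul, one_mul] at hl
    rcases List.mem_cons.1 h with rfl | h
    · simp; omega
    · exact ih (by simp; omega) h

/-! ### The coins of the adversary -/

/-- The binary logarithm of the number of blocks. -/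
def blockBits (c d : ℕ) : ℕ := c * (Nat.log 2 d + 1)

theorem two_pow_blockBits_le (c d : ℕ) : 2 ^ blockBits c d ≤ (2 * d + 2) ^ c := by
  rw [blockBits, mul_comm, pow_mul]
  refine Nat.pow_le_pow_left ?_ c
  rw [pow_succ]
  rcases Nat.eq_zero_or_pos d with rfl | h
  · simp
  · have := Nat.pow_log_le_self 2 h.ne'
    omega

/-- The number of the block of a bit string. -/
def bitsBlock (c d : ℕ) (l : List Bool) : ℕ := bitsVal (l.drop (d - blockBits c d))

/-- The guess of the size of the sample, made with the first coins. -/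
def coinSize (c d : ℕ) (R : List Bool) : ℕ := bitsVal (R.take (blockBits c d))

/-- The next `4 * d` coins draw four messages. -/
def coinMsg (c d k : ℕ) (R : List Bool) : List Bool :=
  ((R.drop (blockBits c d)).drop (k * d)).take d

/-- Coins for the learner. -/
def coinLearner (c d n : ℕ) (R : List Bool) : List Bool :=
  ((R.drop (blockBits c d)).drop (4 * d)).take n

/-- The last coins draw the sample, where `n` coins have been used for the learner. -/
def coinSample (c d n : ℕ) (R : List Bool) : List (List Bool) :=
  chunks d (coinSize c d R) (((R.drop (blockBits c d)).drop (4 * d)).drop n)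

/-- Whether the pair `u₁, u₂` of messages may be replaced by `w₁, w₂`: the messages `w₁` and `w₂`
lie in consecutive blocks, `u₁ < u₂` both lie in one of these, and the sample is clean. -/
def bitsGate (c d : ℕ) (u₁ u₂ w₁ w₂ : List Bool) (S : List (List Bool)) : Bool :=
  S.all (fun s => decide (Clean (bitsBlock c d s) (bitsBlock c d w₁))) &&
    (decide (bitsBlock c d w₂ = bitsBlock c d w₁ + 1) && ((cmpBits u₁ u₂ == .lt) &&
    (decide (bitsBlock c d u₁ = bitsBlock c d u₂) &&
    (decide (bitsBlock c d u₁ = bitsBlock c d w₁) ||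
      decide (bitsBlock c d u₁ = bitsBlock c d w₁ + 1)))))

section polyTime

variable {ι : Type} {inp : ι → Tr} {d : ι → ℕ} (c : ℕ)

theorem PolyComp.blockBits (hd : PolyComp inp d) : PolyComp inp fun i => blockBits c (d i) :=
  (PolyComp.const c).mul hd.log.succ

theorem PolyComp.exists_blocks_le (hd : PolyComp inp d) :
    ∃ q : Polynomial ℕ, ∀ i, 2 ^ LeakyThr.blockBits c (d i) ≤ q.eval (inp i).size := by
  obtain ⟨q, hq⟩ := PolyTime.size_le hd
  refine ⟨(2 * q + 2) ^ c, fun i => (two_pow_blockBits_le c (d i)).trans ?_⟩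
  have h := hq i
  rw [size_nat] at h
  simp only [Polynomial.eval_pow, Polynomial.eval_add, Polynomial.eval_mul,
    Polynomial.eval_ofNat]
  exact Nat.pow_le_pow_left (by omega) c

theorem PolyComp.bitsBlock {l : ι → List Bool} (hd : PolyComp inp d) (hl : PolyComp inp l)
    (h : ∀ i, (l i).length ≤ d i) : PolyComp inp fun i => bitsBlock c (d i) (l i) := by
  refine PolyComp.bitsVal ((hd.sub (hd.blockBits c)).drop hl) ?_
  obtain ⟨q, hq⟩ := hd.exists_blocks_le c
  refine ⟨q, fun i => le_trans (Nat.pow_le_pow_right (by norm_num) ?_) (hq i)⟩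
  have := h i
  rw [List.length_drop]
  omega

theorem PolyComp.coinSize {R : ι → List Bool} (hd : PolyComp inp d) (hR : PolyComp inp R) :
    PolyComp inp fun i => coinSize c (d i) (R i) := by
  refine PolyComp.bitsVal ((hd.blockBits c).take hR) ?_
  obtain ⟨q, hq⟩ := hd.exists_blocks_le c
  refine ⟨q, fun i => le_trans (Nat.pow_le_pow_right (by norm_num) ?_) (hq i)⟩
  simp

theorem PolyComp.coinMsg (k : ℕ) {R : ι → List Bool} (hd : PolyComp inp d)
    (hR : PolyComp inp R) : PolyComp inp fun i => coinMsg c (d i) k (R i) :=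
  hd.take (((PolyComp.const k).mul hd).drop ((hd.blockBits c).drop hR))

theorem PolyComp.coinLearner {n : ι → ℕ} {R : ι → List Bool} (hd : PolyComp inp d)
    (hn : PolyComp inp n) (hR : PolyComp inp R) :
    PolyComp inp fun i => coinLearner c (d i) (n i) (R i) :=
  hn.take (((PolyComp.const 4).mul hd).drop ((hd.blockBits c).drop hR))

theorem PolyComp.coinSample {n : ι → ℕ} {R : ι → List Bool} (hd : PolyComp inp d)
    (hn : PolyComp inp n) (hR : PolyComp inp R) :
    PolyComp inp fun i => coinSample c (d i) (n i) (R i) :=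
  hd.chunks (hd.coinSize c hR)
    (hn.drop (((PolyComp.const 4).mul hd).drop ((hd.blockBits c).drop hR)))

theorem PolyComp.logStable {n : ι → ℕ} (hn : PolyComp inp n) :
    PolyComp inp fun i => decide (logStable (n i)) := hn.log.decideEq hn.succ.succ.log

theorem PolyComp.clean {s j : ι → ℕ} (hs : PolyComp inp s) (hj : PolyComp inp j) :
    PolyComp inp fun i => decide (Clean (s i) (j i)) :=
  (((hj.sub hs).sub (.const 1)).logStable.or ((hs.sub hj).sub (.const 2)).logStable).congr
    fun _ => (Bool.decide_or _ _).symm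

theorem PolyComp.bitsGate {u₁ u₂ w₁ w₂ : ι → List Bool} {S : ι → List (List Bool)}
    (hd : PolyComp inp d) (hu₁ : PolyComp inp u₁) (hu₂ : PolyComp inp u₂)
    (hw₁ : PolyComp inp w₁) (hw₂ : PolyComp inp w₂) (hS : PolyComp inp S)
    (lu₁ : ∀ i, (u₁ i).length ≤ d i) (lu₂ : ∀ i, (u₂ i).length ≤ d i)
    (lw₁ : ∀ i, (w₁ i).length ≤ d i) (lw₂ : ∀ i, (w₂ i).length ≤ d i)
    (lS : ∀ i, ∀ s ∈ S i, s.length ≤ d i) :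
    PolyComp inp fun i => bitsGate c (d i) (u₁ i) (u₂ i) (w₁ i) (w₂ i) (S i) := by
  have h1 := hd.bitsBlock c hu₁ lu₁
  have h2 := hd.bitsBlock c hu₂ lu₂
  have h3 := hd.bitsBlock c hw₁ lw₁
  have h4 := hd.bitsBlock c hw₂ lw₂
  refine (hS.all ?_).and ((h4.decideEq h3.succ).and ((hu₁.cmpBits hu₂).isLt.and
    ((h1.decideEq h2).and ((h1.decideEq h3).or (h1.decideEq h3.succ)))))
  exact (PolyComp.bitsBlock c hd.atInput .atValue fun x => lS _ _ x.2).clean h3.atInput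

end polyTime

/-! ### The adversary -/

/-- `bitsGate` for messages: `u₁ < u₂` are in the same block, `w₁` and `w₂` in consecutive blocks of
which this is one, and every message in `S` is in a block that is clean for these. Blocks are given
by the `blockBits c d` most significant bits. -/
def gate (c d : ℕ) (u₁ u₂ w₁ w₂ : Msg d) (S : List (Msg d)) : Prop :=
  (∀ s ∈ S, Clean (s.val / 2 ^ (d - blockBits c d)) (w₁.val / 2 ^ (d - blockBits c d))) ∧
    w₂.val / 2 ^ (d - blockBits c d) = w₁.val / 2 ^ (d - blockBits c d) + 1 ∧ u₁.val < u₂.val ∧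
    u₁.val / 2 ^ (d - blockBits c d) = u₂.val / 2 ^ (d - blockBits c d) ∧
    (u₁.val / 2 ^ (d - blockBits c d) = w₁.val / 2 ^ (d - blockBits c d) ∨
      u₁.val / 2 ^ (d - blockBits c d) = w₁.val / 2 ^ (d - blockBits c d) + 1)

instance (c d : ℕ) (u₁ u₂ w₁ w₂ : Msg d) (S : List (Msg d)) : Decidable (gate c d u₁ u₂ w₁ w₂ S) :=
  inferInstanceAs (Decidable (_ ∧ _))

theorem bitsBlock_eq {c d : ℕ} {l : List Bool} (h : l.length = d) :
    bitsBlock c d l = (msgOf d l).val / 2 ^ (d - blockBits c d) := by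
  rw [bitsBlock, bitsVal_drop, msgOf_val h]

theorem bitsGate_eq {c d : ℕ} {u₁ u₂ w₁ w₂ : List Bool} {S : List (List Bool)}
    (lu₁ : u₁.length = d) (lu₂ : u₂.length = d) (lw₁ : w₁.length = d) (lw₂ : w₂.length = d)
    (lS : ∀ s ∈ S, s.length = d) :
    bitsGate c d u₁ u₂ w₁ w₂ S =
      decide (gate c d (msgOf d u₁) (msgOf d u₂) (msgOf d w₁) (msgOf d w₂) (S.map (msgOf d))) := by
  have hcmp : (cmpBits u₁ u₂ == .lt) = decide ((msgOf d u₁).val < (msgOf d u₂).val) := by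
    rw [Bool.eq_iff_iff, beq_iff_eq, cmpBits_lt _ _ (lu₁.trans lu₂.symm), msgOf_val lu₁,
      msgOf_val lu₂, decide_eq_true_iff]
  rw [Bool.eq_iff_iff, bitsGate, hcmp, bitsBlock_eq lu₁, bitsBlock_eq lu₂, bitsBlock_eq lw₁,
    bitsBlock_eq lw₂]
  simp only [Bool.and_eq_true, List.all_eq_true, decide_eq_true_iff, Bool.or_eq_true, gate,
    List.forall_mem_map]
  refine and_congr_left fun _ => forall₂_congr fun s hs => ?_
  rw [bitsBlock_eq (lS s hs)]

/-- The challenge of the adversary: two messages from the same block against two messages from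
consecutive blocks, next to a sample. -/
def challengeOf (c d : ℕ) (u₁ u₂ w₁ w₂ : Msg d) (S : List (Msg d)) : List (Msg d × Msg d) :=
  if gate c d u₁ u₂ w₁ w₂ S then (u₁, w₁) :: (u₂, w₂) :: S.map fun s => (s, s) else []

/-- The challenge is legal: for the learner's sample this is what cleanness is made for, and the
challenge messages themselves come in the same order on both sides. -/
theorem challengeOf_leak_eq {c d : ℕ} {u₁ u₂ w₁ w₂ : Msg d} {S : List (Msg d)}
    (x : Msg d × Msg d) (hx : x ∈ challengeOf c d u₁ u₂ w₁ w₂ S)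
    (y : Msg d × Msg d) (hy : y ∈ challengeOf c d u₁ u₂ w₁ w₂ S)
    (z : Msg d × Msg d) (hz : z ∈ challengeOf c d u₁ u₂ w₁ w₂ S) :
    tfld x.1 y.1 z.1 = tfld x.2 y.2 z.2 := by
  unfold challengeOf at hx hy hz
  split_ifs at hx hy hz with h
  · obtain ⟨h1, h2, h3, h4, h5⟩ := h
    set a := d - blockBits c d with ha
    set j := w₁.val / 2 ^ a with hj
    have hw : w₁.val < w₂.val := by
      by_contra hlt
      have := Nat.div_le_div_right (c := 2 ^ a) (not_lt.1 hlt)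
      omega
    refine tfld_eq_of_clean h3 hw (inBlocks_of_div h5) (inBlocks_of_div (by rwa [h4] at h5))
      (inBlocks_of_div (.inl rfl)) (inBlocks_of_div (.inr h2))
      (fun p => ∃ x ∈ (u₁, w₁) :: (u₂, w₂) :: S.map fun s => (s, s), (x.1.val, x.2.val) = p) ?_
      ⟨x, hx, rfl⟩ ⟨y, hy, rfl⟩ ⟨z, hz, rfl⟩
    rintro p ⟨x, hx, rfl⟩
    rcases List.mem_cons.1 hx with rfl | hx
    · exact .inr (.inl rfl)
    rcases List.mem_cons.1 hx with rfl | hx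
    · exact .inr (.inr rfl)
    obtain ⟨s, hs, rfl⟩ := List.mem_map.1 hx
    exact .inl ⟨rfl, h1 s hs⟩
  · simp at hx

section adversary

variable {F : FRE} {lam : ℕ → ℕ} (L : EfficientLearner (LEncThr F lam)) (c : ℕ)

/-- The sample for the learner: ciphertexts with the parameters and with the labels under the
threshold in the middle. -/
def labelled {d : ℕ} (q : F.params (lam d) d) (cs : List (F.ciphers (lam d) d))
    (S : List (Msg d)) : List ((F.ciphers (lam d) d × F.params (lam d) d) × Bool) :=
  (cs.zip S).map fun x => ((x.1, q), decide (x.2.val < 2 ^ (d - 1)))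

/-- The guess of the adversary, which takes the first two ciphertexts for the challenge and the
others for encryptions of the sample: whether the hypothesis learned from the sample labels both
challenge ciphertexts `1`. -/
def guessOf (d : ℕ) (u₁ u₂ w₁ w₂ : Msg d) (s : Fin (L.coins.eval d) → Bool) (S : List (Msg d))
    (q : F.params (lam d) d) (cs : List (F.ciphers (lam d) d)) : Bool :=
  match cs with
  | c₁ :: c₂ :: cs =>
    decide (gate c d u₁ u₂ w₁ w₂ S) &&
      (L.hyp d (L.learn d (labelled q cs S) s) (c₁, q) &&
        L.hyp d (L.learn d (labelled q cs S) s) (c₂, q))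
  | _ => false

/-- The number of coins of the adversary. -/
noncomputable def advCoins : Polynomial ℕ :=
  (2 * Polynomial.X + 2) ^ c + 4 * Polynomial.X + L.coins +
    (2 * Polynomial.X + 2) ^ c * Polynomial.X

theorem advCoins_ge (d : ℕ) :
    blockBits c d + (4 * d + (L.coins.eval d + 2 ^ blockBits c d * d)) ≤
      (advCoins L c).eval d := by
  have h1 := two_pow_blockBits_le c d
  have h2 : blockBits c d < 2 ^ blockBits c d := Nat.lt_two_pow_self
  have h3 := Nat.mul_le_mul_right d h1
  simp only [advCoins, Polynomial.eval_add, Polynomial.eval_mul, Polynomial.eval_pow,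
    Polynomial.eval_ofNat, Polynomial.eval_X]
  omega

/-- Coins for the learner, as a function. -/
def learnerCoins (d : ℕ) (R : List Bool) : Fin (L.coins.eval d) → Bool :=
  fun i => (coinLearner c d (L.coins.eval d) R).getD i false

/-- The drawn messages. -/
def drawMsg (d k : ℕ) (R : List Bool) : Msg d := msgOf d (coinMsg c d k R)

/-- The drawn sample. -/
def drawSample (d : ℕ) (R : List Bool) : List (Msg d) :=
  (coinSample c d (L.coins.eval d) R).map (msgOf d)

theorem length_coinMsg {d k : ℕ} (hk : k < 4) {R : List Bool}
    (hR : R.length = (advCoins L c).eval d) : (coinMsg c d k R).length = d := by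
  have h := advCoins_ge L c d
  have h2 : (k + 1) * d ≤ 4 * d := Nat.mul_le_mul_right d hk
  rw [add_mul, one_mul] at h2
  simp only [coinMsg, List.length_take, List.length_drop]
  omega

theorem length_coinLearner {d : ℕ} {R : List Bool}
    (hR : R.length = (advCoins L c).eval d) :
    (coinLearner c d (L.coins.eval d) R).length = L.coins.eval d := by
  have h := advCoins_ge L c d
  simp only [coinLearner, List.length_take, List.length_drop]
  omega

theorem coinSize_lt (d : ℕ) (R : List Bool) : coinSize c d R < 2 ^ blockBits c d :=
  (bitsVal_lt _).trans_le (Nat.pow_le_pow_right (by norm_num) (by simp))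

theorem length_coinSample {d : ℕ} {R : List Bool}
    (hR : R.length = (advCoins L c).eval d) :
    ∀ s ∈ coinSample c d (L.coins.eval d) R, s.length = d := by
  intro s hs
  refine length_of_mem_chunks ?_ hs
  have h := advCoins_ge L c d
  have h2 := Nat.mul_le_mul_right d (coinSize_lt c d R).le
  simp only [List.length_drop]
  omega

theorem gate_draw {d : ℕ} {R : List Bool} (hR : R.length = (advCoins L c).eval d) :
    decide (gate c d (drawMsg c d 0 R) (drawMsg c d 1 R) (drawMsg c d 2 R) (drawMsg c d 3 R)
      (drawSample L c d R)) = bitsGate c d (coinMsg c d 0 R) (coinMsg c d 1 R) (coinMsg c d 2 R)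
        (coinMsg c d 3 R) (coinSample c d (L.coins.eval d) R) :=
  (bitsGate_eq (length_coinMsg L c (by norm_num) hR) (length_coinMsg L c (by norm_num) hR)
    (length_coinMsg L c (by norm_num) hR) (length_coinMsg L c (by norm_num) hR)
    (length_coinSample L c hR)).symm

theorem gate_draw_polyTime {ι : Type} {inp : ι → Tr} {d : ι → ℕ} {R : ι → List Bool}
    (hd : PolyComp inp d) (hR : PolyComp inp R)
    (hl : ∀ i, (R i).length = (advCoins L c).eval (d i)) :
    PolyComp inp fun i => decide (gate c (d i) (drawMsg c (d i) 0 (R i)) (drawMsg c (d i) 1 (R i))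
      (drawMsg c (d i) 2 (R i)) (drawMsg c (d i) 3 (R i)) (drawSample L c (d i) (R i))) := by
  refine (PolyComp.bitsGate c hd (hd.coinMsg c 0 hR) (hd.coinMsg c 1 hR) (hd.coinMsg c 2 hR)
    (hd.coinMsg c 3 hR) (hd.coinSample c (hd.evalPoly L.coins) hR) ?_ ?_ ?_ ?_ ?_).congr
      fun i => (gate_draw L c (hl i)).symm
  · exact fun i => (length_coinMsg L c (by norm_num) (hl i)).le
  · exact fun i => (length_coinMsg L c (by norm_num) (hl i)).le
  · exact fun i => (length_coinMsg L c (by norm_num) (hl i)).le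
  · exact fun i => (length_coinMsg L c (by norm_num) (hl i)).le
  · exact fun i s hs => (length_coinSample L c (hl i) s hs).le

theorem challenge_polyTime : PolyTime
    (fun i : (d : ℕ) × (Fin ((advCoins L c).eval d) → Bool) => enc (lam i.1, i.1, i.2))
    (fun i => enc (challengeOf c i.1 (drawMsg c i.1 0 (List.ofFn i.2))
      (drawMsg c i.1 1 (List.ofFn i.2)) (drawMsg c i.1 2 (List.ofFn i.2))
      (drawMsg c i.1 3 (List.ofFn i.2)) (drawSample L c i.1 (List.ofFn i.2)))) := by
  set inp := fun i : (d : ℕ) × (Fin ((advCoins L c).eval d) → Bool) => enc (lam i.1, i.1, i.2)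
    with hinp
  have hid : PolyTime inp inp := .refl
  have hd : PolyComp inp fun i => i.1 := hid.right.left.congr fun _ => rfl
  have hR : PolyComp inp fun i => List.ofFn i.2 := hid.right.right.congr fun _ => rfl
  have hl : ∀ i : (d : ℕ) × (Fin ((advCoins L c).eval d) → Bool),
      (List.ofFn i.2).length = (advCoins L c).eval i.1 := fun i => List.length_ofFn
  refine PolyTime.splitBool (gate_draw_polyTime L c hd hR hl) ?_ ?_
  · have h := ((hd.coinMsg c 0 hR).pair (hd.coinMsg c 2 hR)).cons
      (((hd.coinMsg c 1 hR).pair (hd.coinMsg c 3 hR)).cons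
      ((hd.coinSample c (hd.evalPoly L.coins) hR).map (g := fun _ s => (s, s))
        (PolyComp.pair .atValue .atValue)))
    refine (PolyTime.reindex h _).congr fun i => ?_
    obtain ⟨⟨d, r⟩, hg⟩ := i
    rw [challengeOf, if_pos (of_decide_eq_true hg), enc_cons, enc_cons, enc_cons, enc_cons]
    have e : ∀ k < 4, enc (drawMsg c d k (List.ofFn r)) = enc (coinMsg c d k (List.ofFn r)) :=
      fun k hk => enc_msgOf (length_coinMsg L c hk (by simp))
    have e2 : ∀ x y : Msg d, enc (x, y) = Tr.node (enc x) (enc y) := fun _ _ => rfl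
    have e3 : ∀ x y : List Bool, enc (x, y) = Tr.node (enc x) (enc y) := fun _ _ => rfl
    rw [e2, e2, e3, e3, e 0 (by norm_num), e 1 (by norm_num), e 2 (by norm_num), e 3 (by norm_num)]
    congr 2
    rw [drawSample, List.map_map]
    refine enc_list_map_congr _ _ _ fun s hs => ?_
    rw [Function.comp_apply, e2, e3, enc_msgOf (length_coinSample L c (by simp) s hs)]
  · refine (polyTime_const .leaf).congr fun i => ?_
    rw [challengeOf, if_neg (of_decide_eq_false i.2)]
    rfl

end adversary

/-! ### The running time of the adversary -/

section adversary

variable {F : FRE} {lam : ℕ → ℕ} (L : EfficientLearner (LEncThr F lam)) (c : ℕ)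

theorem ofFn_getD {n : ℕ} {l : List Bool} (h : l.length = n) :
    (List.ofFn fun i : Fin n => l.getD i false) = l := by
  subst h
  refine List.ext_getElem (by simp) fun i h1 h2 => ?_
  simp

theorem enc_learnerCoins {d : ℕ} {R : List Bool} (hR : R.length = (advCoins L c).eval d) :
    enc (learnerCoins L c d R) = enc (coinLearner c d (L.coins.eval d) R) := by
  change enc (List.ofFn fun i : Fin (L.coins.eval d) =>
    (coinLearner c d (L.coins.eval d) R).getD i false) = _
  rw [ofFn_getD (length_coinLearner L c hR)]

theorem guessOf_cons {d : ℕ} {u₁ u₂ w₁ w₂ : Msg d} {s : Fin (L.coins.eval d) → Bool}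
    {S : List (Msg d)} {q : F.params (lam d) d} {c₁ c₂ : F.ciphers (lam d) d}
    {cs : List (F.ciphers (lam d) d)} (h : decide (gate c d u₁ u₂ w₁ w₂ S) = true) :
    guessOf L c d u₁ u₂ w₁ w₂ s S q (c₁ :: c₂ :: cs) =
      (L.hyp d (L.learn d (labelled q cs S) s) (c₁, q) &&
        L.hyp d (L.learn d (labelled q cs S) s) (c₂, q)) := by
  rw [guessOf, h, Bool.true_and]

theorem guessOf_of_not_gate {d : ℕ} {u₁ u₂ w₁ w₂ : Msg d} {s : Fin (L.coins.eval d) → Bool}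
    {S : List (Msg d)} {q : F.params (lam d) d} {cs : List (F.ciphers (lam d) d)}
    (h : decide (gate c d u₁ u₂ w₁ w₂ S) = false) :
    guessOf L c d u₁ u₂ w₁ w₂ s S q cs = false := by
  unfold guessOf
  split
  · rw [h, Bool.false_and]
  · rfl

/-- The learner can be run on a labelled sample, and its hypothesis evaluated on two ciphertexts. -/
theorem guess_aux_polyTime : PolyComp
    (fun j : (d : ℕ) × ((Fin ((advCoins L c).eval d) → Bool) × F.params (lam d) d ×
        (F.ciphers (lam d) d × F.ciphers (lam d) d × List (F.ciphers (lam d) d))) =>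
      Tr.node (enc (lam j.1)) (Tr.node (enc j.1) (Tr.node (enc j.2.1) (Tr.node (enc j.2.2.1)
        (enc (j.2.2.2.1 :: j.2.2.2.2.1 :: j.2.2.2.2.2))))))
    (fun j => L.hyp j.1 (L.learn j.1 (labelled j.2.2.1 j.2.2.2.2.2
          (drawSample L c j.1 (List.ofFn j.2.1))) (learnerCoins L c j.1 (List.ofFn j.2.1)))
          (j.2.2.2.1, j.2.2.1) &&
        L.hyp j.1 (L.learn j.1 (labelled j.2.2.1 j.2.2.2.2.2
          (drawSample L c j.1 (List.ofFn j.2.1))) (learnerCoins L c j.1 (List.ofFn j.2.1)))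
          (j.2.2.2.2.1, j.2.2.1)) := by
  set inp := fun j : (d : ℕ) × ((Fin ((advCoins L c).eval d) → Bool) × F.params (lam d) d ×
        (F.ciphers (lam d) d × F.ciphers (lam d) d × List (F.ciphers (lam d) d))) =>
      Tr.node (enc (lam j.1)) (Tr.node (enc j.1) (Tr.node (enc j.2.1) (Tr.node (enc j.2.2.1)
        (enc (j.2.2.2.1 :: j.2.2.2.2.1 :: j.2.2.2.2.2))))) with hinp
  have hid : PolyTime inp inp := .refl
  have hdesc : PolyTime inp fun j => enc (lam j.1, j.1) :=
    PolyTime.node (hid.left.congr fun _ => rfl) (hid.right.left.congr fun _ => rfl)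
  have hd : PolyComp inp fun j => j.1 := hid.right.left.congr fun _ => rfl
  have hR : PolyComp inp fun j => List.ofFn j.2.1 := hid.right.right.left.congr fun _ => rfl
  have hq : PolyComp inp fun j => j.2.2.1.1 := hid.right.right.right.left.congr fun _ => rfl
  have hc₁ : PolyTime inp fun j => enc j.2.2.2.1 :=
    hid.right.right.right.right.left.congr fun _ => rfl
  have hc₂ : PolyTime inp fun j => enc j.2.2.2.2.1 :=
    hid.right.right.right.right.right.left.congr fun _ => rfl
  have hcs : PolyComp inp fun j => j.2.2.2.2.2.map Subtype.val :=
    hid.right.right.right.right.right.right.congr fun j =>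
      (enc_list_map Subtype.val (fun _ => rfl) j.2.2.2.2.2).symm
  have hS := hd.coinSample c (hd.evalPoly L.coins) hR
  have hlen : ∀ j : (d : ℕ) × ((Fin ((advCoins L c).eval d) → Bool) × F.params (lam d) d ×
      (F.ciphers (lam d) d × F.ciphers (lam d) d × List (F.ciphers (lam d) d))),
      (List.ofFn j.2.1).length = (advCoins L c).eval j.1 := fun j => List.length_ofFn
  have hsample : PolyTime inp fun j => enc (labelled j.2.2.1 j.2.2.2.2.2
      (drawSample L c j.1 (List.ofFn j.2.1))) := by
    have h := (hcs.zip hS).map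
      (g := fun j x => ((x.1, j.2.2.1.1), decide (bitsVal (x.2.drop (j.1 - 1)) = 0))) (by
        refine PolyComp.pair (PolyComp.pair (PolyComp.fst .atValue) hq.atInput)
          (PolyComp.decideEq (PolyComp.bitsVal
            ((hd.sub (.const 1)).atInput.drop (PolyComp.snd .atValue)) ⟨2, fun x => ?_⟩) (.const 0))
        have h1 := length_coinSample L c (hlen x.1.1) x.1.2.2 (List.of_mem_zip x.2).2
        rw [Polynomial.eval_ofNat]
        refine (Nat.pow_le_pow_right (by norm_num) (show _ ≤ 1 from ?_)).trans (by norm_num)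
        rw [List.length_drop, h1]
        omega)
    refine PolyTime.congr h fun j => ?_
    dsimp only
    rw [labelled, drawSample, List.zip_map_left, List.zip_map_right, List.map_map, List.map_map]
    refine (enc_list_map_congr _ _ _ fun x hx => ?_).symm
    have h1 := length_coinSample L c (hlen j) x.2 (List.of_mem_zip hx).2
    simp only [Function.comp_apply, Prod.map_fst, Prod.map_snd, id]
    have h2 : decide ((msgOf j.1 x.2).val < 2 ^ (j.1 - 1)) =
        decide (bitsVal (x.2.drop (j.1 - 1)) = 0) := by
      rw [decide_eq_decide, bitsVal_drop, ← msgOf_val h1, Nat.div_eq_zero_iff]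
      simp
    rw [h2]
    rfl
  have hlc : PolyTime inp fun j => enc (learnerCoins L c j.1 (List.ofFn j.2.1)) :=
    PolyTime.congr (hd.coinLearner c (hd.evalPoly L.coins) hR)
      fun j => (enc_learnerCoins L c (hlen j)).symm
  have hlearn : PolyTime inp fun j => L.learn j.1 (labelled j.2.2.1 j.2.2.2.2.2
      (drawSample L c j.1 (List.ofFn j.2.1))) (learnerCoins L c j.1 (List.ofFn j.2.1)) :=
    (hdesc.node (hsample.node hlc)).trans (L.learn_polyTime.reindex fun j : (d : ℕ) ×
      ((Fin ((advCoins L c).eval d) → Bool) × F.params (lam d) d ×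
      (F.ciphers (lam d) d × F.ciphers (lam d) d × List (F.ciphers (lam d) d))) =>
      ⟨j.1, labelled j.2.2.1 j.2.2.2.2.2 (drawSample L c j.1 (List.ofFn j.2.1)),
        learnerCoins L c j.1 (List.ofFn j.2.1)⟩)
  refine PolyComp.and ?_ ?_
  · exact (hdesc.node (hlearn.node (hc₁.node hq))).trans
      (L.hyp_polyTime.reindex fun j : (d : ℕ) ×
      ((Fin ((advCoins L c).eval d) → Bool) × F.params (lam d) d ×
      (F.ciphers (lam d) d × F.ciphers (lam d) d × List (F.ciphers (lam d) d))) =>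
      ⟨j.1, L.learn j.1 (labelled j.2.2.1 j.2.2.2.2.2
        (drawSample L c j.1 (List.ofFn j.2.1))) (learnerCoins L c j.1 (List.ofFn j.2.1)),
        (j.2.2.2.1, j.2.2.1)⟩)
  · exact (hdesc.node (hlearn.node (hc₂.node hq))).trans
      (L.hyp_polyTime.reindex fun j : (d : ℕ) ×
      ((Fin ((advCoins L c).eval d) → Bool) × F.params (lam d) d ×
      (F.ciphers (lam d) d × F.ciphers (lam d) d × List (F.ciphers (lam d) d))) =>
      ⟨j.1, L.learn j.1 (labelled j.2.2.1 j.2.2.2.2.2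
        (drawSample L c j.1 (List.ofFn j.2.1))) (learnerCoins L c j.1 (List.ofFn j.2.1)),
        (j.2.2.2.2.1, j.2.2.1)⟩)

theorem guess_polyTime : PolyTime
    (fun j : (d : ℕ) × ((Fin ((advCoins L c).eval d) → Bool) × F.params (lam d) d ×
        List (F.ciphers (lam d) d)) => enc (lam j.1, j.1, j.2))
    (fun j => enc (guessOf L c j.1 (drawMsg c j.1 0 (List.ofFn j.2.1))
      (drawMsg c j.1 1 (List.ofFn j.2.1)) (drawMsg c j.1 2 (List.ofFn j.2.1))
      (drawMsg c j.1 3 (List.ofFn j.2.1)) (learnerCoins L c j.1 (List.ofFn j.2.1))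
      (drawSample L c j.1 (List.ofFn j.2.1)) j.2.2.1 j.2.2.2)) := by
  set inp := fun j : (d : ℕ) × ((Fin ((advCoins L c).eval d) → Bool) × F.params (lam d) d ×
    List (F.ciphers (lam d) d)) => enc (lam j.1, j.1, j.2) with hinp
  have hid : PolyTime inp inp := .refl
  have hd : PolyComp inp fun j => j.1 := hid.right.left.congr fun _ => rfl
  have hR : PolyComp inp fun j => List.ofFn j.2.1 := hid.right.right.left.congr fun _ => rfl
  have hg := gate_draw_polyTime L c hd hR fun j => List.length_ofFn
  have hcs : PolyComp inp fun j => j.2.2.2.map Subtype.val :=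
    hid.right.right.right.right.congr fun j =>
      (enc_list_map Subtype.val (fun _ => rfl) j.2.2.2).symm
  refine PolyTime.splitBool hcs.tail.isEmpty ?_ (PolyTime.splitBool (hg.reindex _) ?_ ?_)
  · refine (polyTime_const (enc false)).congr fun j => ?_
    obtain ⟨⟨d, r, q, cs⟩, h⟩ := j
    match cs, h with
    | [], _ => rfl
    | [_], _ => rfl
    | _ :: _ :: _, h => simp at h
  · have h2 (j : {j : {j : (d : ℕ) × ((Fin ((advCoins L c).eval d) → Bool) × F.params (lam d) d ×
        List (F.ciphers (lam d) d)) // (j.2.2.2.map Subtype.val).tail.isEmpty = false} //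
        decide (gate c j.1.1 (drawMsg c j.1.1 0 (List.ofFn j.1.2.1))
        (drawMsg c j.1.1 1 (List.ofFn j.1.2.1)) (drawMsg c j.1.1 2 (List.ofFn j.1.2.1))
        (drawMsg c j.1.1 3 (List.ofFn j.1.2.1)) (drawSample L c j.1.1 (List.ofFn j.1.2.1))) =
          true}) : ∃ c₁ c₂ cs, j.1.1.2.2.2 = c₁ :: c₂ :: cs := by
      obtain ⟨⟨⟨d, r, q, cs⟩, h⟩, h'⟩ := j
      match cs, h with
      | [], h => simp at h
      | [_], h => simp at h
      | c₁ :: c₂ :: cs, h => exact ⟨c₁, c₂, cs, rfl⟩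
    choose c₁ c₂ cs hcs' using h2
    refine (PolyTime.congrInput ((guess_aux_polyTime L c).reindex fun j =>
      ⟨j.1.1.1, j.1.1.2.1, j.1.1.2.2.1, c₁ j, c₂ j, cs j⟩) fun j => ?_).congr fun j => ?_
    · exact congrArg (fun l => Tr.node (enc (lam j.1.1.1)) (Tr.node (enc j.1.1.1)
        (Tr.node (enc j.1.1.2.1) (Tr.node (enc j.1.1.2.2.1) (enc l))))) (hcs' j).symm
    · exact (congrArg enc ((congrArg (guessOf L c j.1.1.1 _ _ _ _ _ _ j.1.1.2.2.1)
        (hcs' j)).trans (guessOf_cons L c j.2))).symm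
  · refine (polyTime_const (enc false)).congr fun j => ?_
    rw [guessOf_of_not_gate L c j.2]

/-- The adversary against the static security of the scheme that is built from a learner `L` for
encrypted thresholds. It guesses the sample size of `L`, draws a sample and challenge messages
`u₁ < u₂` from the same block and `w₁, w₂` from consecutive blocks, runs `L` on the encrypted sample
and tests whether the hypothesis accepts both challenge ciphertexts. If its random choices do not
satisfy `gate`, it submits nothing and outputs `0`. -/
noncomputable def adversary : F.Adversary lam tfld where
  coins := advCoins L c
  challenge d r := challengeOf c d (drawMsg c d 0 (List.ofFn r)) (drawMsg c d 1 (List.ofFn r))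
    (drawMsg c d 2 (List.ofFn r)) (drawMsg c d 3 (List.ofFn r)) (drawSample L c d (List.ofFn r))
  guess d r q cs := guessOf L c d (drawMsg c d 0 (List.ofFn r)) (drawMsg c d 1 (List.ofFn r))
    (drawMsg c d 2 (List.ofFn r)) (drawMsg c d 3 (List.ofFn r)) (learnerCoins L c d (List.ofFn r))
    (drawSample L c d (List.ofFn r)) q cs
  leak_eq _ _ x hx y hy z hz := challengeOf_leak_eq x hx y hy z hz
  challenge_polyTime := challenge_polyTime L c
  guess_polyTime := guess_polyTime L c

end adversary

/-! ### Averaging over the coins of the adversary -/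

theorem expect_append {m k T : ℕ} (h : m + k = T) (F : List Bool → ℝ) :
    𝔼 r : Fin T → Bool, F (List.ofFn r) =
      𝔼 a : Fin m → Bool, 𝔼 b : Fin k → Bool, F (List.ofFn a ++ List.ofFn b) := by
  subst h
  rw [← expect_prod fun x : (Fin m → Bool) × (Fin k → Bool) => F (List.ofFn x.1 ++ List.ofFn x.2)]
  refine (Fintype.expect_equiv (Fin.appendEquiv m k) _ _ fun x => ?_).symm
  rw [← List.ofFn_fin_append]
  rfl

theorem ofFn_testBit_of_length {l : List Bool} {d : ℕ} (h : l.length = d) :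
    (List.ofFn fun i : Fin d => (bitsVal l).testBit i) = l := by
  subst h
  exact ofFn_testBit_bitsVal l

theorem msgOf_ofFn_bijective (d : ℕ) :
    Function.Bijective fun r : Fin d → Bool => msgOf d (List.ofFn r) := by
  rw [Fintype.bijective_iff_injective_and_card]
  refine ⟨fun r r' h => ?_, by simp⟩
  have h1 : bitsVal (List.ofFn r) = bitsVal (List.ofFn r') := by
    rw [← msgOf_val (d := d) (by simp), ← msgOf_val (d := d) (by simp)]
    exact congrArg Fin.val h
  have h2 := ofFn_testBit_of_length (l := List.ofFn r) (d := d) (by simp)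
  rw [h1, ofFn_testBit_of_length (by simp)] at h2
  exact (List.ofFn_injective h2).symm

theorem expect_msgOf (d : ℕ) (F : Msg d → ℝ) :
    𝔼 r : Fin d → Bool, F (msgOf d (List.ofFn r)) = 𝔼 m, F m :=
  Fintype.expect_bijective _ (msgOf_ofFn_bijective d) _ _ fun _ => rfl

theorem expect_bitsVal (d : ℕ) (F : ℕ → ℝ) :
    𝔼 r : Fin d → Bool, F (bitsVal (List.ofFn r)) = 𝔼 m : Msg d, F m := by
  rw [← expect_msgOf d fun m => F m]
  refine Finset.expect_congr rfl fun r _ => ?_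
  rw [msgOf_val (by simp)]

theorem expect_chunks (d n K : ℕ) (h : n * d ≤ K) (F : List (Msg d) → ℝ) :
    𝔼 r : Fin K → Bool, F ((chunks d n (List.ofFn r)).map (msgOf d)) =
      𝔼 v : Fin n → Msg d, F (List.ofFn v) := by
  induction n generalizing K F with
  | zero => simp [chunks]
  | succ n ih =>
    rw [add_mul, one_mul] at h
    rw [expect_append (show d + (K - d) = K by omega)
      fun l => F ((chunks d (n + 1) l).map (msgOf d)), expect_cons]
    have h1 : ∀ (a : Fin d → Bool) (b : Fin (K - d) → Bool),
        (chunks d (n + 1) (List.ofFn a ++ List.ofFn b)).map (msgOf d) =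
          msgOf d (List.ofFn a) :: (chunks d n (List.ofFn b)).map (msgOf d) := by
      intro a b
      rw [chunks, List.map_cons, List.take_left' (by simp), List.drop_left' (by simp)]
    simp only [h1]
    rw [← expect_msgOf d fun m => 𝔼 v : Fin n → Msg d, F (List.ofFn (Fin.cons m v : Fin (n + 1) → _))]
    refine Finset.expect_congr rfl fun a _ => ?_
    rw [ih (K - d) (by omega) fun l => F (msgOf d (List.ofFn a) :: l)]
    refine Finset.expect_congr rfl fun v _ => ?_
    rw [List.ofFn_succ]
    simp

theorem expect_congr' {A : Type} [Fintype A] {f g : A → ℝ} (h : ∀ a, f a = g a) :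
    𝔼 a, f a = 𝔼 a, g a := Finset.expect_congr rfl fun a _ => h a

section adversary

variable {F : FRE} {lam : ℕ → ℕ} (L : EfficientLearner (LEncThr F lam)) (c : ℕ)

/-- The messages, the coins of the learner and the sample that the adversary draws are independent
and uniform, and the size of the sample is uniform as well. -/
theorem expect_draw (d : ℕ) (G : Msg d → Msg d → Msg d → Msg d → (Fin (L.coins.eval d) → Bool) →
      List (Msg d) → ℝ) :
    𝔼 r : Fin ((advCoins L c).eval d) → Bool, G (drawMsg c d 0 (List.ofFn r))
      (drawMsg c d 1 (List.ofFn r)) (drawMsg c d 2 (List.ofFn r)) (drawMsg c d 3 (List.ofFn r))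
      (learnerCoins L c d (List.ofFn r)) (drawSample L c d (List.ofFn r)) =
    𝔼 m : Msg (blockBits c d), 𝔼 u₁, 𝔼 u₂, 𝔼 w₁, 𝔼 w₂, 𝔼 s, 𝔼 v : Fin m → Msg d,
      G u₁ u₂ w₁ w₂ s (List.ofFn v) := by
  set ν := blockBits c d with hν
  have hT := advCoins_ge L c d
  set T := (advCoins L c).eval d
  rw [← hν] at hT
  obtain ⟨K, hK⟩ : ∃ K, T = ν + (d + (d + (d + (d + (L.coins.eval d + K))))) :=
    ⟨T - (ν + (4 * d + L.coins.eval d)), by omega⟩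
  have hKd : 2 ^ ν * d ≤ K := by omega
  rw [expect_append hK.symm (fun R => G (drawMsg c d 0 R) (drawMsg c d 1 R) (drawMsg c d 2 R)
    (drawMsg c d 3 R) (learnerCoins L c d R) (drawSample L c d R)),
    ← expect_bitsVal ν fun m => 𝔼 u₁, 𝔼 u₂, 𝔼 w₁, 𝔼 w₂, 𝔼 s, 𝔼 v : Fin m → Msg d,
      G u₁ u₂ w₁ w₂ s (List.ofFn v)]
  refine expect_congr' fun r₀ => ?_
  rw [expect_append rfl fun R => G (drawMsg c d 0 (List.ofFn r₀ ++ R))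
    (drawMsg c d 1 (List.ofFn r₀ ++ R)) (drawMsg c d 2 (List.ofFn r₀ ++ R))
    (drawMsg c d 3 (List.ofFn r₀ ++ R)) (learnerCoins L c d (List.ofFn r₀ ++ R))
    (drawSample L c d (List.ofFn r₀ ++ R)), ← expect_msgOf d]
  refine expect_congr' fun r₁ => ?_
  rw [expect_append rfl fun R => G (drawMsg c d 0 (List.ofFn r₀ ++ (List.ofFn r₁ ++ R)))
    (drawMsg c d 1 (List.ofFn r₀ ++ (List.ofFn r₁ ++ R)))
    (drawMsg c d 2 (List.ofFn r₀ ++ (List.ofFn r₁ ++ R)))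
    (drawMsg c d 3 (List.ofFn r₀ ++ (List.ofFn r₁ ++ R)))
    (learnerCoins L c d (List.ofFn r₀ ++ (List.ofFn r₁ ++ R)))
    (drawSample L c d (List.ofFn r₀ ++ (List.ofFn r₁ ++ R))), ← expect_msgOf d]
  refine expect_congr' fun r₂ => ?_
  rw [expect_append rfl fun R =>
    G (drawMsg c d 0 (List.ofFn r₀ ++ (List.ofFn r₁ ++ (List.ofFn r₂ ++ R))))
    (drawMsg c d 1 (List.ofFn r₀ ++ (List.ofFn r₁ ++ (List.ofFn r₂ ++ R))))
    (drawMsg c d 2 (List.ofFn r₀ ++ (List.ofFn r₁ ++ (List.ofFn r₂ ++ R))))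
    (drawMsg c d 3 (List.ofFn r₀ ++ (List.ofFn r₁ ++ (List.ofFn r₂ ++ R))))
    (learnerCoins L c d (List.ofFn r₀ ++ (List.ofFn r₁ ++ (List.ofFn r₂ ++ R))))
    (drawSample L c d (List.ofFn r₀ ++ (List.ofFn r₁ ++ (List.ofFn r₂ ++ R)))), ← expect_msgOf d]
  refine expect_congr' fun r₃ => ?_
  rw [expect_append rfl fun R =>
    G (drawMsg c d 0 (List.ofFn r₀ ++ (List.ofFn r₁ ++ (List.ofFn r₂ ++ (List.ofFn r₃ ++ R)))))
    (drawMsg c d 1 (List.ofFn r₀ ++ (List.ofFn r₁ ++ (List.ofFn r₂ ++ (List.ofFn r₃ ++ R)))))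
    (drawMsg c d 2 (List.ofFn r₀ ++ (List.ofFn r₁ ++ (List.ofFn r₂ ++ (List.ofFn r₃ ++ R)))))
    (drawMsg c d 3 (List.ofFn r₀ ++ (List.ofFn r₁ ++ (List.ofFn r₂ ++ (List.ofFn r₃ ++ R)))))
    (learnerCoins L c d
      (List.ofFn r₀ ++ (List.ofFn r₁ ++ (List.ofFn r₂ ++ (List.ofFn r₃ ++ R)))))
    (drawSample L c d (List.ofFn r₀ ++ (List.ofFn r₁ ++ (List.ofFn r₂ ++ (List.ofFn r₃ ++ R))))),
    ← expect_msgOf d]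
  refine expect_congr' fun r₄ => ?_
  have hd0 (R : List Bool) : (List.ofFn r₀ ++ R).drop ν = R := List.drop_left' (by simp)
  have hd1 (R : List Bool) : (List.ofFn r₁ ++ R).drop (1 * d) = R := List.drop_left' (by simp)
  have hd2 (R : List Bool) : (List.ofFn r₁ ++ (List.ofFn r₂ ++ R)).drop (2 * d) = R := by
    rw [← List.append_assoc]
    exact List.drop_left' (by simp; ring)
  have hd3 (R : List Bool) :
      (List.ofFn r₁ ++ (List.ofFn r₂ ++ (List.ofFn r₃ ++ R))).drop (3 * d) = R := by
    rw [← List.append_assoc, ← List.append_assoc]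
    exact List.drop_left' (by simp; ring)
  have hd4 (R : List Bool) :
      (List.ofFn r₁ ++ (List.ofFn r₂ ++ (List.ofFn r₃ ++ (List.ofFn r₄ ++ R)))).drop (4 * d) =
        R := by
    rw [← List.append_assoc, ← List.append_assoc, ← List.append_assoc]
    exact List.drop_left' (by simp; ring)
  have ht (r : Fin d → Bool) (R : List Bool) : (List.ofFn r ++ R).take d = List.ofFn r :=
    List.take_left' (by simp)
  have ht0 (R : List Bool) : (List.ofFn r₀ ++ R).take ν = List.ofFn r₀ :=
    List.take_left' (by simp)
  rw [expect_append rfl fun R =>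
    G (drawMsg c d 0 (List.ofFn r₀ ++ (List.ofFn r₁ ++ (List.ofFn r₂ ++ (List.ofFn r₃ ++
      (List.ofFn r₄ ++ R))))))
    (drawMsg c d 1 (List.ofFn r₀ ++ (List.ofFn r₁ ++ (List.ofFn r₂ ++ (List.ofFn r₃ ++
      (List.ofFn r₄ ++ R))))))
    (drawMsg c d 2 (List.ofFn r₀ ++ (List.ofFn r₁ ++ (List.ofFn r₂ ++ (List.ofFn r₃ ++
      (List.ofFn r₄ ++ R))))))
    (drawMsg c d 3 (List.ofFn r₀ ++ (List.ofFn r₁ ++ (List.ofFn r₂ ++ (List.ofFn r₃ ++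
      (List.ofFn r₄ ++ R))))))
    (learnerCoins L c d (List.ofFn r₀ ++ (List.ofFn r₁ ++ (List.ofFn r₂ ++ (List.ofFn r₃ ++
      (List.ofFn r₄ ++ R))))))
    (drawSample L c d (List.ofFn r₀ ++ (List.ofFn r₁ ++ (List.ofFn r₂ ++ (List.ofFn r₃ ++
      (List.ofFn r₄ ++ R))))))]
  refine expect_congr' fun s => ?_
  have hts (R : List Bool) : (List.ofFn s ++ R).take (L.coins.eval d) = List.ofFn s :=
    List.take_left' (by simp)
  have hds (R : List Bool) : (List.ofFn s ++ R).drop (L.coins.eval d) = R := List.drop_left' (by simp)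
  have hlc (R : List Bool) : learnerCoins L c d (List.ofFn r₀ ++ (List.ofFn r₁ ++
      (List.ofFn r₂ ++ (List.ofFn r₃ ++ (List.ofFn r₄ ++ (List.ofFn s ++ R)))))) = s := by
    funext i
    simp only [learnerCoins, coinLearner, ← hν, hd0, hd4, hts]
    simp [List.getD_eq_getElem?_getD]
  simp only [hlc]
  simp only [drawMsg, drawSample, coinMsg, coinSample, coinSize, ← hν, hd0, hd1, hd2, hd3,
    hd4, ht, ht0, hds, zero_mul, List.drop_zero]
  refine expect_chunks d _ K ?_ fun l => G _ _ _ _ s l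
  refine (Nat.mul_le_mul_right d (bitsVal_lt _).le).trans ?_
  simpa using hKd

/-! ### The advantage of the adversary -/

/-- An encryption, under the key and parameters generated from the coins `r`. -/
def encExample (F : FRE) (l d : ℕ) (r : Fin (F.genCoins.eval (l + d)) → Bool) (v : Msg d)
    (s : Fin (F.encCoins.eval (l + d)) → Bool) : F.ciphers l d × F.params l d :=
  (F.Enc l d (F.Gen l d r).1 v s, (F.Gen l d r).2)

/-- Probability that a hypothesis labels an encryption of a message `1`. -/
noncomputable def posProb (F : FRE) (l d : ℕ) (r : Fin (F.genCoins.eval (l + d)) → Bool)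
    (h : F.ciphers l d × F.params l d → Bool) (v : Msg d) : ℝ :=
  𝔼 s, ind (h (encExample F l d r v s) = true)

/-- The sample for the messages and coins `z`, labelled with the threshold in the middle. -/
def sampleOf (F : FRE) (l d : ℕ) (r : Fin (F.genCoins.eval (l + d)) → Bool) {n : ℕ}
    (z : Fin n → Msg d × (Fin (F.encCoins.eval (l + d)) → Bool)) :
    Fin n → (F.ciphers l d × F.params l d) × Bool :=
  fun i => (encExample F l d r (z i).1 (z i).2, decide ((z i).1.val < 2 ^ (d - 1)))

/-- The hypothesis that is learned from the sample `sampleOf F l d r z`. -/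
def hypOf {d n : ℕ} (r : Fin (F.genCoins.eval (lam d + d)) → Bool)
    (s : Fin (L.coins.eval d) → Bool)
    (z : Fin n → Msg d × (Fin (F.encCoins.eval (lam d + d)) → Bool)) :
    F.ciphers (lam d) d × F.params (lam d) d → Bool :=
  L.hyp d (L.learn d (List.ofFn (sampleOf F (lam d) d r z)) s)

theorem labelled_ofFn {d n : ℕ} (r : Fin (F.genCoins.eval (lam d + d)) → Bool)
    (v : Fin n → Msg d) (w : Fin n → Fin (F.encCoins.eval (lam d + d)) → Bool) :
    labelled (F.Gen (lam d) d r).2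
      (List.ofFn fun i => F.Enc (lam d) d (F.Gen (lam d) d r).1 (v i) (w i)) (List.ofFn v) =
      List.ofFn (sampleOf F (lam d) d r fun i => (v i, w i)) := by
  refine List.ext_getElem (by simp [labelled]) fun i h1 h2 => ?_
  simp [labelled, sampleOf, encExample]

theorem ind_and (b b' : Bool) : ind ((b && b') = true) = ind (b = true) * ind (b' = true) := by
  cases b <;> cases b' <;> simp [ind]

/-- The probability that the adversary outputs `1`, where `y` is the pair of challenge messages
that is encrypted. -/
theorem prob_guess {d n : ℕ} (u₁ u₂ w₁ w₂ : Msg d) (s : Fin (L.coins.eval d) → Bool)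
    (v : Fin n → Msg d) (r : Fin (F.genCoins.eval (lam d + d)) → Bool) (b : Bool) :
    listAvg (fun p : Msg d × Msg d => F.Enc (lam d) d (F.Gen (lam d) d r).1
        (bif b then p.2 else p.1))
      (challengeOf c d u₁ u₂ w₁ w₂ (List.ofFn v))
      (fun cs => ind (guessOf L c d u₁ u₂ w₁ w₂ s (List.ofFn v) (F.Gen (lam d) d r).2 cs = true)) =
    ind (gate c d u₁ u₂ w₁ w₂ (List.ofFn v)) *
      𝔼 w : Fin n → Fin (F.encCoins.eval (lam d + d)) → Bool,
        posProb F (lam d) d r (hypOf L r s fun i => (v i, w i)) (bif b then w₁ else u₁) *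
        posProb F (lam d) d r (hypOf L r s fun i => (v i, w i)) (bif b then w₂ else u₂) := by
  by_cases hg : gate c d u₁ u₂ w₁ w₂ (List.ofFn v)
  · rw [ind_true hg, one_mul, challengeOf, if_pos hg, listAvg]
    simp only [listAvg]
    simp only [guessOf_cons L c (decide_eq_true hg), ind_and, listAvg_map, Bool.cond_self,
      listAvg_ofFn]
    have h1 : ∀ x y : Fin (F.encCoins.eval (lam d + d)) → Bool, (fun w : Fin n →
        Fin (F.encCoins.eval (lam d + d)) → Bool => ind (L.hyp d (L.learn d
          (labelled (F.Gen (lam d) d r).2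
            (List.ofFn fun i => F.Enc (lam d) d (F.Gen (lam d) d r).1 (v i) (w i)) (List.ofFn v)) s)
          (F.Enc (lam d) d (F.Gen (lam d) d r).1 (bif b then w₁ else u₁) x,
            (F.Gen (lam d) d r).2) = true) *
        ind (L.hyp d (L.learn d
          (labelled (F.Gen (lam d) d r).2
            (List.ofFn fun i => F.Enc (lam d) d (F.Gen (lam d) d r).1 (v i) (w i)) (List.ofFn v)) s)
          (F.Enc (lam d) d (F.Gen (lam d) d r).1 (bif b then w₂ else u₂) y,
            (F.Gen (lam d) d r).2) = true)) = fun w =>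
        ind (hypOf L r s (fun i => (v i, w i))
          (encExample F (lam d) d r (bif b then w₁ else u₁) x) = true) *
        ind (hypOf L r s (fun i => (v i, w i))
          (encExample F (lam d) d r (bif b then w₂ else u₂) y) = true) := by
      intro x y
      funext w
      rw [labelled_ofFn]
      rfl
    simp only [h1]
    simp only [posProb, Finset.expect_mul_expect]
    rw [Finset.expect_congr rfl fun x _ => Finset.expect_comm _ _ _, Finset.expect_comm]
  · rw [ind_false hg, zero_mul, challengeOf, if_neg hg, listAvg,
      guessOf_of_not_gate L c (decide_eq_false hg)]
    exact ind_false (by simp)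

/-- The winning probabilities of the adversary in terms of the acceptance probabilities of the
learned hypothesis. -/
theorem prob_game (d : ℕ) (b : Bool) :
    prob (FRE.game (adversary L c) b d) {true} =
      𝔼 m : Msg (blockBits c d), 𝔼 u₁, 𝔼 u₂, 𝔼 w₁, 𝔼 w₂, 𝔼 s, 𝔼 v : Fin m → Msg d, 𝔼 r,
      ind (gate c d u₁ u₂ w₁ w₂ (List.ofFn v)) *
      𝔼 w : Fin m → Fin (F.encCoins.eval (lam d + d)) → Bool,
        posProb F (lam d) d r (hypOf L r s fun i => (v i, w i)) (bif b then w₁ else u₁) *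
        posProb F (lam d) d r (hypOf L r s fun i => (v i, w i)) (bif b then w₂ else u₂) := by
  have h := expect_draw L c d fun u₁ u₂ w₁ w₂ s S => 𝔼 r : Fin (F.genCoins.eval (lam d + d)) → Bool,
    listAvg (fun p : Msg d × Msg d => F.Enc (lam d) d (F.Gen (lam d) d r).1
        (bif b then p.2 else p.1)) (challengeOf c d u₁ u₂ w₁ w₂ S)
      (fun cs => ind (guessOf L c d u₁ u₂ w₁ w₂ s S (F.Gen (lam d) d r).2 cs = true))
  simp only [prob_guess] at h
  rw [← h]
  rw [FRE.game, coinFlips, prob_uniform_bind]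
  refine expect_congr' fun r => ?_
  rw [FRE.genDist, coinFlips, prob_uniform_map_bind]
  refine expect_congr' fun r' => ?_
  exact prob_indep_list (fun p : Msg d × Msg d => F.Enc (lam d) d (F.Gen (lam d) d r').1
        (bif b then p.2 else p.1)) _ _ _

end adversary

/-! ### The drop of a hypothesis between consecutive blocks -/

section blocks

variable {V : Type} [Fintype V] (N : ℕ) (J : V → ℕ) (p : V → ℝ)

/-- Mean of `p` over the `j`-th of the `N` blocks of equal size, where `J` is the block number. -/
noncomputable def blockMean (j : ℕ) : ℝ := N * 𝔼 v, ind (J v = j) * p v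

/-- The change of the mean between block `j` and the next one. -/
noncomputable def blockDrop (j : ℕ) : ℝ := |blockMean N J p j - blockMean N J p (j + 1)|

theorem ind_mul_ind (a b : Prop) : ind a * ind b = ind (a ∧ b) := by
  by_cases ha : a <;> by_cases hb : b <;> simp [ind, ha, hb]

/-- Summing over ordered pairs `u < u'` counts half of all pairs up to the diagonal. -/
theorem two_mul_expect_lt [LinearOrder V] (x : V → ℝ) :
    2 * 𝔼 u, 𝔼 u', ind (u < u') * (x u * x u') =
      (𝔼 u, x u) ^ 2 - (Fintype.card V : ℝ)⁻¹ * 𝔼 u, x u ^ 2 := by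
  have h1 : 𝔼 u, 𝔼 u', ind (u < u') * (x u * x u') = 𝔼 u, 𝔼 u', ind (u' < u) * (x u * x u') := by
    rw [Finset.expect_comm]
    refine expect_congr' fun u => expect_congr' fun u' => ?_
    ring
  have h2 : (Fintype.card V : ℝ)⁻¹ * 𝔼 u, x u ^ 2 = 𝔼 u, 𝔼 u', ind (u = u') * (x u * x u') := by
    rw [Finset.mul_expect]
    refine expect_congr' fun u => ?_
    rw [Fintype.expect_eq_sum_div_card, Finset.sum_eq_single u]
    · rw [ind_true rfl]; ring
    · intro u' _ h
      rw [ind_false (Ne.symm h), zero_mul]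
    · simp
  rw [h2, two_mul]
  nth_rewrite 2 [h1]
  rw [sq, Finset.expect_mul_expect, ← Finset.expect_add_distrib, ← Finset.expect_sub_distrib]
  refine expect_congr' fun u => ?_
  rw [← Finset.expect_add_distrib, ← Finset.expect_sub_distrib]
  refine expect_congr' fun u' => ?_
  rcases lt_trichotomy u u' with h | h | h
  · simp [ind, h, h.not_gt, h.ne]
  · simp [ind, h]
  · simp [ind, h, h.not_gt, h.ne']

theorem expect_mul_sub (b b' : V → ℝ) (A : V → V → ℝ) :
    𝔼 u, 𝔼 u', 𝔼 w, 𝔼 w', b w * b' w' * A u u' * (p u * p u' - p w * p w') =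
      (𝔼 w, b w) * (𝔼 w, b' w) * (𝔼 u, 𝔼 u', A u u' * (p u * p u')) -
      (𝔼 w, b w * p w) * (𝔼 w, b' w * p w) * 𝔼 u, 𝔼 u', A u u' := by
  have h : ∀ u u', 𝔼 w, 𝔼 w', b w * b' w' * A u u' * (p u * p u' - p w * p w') =
      (𝔼 w, b w) * (𝔼 w, b' w) * (A u u' * (p u * p u')) -
      (𝔼 w, b w * p w) * (𝔼 w, b' w * p w) * A u u' := by
    intro u u'
    rw [Finset.expect_mul_expect, Finset.expect_mul_expect, Finset.expect_mul, Finset.expect_mul,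
      ← Finset.expect_sub_distrib]
    refine expect_congr' fun w => ?_
    rw [Finset.expect_mul, Finset.expect_mul, ← Finset.expect_sub_distrib]
    refine expect_congr' fun w' => ?_
    ring
  simp only [h, Finset.expect_sub_distrib, Finset.mul_expect]

theorem expect_sum_range {A : Type} [Fintype A] (K : ℕ) (f : A → ℕ → ℝ) :
    𝔼 a, ∑ j ∈ range K, f a j = ∑ j ∈ range K, 𝔼 a, f a j := Finset.expect_sum_comm _ _ _

variable {N J p}

section drop

variable [LinearOrder V] (hJN : ∀ v, J v < N) (hJ : ∀ j < N, 𝔼 v, ind (J v = j) = (N : ℝ)⁻¹)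
  (h0 : ∀ v, 0 ≤ p v) (h1 : ∀ v, p v ≤ 1)
include hJ h0 h1

theorem two_mul_expect_block_ge {j : ℕ} (hj : j < N) :
    (𝔼 v, ind (J v = j) * p v) ^ 2 - (N : ℝ)⁻¹ * (Fintype.card V : ℝ)⁻¹ ≤
      2 * 𝔼 u, 𝔼 u', ind (u < u') * (ind (J u = j) * ind (J u' = j)) * (p u * p u') := by
  have h := two_mul_expect_lt fun u => ind (J u = j) * p u
  have h2 : 𝔼 u, (ind (J u = j) * p u) ^ 2 ≤ (N : ℝ)⁻¹ := by
    rw [← hJ j hj]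
    refine expect_mono fun u => ?_
    by_cases hu : J u = j
    · rw [ind_true hu]; nlinarith [h0 u, h1 u]
    · rw [ind_false hu]; simp
  have h3 : 𝔼 u, 𝔼 u', ind (u < u') * (ind (J u = j) * ind (J u' = j)) * (p u * p u') =
      𝔼 u, 𝔼 u', ind (u < u') * (ind (J u = j) * p u * (ind (J u' = j) * p u')) :=
    expect_congr' fun u => expect_congr' fun u' => by ring
  rw [h3, h, mul_comm (N : ℝ)⁻¹]
  gcongr

omit h0 h1 in
theorem two_mul_expect_block_le {j : ℕ} (hj : j < N) :
    2 * 𝔼 u, 𝔼 u', ind (u < u') * (ind (J u = j) * ind (J u' = j)) ≤ (N : ℝ)⁻¹ ^ 2 := by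
  rw [two_mul_expect_lt fun u => ind (J u = j), hJ j hj]
  have : 0 ≤ 𝔼 u, ind (J u = j) ^ 2 := expect_nonneg' fun u => sq_nonneg _
  have := mul_nonneg (inv_nonneg.2 (Nat.cast_nonneg (α := ℝ) (Fintype.card V))) this
  linarith

include hJN

/-- Let `u₁ < u₂` be drawn from the same block, which is `j` or `j + 1`, and `w₁, w₂` from the
blocks `j` and `j + 1`. If `σ` and `σ'` are the means of `p` over the two blocks, then the
expectation of `p u₁ * p u₂ - p w₁ * p w₂` is `(σ ^ 2 + σ' ^ 2) / 2 - σ * σ'`, which is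
`(σ - σ') ^ 2 / 2`, up to the pairs with `u₁ = u₂`. -/
theorem expect_gate_ge (hN : 0 < N) (G : V → V → V → V → Prop) (cl : ℕ → Prop)
    (hG : ∀ u₁ u₂ w₁ w₂, G u₁ u₂ w₁ w₂ ↔ cl (J w₁) ∧ J w₂ = J w₁ + 1 ∧ u₁ < u₂ ∧ J u₁ = J u₂ ∧
      (J u₁ = J w₁ ∨ J u₁ = J w₁ + 1)) :
    (2 * (N : ℝ) ^ 4)⁻¹ * (∑ j ∈ range (N - 1), ind (cl j) * blockDrop N J p j ^ 2) -
        (N : ℝ)⁻¹ ^ 2 * (Fintype.card V : ℝ)⁻¹ ≤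
      𝔼 u₁, 𝔼 u₂, 𝔼 w₁, 𝔼 w₂, ind (G u₁ u₂ w₁ w₂) * (p u₁ * p u₂ - p w₁ * p w₂) := by
  set A : ℕ → V → V → ℝ := fun j u u' => ind (u < u') * (ind (J u = j) * ind (J u' = j)) with hA
  have hind : ∀ u₁ u₂ w₁ w₂, ind (G u₁ u₂ w₁ w₂) = ∑ j ∈ range (N - 1),
      ind (cl j) * (ind (J w₁ = j) * ind (J w₂ = j + 1) * (A j u₁ u₂ + A (j + 1) u₁ u₂)) := by
    intro u₁ u₂ w₁ w₂
    rw [propext (hG u₁ u₂ w₁ w₂)]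
    have hz : ∀ j ≠ J w₁, ind (cl j) * (ind (J w₁ = j) * ind (J w₂ = j + 1) *
        (A j u₁ u₂ + A (j + 1) u₁ u₂)) = 0 := by
      intro j hj
      rw [ind_false hj.symm]
      ring
    rw [Finset.sum_eq_single (J w₁) (fun j _ hj => hz j hj)]
    · rw [hA]
      simp only [ind_true, one_mul, ind_mul_ind]
      by_cases hu : u₁ < u₂ ∧ J u₁ = J u₂
      · obtain ⟨hu, hu'⟩ := hu
        rw [← hu']
        by_cases e1 : J u₁ = J w₁
        · rw [ind_false (p := _ ∧ J u₁ = J w₁ + 1 ∧ _) (by omega), add_zero, ind_mul_ind,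
            ind_mul_ind]
          congr 1
          exact propext (by tauto)
        · rw [ind_false (p := _ ∧ J u₁ = J w₁ ∧ _) (by tauto), zero_add, ind_mul_ind, ind_mul_ind]
          congr 1
          exact propext (by tauto)
      · rw [ind_false (p := u₁ < u₂ ∧ J u₁ = J w₁ ∧ J u₂ = J w₁)
          fun h => hu ⟨h.1, h.2.1.trans h.2.2.symm⟩,
          ind_false (p := u₁ < u₂ ∧ J u₁ = J w₁ + 1 ∧ J u₂ = J w₁ + 1)
          fun h => hu ⟨h.1, h.2.1.trans h.2.2.symm⟩, ind_false fun h => hu ⟨h.2.2.1, h.2.2.2.1⟩]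
        ring
    · intro h
      have h3 := hJN w₂
      rw [Finset.mem_range] at h
      rw [ind_false (p := J w₂ = J w₁ + 1) (by omega)]
      ring
  have hsplit : 𝔼 u₁, 𝔼 u₂, 𝔼 w₁, 𝔼 w₂, ind (G u₁ u₂ w₁ w₂) * (p u₁ * p u₂ - p w₁ * p w₂) =
      ∑ j ∈ range (N - 1), ind (cl j) * 𝔼 u₁, 𝔼 u₂, 𝔼 w₁, 𝔼 w₂,
        ind (J w₁ = j) * ind (J w₂ = j + 1) * (A j u₁ u₂ + A (j + 1) u₁ u₂) *
          (p u₁ * p u₂ - p w₁ * p w₂) := by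
    simp only [hind, Finset.sum_mul, expect_sum_range, mul_assoc, Finset.mul_expect]
  have hN' : (0 : ℝ) < N := by exact_mod_cast hN
  rw [hsplit, Finset.mul_sum]
  have key : ∀ j ∈ range (N - 1), (2 * (N : ℝ) ^ 4)⁻¹ * (ind (cl j) * blockDrop N J p j ^ 2) -
      (N : ℝ)⁻¹ ^ 3 * (Fintype.card V : ℝ)⁻¹ ≤ ind (cl j) * 𝔼 u₁, 𝔼 u₂, 𝔼 w₁, 𝔼 w₂,
        ind (J w₁ = j) * ind (J w₂ = j + 1) * (A j u₁ u₂ + A (j + 1) u₁ u₂) *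
          (p u₁ * p u₂ - p w₁ * p w₂) := by
    intro j hj
    rw [Finset.mem_range] at hj
    have hnn : 0 ≤ (N : ℝ)⁻¹ ^ 3 * (Fintype.card V : ℝ)⁻¹ := by positivity
    by_cases hc : cl j
    swap
    · rw [ind_false hc]; linarith
    rw [ind_true hc, one_mul, one_mul, expect_mul_sub p (fun w => ind (J w = j))
      (fun w => ind (J w = j + 1)) fun u u' => A j u u' + A (j + 1) u u', hJ j (by omega),
      hJ (j + 1) (by omega), blockDrop, sq_abs, blockMean, blockMean]
    simp only [add_mul, Finset.expect_add_distrib, hA]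
    have a1 := two_mul_expect_block_ge hJ h0 h1 (show j < N by omega)
    have a2 := two_mul_expect_block_ge hJ h0 h1 (show j + 1 < N by omega)
    have a3 := two_mul_expect_block_le hJ (show j < N by omega)
    have a4 := two_mul_expect_block_le hJ (show j + 1 < N by omega)
    have a5 : 0 ≤ 𝔼 v, ind (J v = j) * p v :=
      expect_nonneg' fun v => mul_nonneg (ind_nonneg _) (h0 v)
    have a6 : 0 ≤ 𝔼 v, ind (J v = j + 1) * p v :=
      expect_nonneg' fun v => mul_nonneg (ind_nonneg _) (h0 v)
    have a7 := mul_nonneg a5 a6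
    have a8 := mul_le_mul_of_nonneg_left (add_le_add a3 a4) a7
    have a9 : (0 : ℝ) ≤ (N : ℝ)⁻¹ ^ 2 := by positivity
    have a10 := mul_le_mul_of_nonneg_left (add_le_add a1 a2) a9
    have a11 : (2 * (N : ℝ) ^ 4)⁻¹ * (N * (𝔼 v, ind (J v = j) * p v) -
        N * 𝔼 v, ind (J v = j + 1) * p v) ^ 2 = (N : ℝ)⁻¹ ^ 2 * ((𝔼 v, ind (J v = j) * p v) -
        𝔼 v, ind (J v = j + 1) * p v) ^ 2 / 2 := by
      field_simp
    rw [a11]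
    linarith
  have h2 := Finset.sum_le_sum key
  rw [Finset.sum_sub_distrib] at h2
  refine le_trans (sub_le_sub_left ?_ _) h2
  rw [Finset.sum_const, Finset.card_range, nsmul_eq_mul, pow_succ' _ 2, mul_assoc, ← mul_assoc]
  refine mul_le_of_le_one_left (by positivity) ?_
  rw [← div_eq_mul_inv, div_le_one hN']
  exact_mod_cast Nat.sub_le _ _

end drop

theorem abs_sub_le_sum_blockDrop {i k K : ℕ} (hik : i ≤ k) (hk : k ≤ K) :
    |blockMean N J p i - blockMean N J p k| ≤ ∑ j ∈ range K, blockDrop N J p j := by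
  have h := dist_le_Ico_sum_dist (blockMean N J p) hik
  rw [Real.dist_eq] at h
  refine h.trans ?_
  refine (Finset.sum_le_sum_of_subset_of_nonneg (t := range K) ?_ fun _ _ _ => dist_nonneg).trans ?_
  · intro x hx
    simp only [Finset.mem_Ico, Finset.mem_range] at *
    omega
  · exact Finset.sum_le_sum fun j _ => (Real.dist_eq _ _).le

/-- An accurate hypothesis has a large mean over the blocks below the threshold and a small mean
over the others, so it drops somewhere. -/
theorem half_le_sum_blockDrop {H : ℕ} (hH : 0 < H) (hJN : ∀ v, J v < 2 * H)
    (hJ : ∀ j < 2 * H, 𝔼 v, ind (J v = j) = ((2 * H : ℕ) : ℝ)⁻¹)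
    (herr : 𝔼 v, (ind (J v < H) * (1 - p v) + ind (H ≤ J v) * p v) ≤ 1 / 4) :
    1 / 2 ≤ ∑ j ∈ range (2 * H - 1), blockDrop (2 * H) J p j := by
  have hH' : (0 : ℝ) < H := by exact_mod_cast hH
  set S := ∑ j ∈ range (2 * H - 1), blockDrop (2 * H) J p j with hS
  set σ : ℕ → ℝ := fun j => 𝔼 v, ind (J v = j) * p v with hσ
  have hpt : ∀ v, ind (J v < H) * (1 - p v) + ind (H ≤ J v) * p v =
      ∑ j ∈ range H, (ind (J v = j) - ind (J v = j) * p v) +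
      ∑ j ∈ range H, ind (J v = H + j) * p v := by
    intro v
    by_cases hv : J v < H
    · rw [ind_true hv, ind_false (by omega), Finset.sum_eq_single (J v), ind_true rfl]
      · rw [Finset.sum_eq_zero]
        · ring
        · intro j _
          rw [ind_false (by omega), zero_mul]
      · intro j _ h
        rw [ind_false h.symm]; ring
      · intro h
        exact absurd (Finset.mem_range.2 hv) h
    · rw [ind_false hv, ind_true (by omega), Finset.sum_eq_zero,
        Finset.sum_eq_single (J v - H), ind_true (by omega)]
      · ring
      · intro j _ h
        rw [ind_false (by omega), zero_mul]
      · intro h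
        exact absurd (Finset.mem_range.2 (by have := hJN v; omega)) h
      · intro j hj
        rw [Finset.mem_range] at hj
        rw [ind_false (by omega)]; ring
  have h2 : 𝔼 v, (ind (J v < H) * (1 - p v) + ind (H ≤ J v) * p v) =
      ∑ j ∈ range H, (((2 * H : ℕ) : ℝ)⁻¹ - (σ j - σ (H + j))) := by
    rw [expect_congr' hpt, Finset.expect_add_distrib, expect_sum_range, expect_sum_range,
      ← Finset.sum_add_distrib]
    refine Finset.sum_congr rfl fun j hj => ?_
    rw [Finset.mem_range] at hj
    rw [Finset.expect_sub_distrib, hJ j (by omega)]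
    ring
  have h3 : ∀ j ∈ range H, ((2 * H : ℕ) : ℝ)⁻¹ * (1 - S) ≤
      ((2 * H : ℕ) : ℝ)⁻¹ - (σ j - σ (H + j)) := by
    intro j hj
    rw [Finset.mem_range] at hj
    have h4 := abs_sub_le_sum_blockDrop (N := 2 * H) (J := J) (p := p) (i := j) (k := H + j)
      (K := 2 * H - 1) (by omega) (by omega)
    rw [← hS, blockMean, blockMean, ← mul_sub] at h4
    have h5 : ((2 * H : ℕ) : ℝ) * (σ j - σ (H + j)) ≤ S := (le_abs_self _).trans h4
    have h6 : (0 : ℝ) < ((2 * H : ℕ) : ℝ) := by push_cast; positivity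
    rw [mul_sub, mul_one]
    have h7 : σ j - σ (H + j) ≤ ((2 * H : ℕ) : ℝ)⁻¹ * S := by
      rw [← div_eq_inv_mul, le_div_iff₀ h6]
      linarith
    linarith
  have h4 := Finset.sum_le_sum h3
  rw [← h2, Finset.sum_const, Finset.card_range, nsmul_eq_mul] at h4
  have h5 : (H : ℝ) * (((2 * H : ℕ) : ℝ)⁻¹ * (1 - S)) = (1 - S) / 2 := by
    push_cast
    field_simp
  linarith

end blocks

/-! ### Differential privacy against local dependence on the sample -/

section privacy

variable {Z R : Type} [Fintype Z] [Fintype R]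

/-- Exchanging an entry of an i.i.d. sequence with an independent copy. -/
theorem expect_update {n : ℕ} (i : Fin n) (f : Z → (Fin n → Z) → ℝ) :
    𝔼 ω : Fin n → Z, 𝔼 z, f (ω i) (Function.update ω i z) = 𝔼 ω : Fin n → Z, 𝔼 z, f z ω := by
  rw [← expect_prod fun x : (Fin n → Z) × Z => f (x.1 i) (Function.update x.1 i x.2),
    ← expect_prod fun x : (Fin n → Z) × Z => f x.2 x.1]
  let φ : (Fin n → Z) × Z → (Fin n → Z) × Z := fun x => (Function.update x.1 i x.2, x.1 i)
  have hφ : Function.Involutive φ := fun x => by simp [φ]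
  exact Fintype.expect_bijective φ hφ.bijective _ _ fun _ => rfl

/-- A learner that is private in its sample `ω` cannot produce quantities `g ω ρ j` whose sum is
likely to be at least `1 / 2` but which are concentrated on indices `j` that are not clean for the
sample, if a fixed index is rarely unclean for a random sample entry. For, a large sum over the
indices that are unclean for the `i`-th entry remains likely when this entry is replaced by an
independent one, for which these indices are no longer special. -/
theorem false_of_private [Nonempty Z] [Nonempty R] {n K N : ℕ} (hK : K ≤ N) (hN : 0 < N) {M μ η : ℝ} (hμ0 : 0 ≤ μ)
    (g : (Fin n → Z) → R → ℕ → ℝ) (cl : Z → ℕ → Prop)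
    (hg0 : ∀ ω ρ j, 0 ≤ g ω ρ j) (hg1 : ∀ ω ρ j, g ω ρ j ≤ 1)
    (hμ : ∀ j < K, 𝔼 z, ind (¬ cl z j) ≤ μ)
    (hM : ∀ z, ∑ j ∈ range K, ind (¬ cl z j) ≤ M)
    (hacc : 3 / 4 ≤ 𝔼 ω, 𝔼 ρ, ind (1 / 2 ≤ ∑ j ∈ range K, g ω ρ j))
    (hsec : 𝔼 ω, 𝔼 ρ, ∑ j ∈ range K, ind (∀ i, cl (ω i) j) * g ω ρ j ^ 2 ≤ η)
    (hpriv : ∀ (ω : Fin n → Z) (i : Fin n) (z : Z),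
      𝔼 ρ, ind (1 / (4 * (n : ℝ)) ≤ ∑ j ∈ range K, ind (¬ cl (ω i) j) * g ω ρ j) ≤
        Real.exp 1 * (𝔼 ρ, ind (1 / (4 * (n : ℝ)) ≤
          ∑ j ∈ range K, ind (¬ cl (ω i) j) * g (Function.update ω i z) ρ j)) + 1 / (4 * (n : ℝ)))
    (hη : 64 * N * η ≤ 1 / 16) (hμM : 12 * (n : ℝ) ^ 2 * μ * (n * M + 1) ≤ 1 / 16) : False := by
  set X : (Fin n → Z) → R → ℝ := fun ω ρ => ∑ j ∈ range K, ind (∀ i, cl (ω i) j) * g ω ρ j with hX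
  set U : Z → (Fin n → Z) → R → ℝ := fun z ω ρ => ∑ j ∈ range K, ind (¬ cl z j) * g ω ρ j with hU
  have hN' : (0 : ℝ) < N := by exact_mod_cast hN
  have hU0 : ∀ z ω ρ, 0 ≤ U z ω ρ := fun z ω ρ =>
    Finset.sum_nonneg fun j _ => mul_nonneg (ind_nonneg _) (hg0 _ _ _)
  have hX0 : ∀ ω ρ, 0 ≤ X ω ρ := fun ω ρ =>
    Finset.sum_nonneg fun j _ => mul_nonneg (ind_nonneg _) (hg0 _ _ _)
  -- every index is clean or unclean for an entry of the sample
  have hsum : ∀ ω ρ, ∑ j ∈ range K, g ω ρ j ≤ X ω ρ + ∑ i, U (ω i) ω ρ := by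
    intro ω ρ
    rw [hU, Finset.sum_comm, ← Finset.sum_add_distrib]
    refine Finset.sum_le_sum fun j _ => ?_
    rw [← Finset.sum_mul, ← add_mul]
    refine le_mul_of_one_le_left (hg0 _ _ _) ?_
    have hnn : ∀ i ∈ Finset.univ, 0 ≤ ind (¬ cl (ω i) j) := fun i _ => ind_nonneg _
    by_cases h : ∀ i, cl (ω i) j
    · rw [ind_true h]
      linarith [Finset.sum_nonneg hnn]
    · rw [ind_false h, zero_add]
      push Not at h
      obtain ⟨i, hi⟩ := h
      rw [← ind_true hi]
      exact Finset.single_le_sum hnn (Finset.mem_univ i)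
  have hUM : ∀ z ω ρ, U z ω ρ ≤ M := fun z ω ρ => (Finset.sum_le_sum fun j _ =>
    mul_le_of_le_one_right (ind_nonneg _) (hg1 _ _ _)).trans (hM z)
  have hsum' : ∀ ω ρ, ∑ j ∈ range K, g ω ρ j ≤ X ω ρ + n * M := by
    intro ω ρ
    refine (hsum ω ρ).trans (add_le_add_right ?_ _)
    refine (Finset.sum_le_sum fun i _ => hUM (ω i) ω ρ).trans ?_
    simp
  have hEX : 𝔼 ω, 𝔼 ρ, X ω ρ ≤ 16 * N * η + 1 / 64 := by
    have h1 : ∀ ω ρ, X ω ρ ≤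
        16 * N * (∑ j ∈ range K, ind (∀ i, cl (ω i) j) * g ω ρ j ^ 2) + 1 / 64 := by
      intro ω ρ
      have h2 : ∀ j ∈ range K, ind (∀ i, cl (ω i) j) * g ω ρ j ≤
          16 * N * (ind (∀ i, cl (ω i) j) * g ω ρ j ^ 2) + 1 / (64 * N) := by
        intro j _
        -- weights for which the constant terms add up to at most `1 / 64`
        have h3 : g ω ρ j ≤ 16 * N * g ω ρ j ^ 2 + 1 / (64 * N) := by
          have h4 : 16 * N * g ω ρ j ^ 2 + 1 / (64 * N) - g ω ρ j =
              (32 * N * g ω ρ j - 1) ^ 2 / (64 * N) := by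
            field_simp
            ring
          have h5 : 0 ≤ (32 * N * g ω ρ j - 1) ^ 2 / (64 * N) := by positivity
          linarith
        by_cases h : ∀ i, cl (ω i) j
        · simpa only [ind_true h, one_mul] using h3
        · rw [ind_false h]
          simp
      refine (Finset.sum_le_sum h2).trans ?_
      rw [Finset.sum_add_distrib, ← Finset.mul_sum, Finset.sum_const, Finset.card_range,
        nsmul_eq_mul]
      refine add_le_add_right ?_ _
      have : (K : ℝ) ≤ N := by exact_mod_cast hK
      rw [mul_one_div, div_le_div_iff₀ (by positivity) (by norm_num)]
      linarith
    refine (expect_mono fun ω => expect_mono fun ρ => h1 ω ρ).trans ?_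
    simp only [Finset.expect_add_distrib, ← Finset.mul_expect, Fintype.expect_const]
    gcongr
  have hEU : ∀ i : Fin n, 𝔼 ω : Fin n → Z, 𝔼 ρ, ind (1 / (4 * (n : ℝ)) ≤ U (ω i) ω ρ) ≤
      12 * n * μ * (n * M + 1) + 1 / (4 * (n : ℝ)) := by
    intro i
    have hn : (0 : ℝ) < n := by exact_mod_cast i.pos
    have h1 : 𝔼 ω : Fin n → Z, 𝔼 ρ, ind (1 / (4 * (n : ℝ)) ≤ U (ω i) ω ρ) ≤
        𝔼 ω : Fin n → Z, 𝔼 z, (Real.exp 1 * (𝔼 ρ, ind (1 / (4 * (n : ℝ)) ≤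
          U (ω i) (Function.update ω i z) ρ)) + 1 / (4 * (n : ℝ))) := by
      refine expect_mono fun ω => ?_
      rw [← Fintype.expect_const (ι := Z) (𝔼 ρ, ind (1 / (4 * (n : ℝ)) ≤ U (ω i) ω ρ))]
      exact expect_mono fun z => hpriv ω i z
    rw [expect_update i fun z ω => Real.exp 1 * (𝔼 ρ, ind (1 / (4 * (n : ℝ)) ≤ U z ω ρ)) +
      1 / (4 * (n : ℝ))] at h1
    simp only [Finset.expect_add_distrib, ← Finset.mul_expect, Fintype.expect_const] at h1
    -- Markov's inequality for the sum over the unclean indices of an independent entry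
    have h2 : ∀ ω : Fin n → Z, 𝔼 z, 𝔼 ρ, ind (1 / (4 * (n : ℝ)) ≤ U z ω ρ) ≤
        𝔼 ρ, 4 * n * (μ * (X ω ρ + n * M)) := by
      intro ω
      rw [Finset.expect_comm]
      refine expect_mono fun ρ => ?_
      have h3 : ∀ z, ind (1 / (4 * (n : ℝ)) ≤ U z ω ρ) ≤ 4 * n * U z ω ρ := by
        intro z
        by_cases h : 1 / (4 * (n : ℝ)) ≤ U z ω ρ
        · rw [ind_true h]
          rwa [div_le_iff₀' (by positivity)] at h
        · rw [ind_false h]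
          have := hU0 z ω ρ
          positivity
      refine (expect_mono h3).trans ?_
      rw [← Finset.mul_expect]
      refine mul_le_mul_of_nonneg_left ?_ (by positivity)
      have h4 : 𝔼 z, U z ω ρ ≤ μ * ∑ j ∈ range K, g ω ρ j := by
        rw [hU, expect_sum_range, Finset.mul_sum]
        refine Finset.sum_le_sum fun j hj => ?_
        rw [← Finset.expect_mul]
        exact mul_le_mul_of_nonneg_right (hμ j (Finset.mem_range.1 hj)) (hg0 _ _ _)
      exact h4.trans (mul_le_mul_of_nonneg_left (hsum' ω ρ) hμ0)
    have h5 : 𝔼 ω : Fin n → Z, 𝔼 z, 𝔼 ρ, ind (1 / (4 * (n : ℝ)) ≤ U z ω ρ) ≤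
        4 * n * (μ * (1 + n * M)) := by
      refine (expect_mono h2).trans ?_
      simp only [← Finset.mul_expect, Finset.expect_add_distrib, Fintype.expect_const]
      gcongr
      linarith
    have h6 : 0 ≤ 4 * n * (μ * (1 + n * M)) :=
      (expect_nonneg' fun ω => expect_nonneg' fun z => expect_nonneg' fun ρ => ind_nonneg _).trans h5
    have h7 := mul_le_mul_of_nonneg_left h5 (Real.exp_pos 1).le
    have h8 := mul_le_mul_of_nonneg_right (Real.exp_one_lt_d9.le.trans
      (show (2.7182818286 : ℝ) ≤ 3 by norm_num)) h6
    linarith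
  have hpt : ∀ ω ρ, ind (1 / 2 ≤ ∑ j ∈ range K, g ω ρ j) ≤
      4 * X ω ρ + ∑ i, ind (1 / (4 * (n : ℝ)) ≤ U (ω i) ω ρ) := by
    intro ω ρ
    by_cases hT : ∃ i, 1 / (4 * (n : ℝ)) ≤ U (ω i) ω ρ
    · obtain ⟨i, hi⟩ := hT
      have h1 := Finset.single_le_sum (f := fun i => ind (1 / (4 * (n : ℝ)) ≤ U (ω i) ω ρ))
        (fun i _ => ind_nonneg _) (Finset.mem_univ i)
      have h2 := ind_true hi
      have h3 := ind_le_one (1 / 2 ≤ ∑ j ∈ range K, g ω ρ j)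
      have h4 := hX0 ω ρ
      linarith
    · push Not at hT
      have h1 : 0 ≤ ∑ i, ind (1 / (4 * (n : ℝ)) ≤ U (ω i) ω ρ) :=
        Finset.sum_nonneg fun i _ => ind_nonneg _
      have h2 := Finset.sum_le_sum fun i (_ : i ∈ Finset.univ) => (hT i).le
      have h3 : ∑ _i : Fin n, 1 / (4 * (n : ℝ)) ≤ 1 / 4 := by
        rw [Finset.sum_const, Finset.card_univ, Fintype.card_fin, nsmul_eq_mul]
        rcases Nat.eq_zero_or_pos n with h | h
        · simp [h]
        · have : (0 : ℝ) < n := by exact_mod_cast h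
          exact le_of_eq (by field_simp)
      by_cases h : 1 / 2 ≤ ∑ j ∈ range K, g ω ρ j
      · rw [ind_true h]
        have h4 := hsum ω ρ
        linarith
      · rw [ind_false h]
        linarith [hX0 ω ρ]
  have hfin := hacc.trans (expect_mono fun ω => expect_mono fun ρ => hpt ω ρ)
  have hswap : 𝔼 ω : Fin n → Z, 𝔼 ρ, ∑ i, ind (1 / (4 * (n : ℝ)) ≤ U (ω i) ω ρ) =
      ∑ i, 𝔼 ω : Fin n → Z, 𝔼 ρ, ind (1 / (4 * (n : ℝ)) ≤ U (ω i) ω ρ) := by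
    rw [← Finset.expect_sum_comm]
    exact expect_congr' fun ω => Finset.expect_sum_comm _ _ _
  simp only [Finset.expect_add_distrib, ← Finset.mul_expect] at hfin
  rw [hswap] at hfin
  have h1 := Finset.sum_le_sum fun i (_ : i ∈ Finset.univ) => hEU i
  rw [Finset.sum_const, Finset.card_univ, Fintype.card_fin, nsmul_eq_mul] at h1
  have h2 : n * (12 * n * μ * (n * M + 1) + 1 / (4 * (n : ℝ))) ≤ 1 / 16 + 1 / 4 := by
    rcases Nat.eq_zero_or_pos n with h | h
    · simp [h]
      norm_num
    · have : (0 : ℝ) < n := by exact_mod_cast h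
      have h3 : n * (12 * n * μ * (n * M + 1) + 1 / (4 * (n : ℝ))) =
          12 * (n : ℝ) ^ 2 * μ * (n * M + 1) + 1 / 4 := by field_simp
      linarith
  linarith

end privacy


/-! ### The blocks of messages -/

section msgBlocks

variable {ν d : ℕ} (hν : ν ≤ d)
include hν

theorem block_lt (v : Msg d) : v.val / 2 ^ (d - ν) < 2 ^ ν := by
  rw [Nat.div_lt_iff_lt_mul (by positivity), ← pow_add, Nat.add_sub_cancel' hν]
  exact v.isLt

theorem expect_block (f : ℕ → ℝ) :
    𝔼 v : Msg d, f (v.val / 2 ^ (d - ν)) = (∑ j ∈ range (2 ^ ν), f j) / (2 ^ ν : ℕ) := by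
  have h : 2 ^ ν * 2 ^ (d - ν) = 2 ^ d := by rw [← pow_add, Nat.add_sub_cancel' hν]
  have h1 : 𝔼 x : Fin (2 ^ ν) × Fin (2 ^ (d - ν)), f x.1 = 𝔼 v : Msg d, f (v.val / 2 ^ (d - ν)) := by
    refine Fintype.expect_equiv (finProdFinEquiv.trans (finCongr h)) _ _ fun x => ?_
    congr 1
    simp only [Equiv.trans_apply, finCongr_apply, Fin.val_cast, finProdFinEquiv_apply_val]
    rw [Nat.add_mul_div_left _ _ (by positivity), Nat.div_eq_of_lt x.2.isLt, zero_add]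
  rw [← h1, expect_prod]
  simp only [Fintype.expect_const]
  rw [Fintype.expect_eq_sum_div_card, Fintype.card_fin, Fin.sum_univ_eq_sum_range]

omit hν in
theorem sum_ind_eq_card (K : ℕ) (q : ℕ → Prop) [DecidablePred q] :
    ∑ j ∈ range K, ind (q j) = ((range K).filter q).card := by
  rw [Finset.card_filter]
  push_cast
  refine Finset.sum_congr rfl fun j _ => ?_
  by_cases h : q j <;> simp [ind, h]

theorem expect_ind_block {j : ℕ} (hj : j < 2 ^ ν) :
    𝔼 v : Msg d, ind (v.val / 2 ^ (d - ν) = j) = ((2 ^ ν : ℕ) : ℝ)⁻¹ := by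
  rw [expect_block hν fun i => ind (i = j), Finset.sum_eq_single j]
  · rw [ind_true rfl, one_div]
  · intro i _ h
    exact ind_false h
  · intro h
    exact absurd (Finset.mem_range.2 hj) h

theorem expect_not_clean_le {j : ℕ} (hj : j < 2 ^ ν) :
    𝔼 v : Msg d, ind (¬ Clean (v.val / 2 ^ (d - ν)) j) ≤ uncleanBound ν / (2 ^ ν : ℕ) := by
  rw [expect_block hν fun i => ind (¬ Clean i j), sum_ind_eq_card]
  gcongr
  exact card_not_clean_left_le ν j hj

theorem blockDrop_le_one {p : Msg d → ℝ} (h0 : ∀ v, 0 ≤ p v) (h1 : ∀ v, p v ≤ 1) (j : ℕ) :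
    blockDrop (2 ^ ν) (fun v : Msg d => v.val / 2 ^ (d - ν)) p j ≤ 1 := by
  have hN : (0 : ℝ) < ((2 ^ ν : ℕ) : ℝ) := by positivity
  have key : ∀ j, 0 ≤ blockMean (2 ^ ν) (fun v : Msg d => v.val / 2 ^ (d - ν)) p j ∧
      blockMean (2 ^ ν) (fun v : Msg d => v.val / 2 ^ (d - ν)) p j ≤ 1 := by
    intro j
    refine ⟨mul_nonneg hN.le (expect_nonneg' fun v => mul_nonneg (ind_nonneg _) (h0 v)), ?_⟩
    have h2 : 𝔼 v : Msg d, ind (v.val / 2 ^ (d - ν) = j) * p v ≤ ((2 ^ ν : ℕ) : ℝ)⁻¹ := by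
      refine (expect_mono fun v => mul_le_of_le_one_right (ind_nonneg _) (h1 v)).trans ?_
      by_cases hj : j < 2 ^ ν
      · exact (expect_ind_block hν hj).le
      · refine le_trans (le_of_eq ?_) (inv_nonneg.2 hN.le)
        refine Finset.expect_eq_zero fun v _ => ind_false ?_
        have := block_lt hν v
        omega
    calc _ ≤ ((2 ^ ν : ℕ) : ℝ) * ((2 ^ ν : ℕ) : ℝ)⁻¹ := mul_le_mul_of_nonneg_left h2 hN.le
      _ = 1 := mul_inv_cancel₀ hN.ne'
  rw [blockDrop, abs_le]
  have := key j
  have := key (j + 1)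
  constructor <;> linarith

end msgBlocks

/-! ### Security bounds the drops over clean blocks -/

section reorder

variable {A S V R W : Type} [Fintype A] [Fintype S] [Fintype V] [Fintype R] [Fintype W]

theorem expect_comm₄ (f : A → A → A → A → S → ℝ) :
    𝔼 a, 𝔼 b, 𝔼 c, 𝔼 d, 𝔼 s, f a b c d s = 𝔼 s, 𝔼 a, 𝔼 b, 𝔼 c, 𝔼 d, f a b c d s := by
  calc _ = 𝔼 a, 𝔼 b, 𝔼 c, 𝔼 s, 𝔼 d, f a b c d s := expect_congr' fun a => expect_congr' fun b =>
        expect_congr' fun c => Finset.expect_comm _ _ _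
    _ = 𝔼 a, 𝔼 b, 𝔼 s, 𝔼 c, 𝔼 d, f a b c d s := expect_congr' fun a => expect_congr' fun b =>
        Finset.expect_comm _ _ _
    _ = 𝔼 a, 𝔼 s, 𝔼 b, 𝔼 c, 𝔼 d, f a b c d s := expect_congr' fun a => Finset.expect_comm _ _ _
    _ = _ := Finset.expect_comm _ _ _

theorem expect_reorder (f : A → A → A → A → S → V → R → W → ℝ) :
    𝔼 a, 𝔼 b, 𝔼 c, 𝔼 d, 𝔼 s, 𝔼 v, 𝔼 r, 𝔼 w, f a b c d s v r w =
      𝔼 r, 𝔼 v, 𝔼 w, 𝔼 s, 𝔼 a, 𝔼 b, 𝔼 c, 𝔼 d, f a b c d s v r w := by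
  calc _ = 𝔼 s, 𝔼 v, 𝔼 r, 𝔼 w, 𝔼 a, 𝔼 b, 𝔼 c, 𝔼 d, f a b c d s v r w :=
        (expect_comm₄ _).trans <| expect_congr' fun s => (expect_comm₄ _).trans <|
          expect_congr' fun v => (expect_comm₄ _).trans <| expect_congr' fun r => expect_comm₄ _
    _ = 𝔼 s, 𝔼 r, 𝔼 v, 𝔼 w, 𝔼 a, 𝔼 b, 𝔼 c, 𝔼 d, f a b c d s v r w :=
        expect_congr' fun s => Finset.expect_comm _ _ _
    _ = 𝔼 r, 𝔼 s, 𝔼 v, 𝔼 w, 𝔼 a, 𝔼 b, 𝔼 c, 𝔼 d, f a b c d s v r w := Finset.expect_comm _ _ _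
    _ = 𝔼 r, 𝔼 v, 𝔼 s, 𝔼 w, 𝔼 a, 𝔼 b, 𝔼 c, 𝔼 d, f a b c d s v r w :=
        expect_congr' fun r => Finset.expect_comm _ _ _
    _ = _ := expect_congr' fun r => expect_congr' fun v => Finset.expect_comm _ _ _

theorem expect_arrow_prod {n : ℕ} (f : (Fin n → A × S) → ℝ) :
    𝔼 ω, f ω = 𝔼 v : Fin n → A, 𝔼 w : Fin n → S, f fun i => (v i, w i) := by
  rw [← expect_prod fun x : (Fin n → A) × (Fin n → S) => f fun i => (x.1 i, x.2 i)]
  exact Fintype.expect_equiv (Equiv.arrowProdEquivProdArrow _ _ _) _ _ fun _ => rfl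

end reorder

section learner

variable {F : FRE} {lam : ℕ → ℕ} (L : EfficientLearner (LEncThr F lam)) (c d : ℕ)

theorem posProb_nonneg (l : ℕ) (r : Fin (F.genCoins.eval (l + d)) → Bool)
    (h : F.ciphers l d × F.params l d → Bool) (v : Msg d) : 0 ≤ posProb F l d r h v :=
  expect_nonneg' fun _ => ind_nonneg _

theorem posProb_le_one (l : ℕ) (r : Fin (F.genCoins.eval (l + d)) → Bool)
    (h : F.ciphers l d × F.params l d → Bool) (v : Msg d) : posProb F l d r h v ≤ 1 :=
  (expect_mono fun _ => ind_le_one _).trans (Fintype.expect_const _).le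

/-- The drop between consecutive blocks of the probability that the hypothesis `h` labels an
encryption with `1`. -/
noncomputable def hypDrop (r : Fin (F.genCoins.eval (lam d + d)) → Bool)
    (h : F.ciphers (lam d) d × F.params (lam d) d → Bool) (j : ℕ) : ℝ :=
  blockDrop (2 ^ blockBits c d) (fun v : Msg d => v.val / 2 ^ (d - blockBits c d))
    (posProb F (lam d) d r h) j

/-- The expected squared drops over the blocks that are clean for a sample of size `m`. -/
noncomputable def cleanDrops (m : ℕ) : ℝ :=
  𝔼 r : Fin (F.genCoins.eval (lam d + d)) → Bool,
  𝔼 ω : Fin m → Msg d × (Fin (F.encCoins.eval (lam d + d)) → Bool), 𝔼 s,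
    ∑ j ∈ range (2 ^ blockBits c d - 1),
      ind (∀ i, Clean ((ω i).1.val / 2 ^ (d - blockBits c d)) j) *
        hypDrop c d r (hypOf L r s ω) j ^ 2

variable {c d}

/-- If the adversary guesses the sample size `m`, its advantage is essentially at least
`cleanDrops`. -/
theorem advantage_given_size_ge (hd : blockBits c d ≤ d) (m : ℕ) :
    (2 * ((2 ^ blockBits c d : ℕ) : ℝ) ^ 4)⁻¹ * cleanDrops L c d m -
      ((2 ^ blockBits c d : ℕ) : ℝ)⁻¹ ^ 2 * ((2 ^ d : ℕ) : ℝ)⁻¹ ≤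
    (𝔼 u₁ : Msg d, 𝔼 u₂ : Msg d, 𝔼 w₁ : Msg d, 𝔼 w₂ : Msg d, 𝔼 s, 𝔼 v : Fin m → Msg d, 𝔼 r,
      ind (gate c d u₁ u₂ w₁ w₂ (List.ofFn v)) *
      𝔼 w : Fin m → Fin (F.encCoins.eval (lam d + d)) → Bool,
        posProb F (lam d) d r (hypOf L r s fun i => (v i, w i)) u₁ *
        posProb F (lam d) d r (hypOf L r s fun i => (v i, w i)) u₂) -
    𝔼 u₁ : Msg d, 𝔼 u₂ : Msg d, 𝔼 w₁ : Msg d, 𝔼 w₂ : Msg d, 𝔼 s, 𝔼 v : Fin m → Msg d, 𝔼 r,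
      ind (gate c d u₁ u₂ w₁ w₂ (List.ofFn v)) *
      𝔼 w : Fin m → Fin (F.encCoins.eval (lam d + d)) → Bool,
        posProb F (lam d) d r (hypOf L r s fun i => (v i, w i)) w₁ *
        posProb F (lam d) d r (hypOf L r s fun i => (v i, w i)) w₂ := by
  simp only [Finset.mul_expect, ← Finset.expect_sub_distrib]
  rw [expect_reorder, cleanDrops]
  simp only [expect_arrow_prod, Finset.mul_expect]
  rw [← Fintype.expect_const (ι := Fin (F.genCoins.eval (lam d + d)) → Bool)
    (((2 ^ blockBits c d : ℕ) : ℝ)⁻¹ ^ 2 * ((2 ^ d : ℕ) : ℝ)⁻¹), ← Finset.expect_sub_distrib]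
  refine expect_mono fun r => ?_
  rw [← Fintype.expect_const (ι := Fin m → Msg d)
    (((2 ^ blockBits c d : ℕ) : ℝ)⁻¹ ^ 2 * ((2 ^ d : ℕ) : ℝ)⁻¹), ← Finset.expect_sub_distrib]
  refine expect_mono fun v => ?_
  rw [← Fintype.expect_const (ι := Fin m → Fin (F.encCoins.eval (lam d + d)) → Bool)
    (((2 ^ blockBits c d : ℕ) : ℝ)⁻¹ ^ 2 * ((2 ^ d : ℕ) : ℝ)⁻¹), ← Finset.expect_sub_distrib]
  refine expect_mono fun w => ?_
  rw [← Fintype.expect_const (ι := Fin (L.coins.eval d) → Bool)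
    (((2 ^ blockBits c d : ℕ) : ℝ)⁻¹ ^ 2 * ((2 ^ d : ℕ) : ℝ)⁻¹), ← Finset.expect_sub_distrib]
  refine expect_mono fun s => ?_
  have h := expect_gate_ge (p := posProb F (lam d) d r (hypOf L r s fun i => (v i, w i)))
    (block_lt hd) (fun j hj => expect_ind_block hd hj) (posProb_nonneg d _ _ _)
    (posProb_le_one d _ _ _) (by positivity)
    (fun u₁ u₂ w₁ w₂ => gate c d u₁ u₂ w₁ w₂ (List.ofFn v))
    (fun j => ∀ i, Clean ((v i).val / 2 ^ (d - blockBits c d)) j)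
    (fun u₁ u₂ w₁ w₂ => by simp only [gate, List.forall_mem_ofFn_iff, Fin.lt_def])
  rw [Fintype.card_fin] at h
  simp only [mul_sub] at h
  exact h

/-- The sample size `m` is guessed with probability `1 / 2 ^ blockBits c d`, and a wrong guess costs
at most the negligible contribution of the pairs `u₁ = u₂`, because the bound for every size is
nonnegative up to that. -/
theorem advantage_ge (hd : blockBits c d ≤ d) (m : Msg (blockBits c d)) :
    ((2 ^ blockBits c d : ℕ) : ℝ)⁻¹ *
        ((2 * ((2 ^ blockBits c d : ℕ) : ℝ) ^ 4)⁻¹ * cleanDrops L c d m) -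
      ((2 ^ blockBits c d : ℕ) : ℝ)⁻¹ ^ 2 * ((2 ^ d : ℕ) : ℝ)⁻¹ ≤
    prob (FRE.game (adversary L c) false d) {true} -
      prob (FRE.game (adversary L c) true d) {true} := by
  rw [prob_game, prob_game, ← Finset.expect_sub_distrib]
  simp only [Bool.cond_false, Bool.cond_true]
  set ε := ((2 ^ blockBits c d : ℕ) : ℝ)⁻¹ ^ 2 * ((2 ^ d : ℕ) : ℝ)⁻¹
  have h := expect_mono fun m : Msg (blockBits c d) => advantage_given_size_ge L hd m
  refine le_trans ?_ h
  rw [Finset.expect_sub_distrib, Fintype.expect_const]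
  refine sub_le_sub_right ?_ _
  rw [Fintype.expect_eq_sum_div_card, Fintype.card_fin, div_eq_inv_mul]
  refine mul_le_mul_of_nonneg_left ?_ (by positivity)
  refine Finset.single_le_sum (f := fun m : Msg (blockBits c d) =>
    (2 * ((2 ^ blockBits c d : ℕ) : ℝ) ^ 4)⁻¹ * cleanDrops L c d m) (fun m _ => ?_)
    (Finset.mem_univ m)
  refine mul_nonneg (by positivity) (expect_nonneg' fun r => expect_nonneg' fun ω =>
    expect_nonneg' fun s => Finset.sum_nonneg fun j _ => mul_nonneg (ind_nonneg _) (sq_nonneg _))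

theorem cleanDrops_le (hd : blockBits c d ≤ d) {m : ℕ} (hm : m < 2 ^ blockBits c d) :
    cleanDrops L c d m ≤ 2 * ((2 ^ blockBits c d : ℕ) : ℝ) ^ 5 *
        |prob (FRE.game (adversary L c) false d) {true} -
          prob (FRE.game (adversary L c) true d) {true}| +
      2 * ((2 ^ blockBits c d : ℕ) : ℝ) ^ 3 / (2 ^ d : ℕ) := by
  have h := (advantage_ge L hd ⟨m, hm⟩).trans (le_abs_self _)
  have hN : (0 : ℝ) < ((2 ^ blockBits c d : ℕ) : ℝ) := by positivity
  have hD : (0 : ℝ) < ((2 ^ d : ℕ) : ℝ) := by positivity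
  set N := ((2 ^ blockBits c d : ℕ) : ℝ)
  set D := ((2 ^ d : ℕ) : ℝ)
  set adv := |prob (FRE.game (adversary L c) false d) {true} -
    prob (FRE.game (adversary L c) true d) {true}|
  simp only at h
  have h2 : cleanDrops L c d m = 2 * N ^ 5 * (N⁻¹ * ((2 * N ^ 4)⁻¹ * cleanDrops L c d m)) := by
    field_simp
  have h3 : 2 * N ^ 3 / D = 2 * N ^ 5 * (N⁻¹ ^ 2 * D⁻¹) := by field_simp
  rw [h2, h3, ← mul_add]
  refine mul_le_mul_of_nonneg_left ?_ (by positivity)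
  linarith

/-! ### Accuracy and privacy of the learner -/

theorem encThreshold_encExample (hdec : F.CorrectDecryption) (l : ℕ) (hd : 1 ≤ d)
    (r : Fin (F.genCoins.eval (l + d)) → Bool) (v : Msg d)
    (s : Fin (F.encCoins.eval (l + d)) → Bool) :
    encThreshold F l d ⟨2 ^ (d - 1), Nat.pow_lt_pow_right (by norm_num) (by omega)⟩ r
      (encExample F l d r v s) = decide (v.val < 2 ^ (d - 1)) := by
  rw [encThreshold, decide_eq_decide, encExample, hdec.dec_enc]
  simp [Fin.lt_def]

/-- The error of a hypothesis under uniform messages with fresh encryptions. -/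
theorem prob_error (hdec : F.CorrectDecryption) (l : ℕ) (hd : 1 ≤ d)
    (r : Fin (F.genCoins.eval (l + d)) → Bool) (h : F.ciphers l d × F.params l d → Bool) :
    prob ((PMF.uniformOfFintype (Msg d × (Fin (F.encCoins.eval (l + d)) → Bool))).map
        fun z => encExample F l d r z.1 z.2)
      {x | h x ≠ encThreshold F l d
        ⟨2 ^ (d - 1), Nat.pow_lt_pow_right (by norm_num) (by omega)⟩ r x} =
    𝔼 v : Msg d, (ind (v.val < 2 ^ (d - 1)) * (1 - posProb F l d r h v) +
      ind (2 ^ (d - 1) ≤ v.val) * posProb F l d r h v) := by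
  rw [prob_uniform_map, expect_prod]
  refine expect_congr' fun v => ?_
  simp only [Set.mem_ofPred_eq, encThreshold_encExample hdec l hd]
  by_cases hv : v.val < 2 ^ (d - 1)
  · rw [ind_true hv, ind_false (not_le.2 hv), zero_mul, one_mul, add_zero, posProb, eq_sub_iff_add_eq,
      ← Finset.expect_add_distrib]
    refine (expect_congr' fun s => ?_).trans (Fintype.expect_const 1)
    cases h (encExample F l d r v s) <;> simp [ind, hv]
  · rw [ind_false hv, ind_true (not_lt.1 hv), zero_mul, one_mul, zero_add, posProb]
    refine expect_congr' fun s => ?_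
    simp [hv]

theorem half_le_sum_hypDrop (hdec : F.CorrectDecryption) (hd : blockBits c d ≤ d)
    (hc : 1 ≤ blockBits c d) (r : Fin (F.genCoins.eval (lam d + d)) → Bool)
    (h : F.ciphers (lam d) d × F.params (lam d) d → Bool)
    (herr : prob ((PMF.uniformOfFintype (Msg d × (Fin (F.encCoins.eval (lam d + d)) → Bool))).map
        fun z => encExample F (lam d) d r z.1 z.2)
      {x | h x ≠ encThreshold F (lam d) d
        ⟨2 ^ (d - 1), Nat.pow_lt_pow_right (by norm_num) (by omega)⟩ r x} ≤ 1 / 4) :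
    1 / 2 ≤ ∑ j ∈ range (2 ^ blockBits c d - 1), hypDrop c d r h j := by
  rw [prob_error hdec (lam d) (by omega)] at herr
  have h2 : 2 ^ blockBits c d = 2 * 2 ^ (blockBits c d - 1) := by
    rw [← pow_succ', Nat.sub_add_cancel hc]
  have hJ := fun j hj => expect_ind_block (j := j) hd hj
  have hJN := block_lt hd
  simp only [hypDrop]
  have h3 : ∀ v : Msg d, v.val / 2 ^ (d - blockBits c d) < 2 ^ (blockBits c d - 1) ↔
      v.val < 2 ^ (d - 1) := by
    intro v
    rw [Nat.div_lt_iff_lt_mul (by positivity), ← pow_add,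
      show blockBits c d - 1 + (d - blockBits c d) = d - 1 by omega]
  generalize d - blockBits c d = a at *
  rw [h2] at hJ hJN ⊢
  refine half_le_sum_blockDrop (by positivity) hJN hJ ?_
  simp only [← not_lt, h3] at herr ⊢
  exact herr

theorem prob_output (d : ℕ) (S : Fin (L.samples d) → (LEncThr F lam).Inst d × Bool)
    (T : Set ((LEncThr F lam).Inst d → Bool)) :
    prob (L.output d S) T = 𝔼 s, ind (L.hyp d (L.learn d (List.ofFn S) s) ∈ T) :=
  prob_uniform_map _ _

theorem accurate_hypDrop (hdec : F.CorrectDecryption) (hd : blockBits c d ≤ d)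
    (hc : 1 ≤ blockBits c d)
    (hL : AccuratePAC (1 / 4) (1 / 4) ((LEncThr F lam).concepts d) (L.output d))
    (r : Fin (F.genCoins.eval (lam d + d)) → Bool) :
    3 / 4 ≤ 𝔼 ω : Fin (L.samples d) → Msg d × (Fin (F.encCoins.eval (lam d + d)) → Bool), 𝔼 s,
      ind (1 / 2 ≤ ∑ j ∈ range (2 ^ blockBits c d - 1), hypDrop c d r (hypOf L r s ω) j) := by
  have h := hL _ ⟨⟨2 ^ (d - 1), Nat.pow_lt_pow_right (by norm_num) (by omega)⟩, r, rfl⟩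
    ((PMF.uniformOfFintype (Msg d × (Fin (F.encCoins.eval (lam d + d)) → Bool))).map
        fun z => encExample F (lam d) d r z.1 z.2)
  have h := h.trans_eq (prob_indep_bind (A := Msg d × (Fin (F.encCoins.eval (lam d + d)) → Bool))
    (fun _ z => encExample F (lam d) d r z.1 z.2) _ _)
  refine le_trans (by norm_num) (h.trans (expect_mono fun ω => ?_))
  rw [prob_output]
  refine expect_mono fun s => ?_
  have hS : (fun i => (encExample F (lam d) d r (ω i).1 (ω i).2, encThreshold F (lam d) d
      ⟨2 ^ (d - 1), Nat.pow_lt_pow_right (by norm_num) (by omega)⟩ r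
      (encExample F (lam d) d r (ω i).1 (ω i).2))) = sampleOf F (lam d) d r ω := by
    funext i
    rw [encThreshold_encExample hdec (lam d) (by omega)]
    rfl
  by_cases hh : 1 / 2 ≤ ∑ j ∈ range (2 ^ blockBits c d - 1), hypDrop c d r (hypOf L r s ω) j
  · rw [ind_true hh]
    exact ind_le_one _
  · rw [ind_false hh, ind_false]
    intro hmem
    refine hh (half_le_sum_hypDrop hdec hd hc r _ ?_)
    rw [hypOf, ← hS]
    exact hmem

/-- The entry `z` may be equal to `ω i`, or lead to the same example. Then the two samples are not
neighbours but equal, and the inequality is trivial. -/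
theorem private_hypOf {δ : ℝ} (hδ : 0 ≤ δ) (hL : DifferentiallyPrivate 1 δ (L.output d))
    (r : Fin (F.genCoins.eval (lam d + d)) → Bool)
    (ω : Fin (L.samples d) → Msg d × (Fin (F.encCoins.eval (lam d + d)) → Bool))
    (i : Fin (L.samples d)) (z : Msg d × (Fin (F.encCoins.eval (lam d + d)) → Bool))
    (T : (F.ciphers (lam d) d × F.params (lam d) d → Bool) → Prop) :
    𝔼 s, ind (T (hypOf L r s ω)) ≤
      Real.exp 1 * (𝔼 s, ind (T (hypOf L r s (Function.update ω i z)))) + δ := by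
  have hout : ∀ ω : Fin (L.samples d) → Msg d × (Fin (F.encCoins.eval (lam d + d)) → Bool),
      𝔼 s, ind (T (hypOf L r s ω)) = prob (L.output d (sampleOf F (lam d) d r ω)) {h | T h} := by
    intro ω
    exact (prob_output L d (sampleOf F (lam d) d r ω) {h | T h}).symm
  rw [hout, hout]
  by_cases hS : sampleOf F (lam d) d r ω = sampleOf F (lam d) d r (Function.update ω i z)
  · rw [← hS]
    have h1 := prob_nonneg (L.output d (sampleOf F (lam d) d r ω)) {h | T h}
    have h2 : (1 : ℝ) ≤ Real.exp 1 := Real.one_le_exp zero_le_one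
    nlinarith
  · have hne : ∀ j ≠ i, sampleOf F (lam d) d r ω j =
        sampleOf F (lam d) d r (Function.update ω i z) j := by
      intro j hj
      rw [sampleOf, sampleOf, Function.update_of_ne hj]
    refine hL _ _ ⟨i, ?_, fun j hj => ?_⟩ _
    · intro hi
      refine hS (funext fun j => ?_)
      by_cases hji : j = i
      · rw [hji]; exact hi
      · exact hne j hji
    · by_contra hji
      exact hj (hne j hji)

/-- An accurate and private learner has large drops over clean blocks. -/
theorem cleanDrops_lower (hdec : F.CorrectDecryption) (hd : blockBits c d ≤ d)
    (hc : 1 ≤ blockBits c d)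
    (hacc : AccuratePAC (1 / 4) (1 / 4) ((LEncThr F lam).concepts d) (L.output d))
    (hpriv : DifferentiallyPrivate 1 (1 / (4 * (L.samples d : ℝ))) (L.output d))
    (hn : 192 * L.samples d ^ 2 * uncleanBound (blockBits c d) *
      (L.samples d * uncleanBound (blockBits c d) + 1) ≤ 2 ^ blockBits c d) :
    1 / 16 < 64 * ((2 ^ blockBits c d : ℕ) : ℝ) * cleanDrops L c d (L.samples d) := by
  by_contra! hlt
  have hN : (0 : ℝ) < ((2 ^ blockBits c d : ℕ) : ℝ) := by positivity
  -- some coins of `Gen` are at least as good as the average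
  have hr := le_refl (cleanDrops L c d (L.samples d))
  conv_lhs at hr => rw [cleanDrops]
  obtain ⟨r, -, hr⟩ := Finset.exists_le_of_expect_le Finset.univ_nonempty hr
  refine false_of_private (K := 2 ^ blockBits c d - 1) (N := 2 ^ blockBits c d) (Nat.sub_le _ _)
    (by positivity)
    (M := uncleanBound (blockBits c d)) (μ := uncleanBound (blockBits c d) / (2 ^ blockBits c d : ℕ))
    (by positivity)
    (fun ω s j => hypDrop c d r (hypOf L r s ω) j)
    (fun z j => Clean (z.1.val / 2 ^ (d - blockBits c d)) j)
    (fun ω s j => abs_nonneg _)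
    (fun ω s j => blockDrop_le_one hd (posProb_nonneg d _ _ _) (posProb_le_one d _ _ _) j)
    (fun j hj => ?_) (fun z => ?_) (accurate_hypDrop L hdec hd hc hacc r) hr
    (fun ω i z => private_hypOf L (by positivity) hpriv r ω i z fun h => 1 / (4 * (L.samples d : ℝ)) ≤
      ∑ j ∈ range (2 ^ blockBits c d - 1),
        ind (¬ Clean ((ω i).1.val / 2 ^ (d - blockBits c d)) j) * hypDrop c d r h j)
    hlt ?_
  · rw [expect_prod]
    simp only [Fintype.expect_const]
    exact expect_not_clean_le hd (by omega)
  · refine le_trans (Finset.sum_le_sum_of_subset_of_nonneg (t := range (2 ^ blockBits c d)) ?_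
      fun _ _ _ => ind_nonneg _) ?_
    · exact Finset.range_subset_range.2 (Nat.sub_le _ _)
    · rw [sum_ind_eq_card]
      exact_mod_cast card_not_clean_right_le _ _ (block_lt hd z.1)
  · have h1 : (192 : ℝ) * L.samples d ^ 2 * uncleanBound (blockBits c d) *
      (L.samples d * uncleanBound (blockBits c d) + 1) ≤ ((2 ^ blockBits c d : ℕ) : ℝ) := by
      exact_mod_cast hn
    rw [mul_div_assoc', div_mul_eq_mul_div, div_le_iff₀ hN]
    linarith

end learner

/-! ### The number of blocks -/

/-- Here `2 ≤ d` is what lets a power of `d` absorb the coefficients. -/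
theorem exists_eval_le_pow (Q : Polynomial ℕ) : ∃ k, ∀ d, 2 ≤ d → Q.eval d ≤ d ^ k := by
  induction Q using Polynomial.induction_on' with
  | add p q hp hq =>
    obtain ⟨k, hk⟩ := hp
    obtain ⟨k', hk'⟩ := hq
    refine ⟨max k k' + 1, fun d hd => ?_⟩
    rw [Polynomial.eval_add, pow_succ]
    have h1 := (hk d hd).trans (Nat.pow_le_pow_right (by omega) (le_max_left k k'))
    have h2 := (hk' d hd).trans (Nat.pow_le_pow_right (by omega) (le_max_right k k'))
    nlinarith
  | monomial n a =>
    refine ⟨a + n, fun d hd => ?_⟩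
    rw [Polynomial.eval_monomial, pow_add]
    exact Nat.mul_le_mul_right _ (Nat.lt_two_pow_self.le.trans (Nat.pow_le_pow_left hd a))

theorem pow_le_two_pow_blockBits (c d : ℕ) : d ^ c ≤ 2 ^ blockBits c d := by
  rw [blockBits, mul_comm, pow_mul]
  exact Nat.pow_le_pow_left (Nat.lt_pow_succ_log_self (by norm_num) d).le c

/-- With enough blocks, all but few of them are clean for a sample of polynomial size. -/
theorem exists_blocks (P : Polynomial ℕ) : ∃ c, 1 ≤ c ∧ ∀ d, 2 ≤ d → c ≤ d → ∀ n ≤ P.eval d,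
    n < 2 ^ blockBits c d ∧ 192 * n ^ 2 * uncleanBound (blockBits c d) *
      (n * uncleanBound (blockBits c d) + 1) ≤ 2 ^ blockBits c d := by
  obtain ⟨k, hk⟩ := exists_eval_le_pow (192 * P ^ 2 * (4 * (Polynomial.X * (Polynomial.X + 1)) + 4) *
    (P * (4 * (Polynomial.X * (Polynomial.X + 1)) + 4) + 1) + (P + 1))
  refine ⟨k + 1, by omega, fun d hd hc n hn => ?_⟩
  have h1 := (hk d hd).trans ((Nat.pow_le_pow_right (by omega) (Nat.le_succ k)).trans
    (pow_le_two_pow_blockBits (k + 1) d))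
  simp only [Polynomial.eval_add, Polynomial.eval_mul, Polynomial.eval_pow, Polynomial.eval_X,
    Polynomial.eval_ofNat, Polynomial.eval_one] at h1
  have h2 : uncleanBound (blockBits (k + 1) d) ≤ 4 * (d * (d + 1)) + 4 := by
    rw [uncleanBound, blockBits]
    have h3 := Nat.log_le_self 2 d
    have h4 := Nat.mul_le_mul hc (Nat.succ_le_succ h3)
    simp only [Nat.succ_eq_add_one] at h4
    omega
  have h3 : 192 * n ^ 2 * uncleanBound (blockBits (k + 1) d) *
      (n * uncleanBound (blockBits (k + 1) d) + 1) ≤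
      192 * P.eval d ^ 2 * (4 * (d * (d + 1)) + 4) * (P.eval d * (4 * (d * (d + 1)) + 4) + 1) := by
    gcongr
  omega

open Filter Topology in
/-- A negligible advantage stays small when multiplied by a polynomial of `d`. -/
theorem eventually_small {lam : ℕ → ℕ} {f : ℕ → ℝ}
    (hlam : ∃ p : Polynomial ℕ, ∀ d, d ≤ p.eval (lam d)) (hf0 : ∀ d, 0 ≤ f d)
    (hf : Asymptotics.SuperpolynomialDecay atTop (fun d => (lam d : ℝ)) f) (k : ℕ) {ε : ℝ}
    (hε : 0 < ε) : ∀ᶠ d : ℕ in atTop, ((2 * d + 2 : ℕ) : ℝ) ^ k * f d < ε := by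
  obtain ⟨p, hp⟩ := hlam
  have h := (hf.polynomial_mul (((2 * p + 2) ^ k).map (Nat.castRingHom ℝ))) 0
  filter_upwards [h.eventually (gt_mem_nhds hε)] with d hd
  refine lt_of_le_of_lt ?_ hd
  rw [pow_zero, one_mul, Polynomial.eval_natCast_map]
  refine mul_le_mul_of_nonneg_right ?_ (hf0 d)
  simp only [Polynomial.eval_pow, Polynomial.eval_add, Polynomial.eval_mul,
    Polynomial.eval_ofNat, Nat.coe_castRingHom]
  have := hp d
  exact_mod_cast Nat.pow_le_pow_left (show 2 * d + 2 ≤ 2 * p.eval (lam d) + 2 by omega) k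

open Filter Topology in
theorem eventually_pow_div_two_pow_small (k : ℕ) {ε : ℝ} (hε : 0 < ε) :
    ∀ᶠ d : ℕ in atTop, ((2 * d + 2 : ℕ) : ℝ) ^ k / (2 ^ d : ℕ) < ε := by
  have h := tendsto_pow_const_div_const_pow_of_one_lt k (r := (2 : ℝ)) (by norm_num)
  have h4 : (0 : ℝ) < 4 ^ k := by positivity
  filter_upwards [h.eventually (gt_mem_nhds (div_pos hε h4)), eventually_ge_atTop 1] with d hd h1
  rw [lt_div_iff₀ h4] at hd
  refine lt_of_le_of_lt ?_ hd
  rw [div_mul_eq_mul_div, ← mul_pow]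
  push_cast
  gcongr
  have : (1 : ℝ) ≤ d := by exact_mod_cast h1
  linarith

/-- No efficient learner for encrypted thresholds is accurate and private. -/
theorem not_accurate_and_private {F : FRE} {lam : ℕ → ℕ} (hdec : F.CorrectDecryption)
    (hlam : ∃ p : Polynomial ℕ, ∀ d, d ≤ p.eval (lam d)) (hsec : F.StaticallySecure lam tfld)
    (L : EfficientLearner (LEncThr F lam))
    (hacc : ∀ d, AccuratePAC (1 / 4) (1 / 4) ((LEncThr F lam).concepts d) (L.output d))
    (hpriv : ∀ d, DifferentiallyPrivate 1 (1 / (4 * (L.samples d : ℝ))) (L.output d)) : False := by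
  obtain ⟨P, hP⟩ := L.samples_le
  obtain ⟨c, hc1, hc⟩ := exists_blocks P
  -- `128 * (1 / 4096 + 1 / 4096)` is the bound `1 / 16` that `cleanDrops_lower` excludes
  have h1 := eventually_small hlam (fun d => abs_nonneg _) (hsec (adversary L c)) (6 * c)
    (show (0 : ℝ) < 1 / 4096 by norm_num)
  have h2 := eventually_pow_div_two_pow_small (4 * c) (show (0 : ℝ) < 1 / 4096 by norm_num)
  obtain ⟨d, h1, h2, h3, h4⟩ := (h1.and (h2.and ((Filter.eventually_ge_atTop 2).and
    (Filter.eventually_ge_atTop c)))).exists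
  obtain ⟨hn, hn'⟩ := hc d h3 h4 _ (hP d)
  have hN : ((2 ^ blockBits c d : ℕ) : ℝ) ≤ ((2 * d + 2 : ℕ) : ℝ) ^ c := by
    exact_mod_cast two_pow_blockBits_le c d
  have hN1 : (1 : ℝ) ≤ ((2 ^ blockBits c d : ℕ) : ℝ) := by exact_mod_cast Nat.one_le_two_pow
  have hD : (0 : ℝ) < ((2 ^ d : ℕ) : ℝ) := by positivity
  set adv := |prob (FRE.game (adversary L c) false d) {true} -
    prob (FRE.game (adversary L c) true d) {true}| with hadv
  have hadv0 : 0 ≤ adv := abs_nonneg _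
  have h5 : ((2 ^ blockBits c d : ℕ) : ℝ) ^ 6 * adv < 1 / 4096 := by
    refine lt_of_le_of_lt (mul_le_mul_of_nonneg_right ?_ hadv0) h1
    rw [mul_comm 6 c, pow_mul]
    gcongr
  have h6 : ((2 ^ blockBits c d : ℕ) : ℝ) ^ 4 / (2 ^ d : ℕ) < 1 / 4096 := by
    refine lt_of_le_of_lt ?_ h2
    rw [mul_comm 4 c, pow_mul]
    gcongr
  have hd : blockBits c d ≤ d := by
    rw [div_lt_iff₀ hD] at h6
    have h7 : ((2 ^ blockBits c d : ℕ) : ℝ) ≤ ((2 ^ d : ℕ) : ℝ) := by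
      refine (le_self_pow₀ hN1 (by norm_num : (4 : ℕ) ≠ 0)).trans ?_
      linarith
    exact (Nat.pow_le_pow_iff_right (a := 2) (by norm_num)).1 (by exact_mod_cast h7)
  have h8 := cleanDrops_lower L hdec hd (Nat.mul_pos hc1 (Nat.succ_pos _)) (hacc d) (hpriv d) hn'
  have h9 := mul_le_mul_of_nonneg_left (cleanDrops_le L hd hn)
    (show 0 ≤ 64 * ((2 ^ blockBits c d : ℕ) : ℝ) by positivity)
  rw [← hadv] at h9
  have h10 : 64 * ((2 ^ blockBits c d : ℕ) : ℝ) * (2 * ((2 ^ blockBits c d : ℕ) : ℝ) ^ 5 * adv +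
      2 * ((2 ^ blockBits c d : ℕ) : ℝ) ^ 3 / (2 ^ d : ℕ)) =
      128 * (((2 ^ blockBits c d : ℕ) : ℝ) ^ 6 * adv) +
      128 * (((2 ^ blockBits c d : ℕ) : ℝ) ^ 4 / (2 ^ d : ℕ)) := by ring
  linarith

end LeakyThr

theorem mainTheorem2 (F : LeakyThr.FRE)
    (hdec : F.CorrectDecryption)
    (heval : F.CorrectEvaluation LeakyThr.tfld)
    (lam : ℕ → ℕ)
    (hlam : ∃ p : Polynomial ℕ, ∀ d, lam d ≤ p.eval d)
    (hlam' : ∃ p : Polynomial ℕ, ∀ d, d ≤ p.eval (lam d))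
    (hsec : F.StaticallySecure lam LeakyThr.tfld) :
    LeakyThr.EfficientlyOnlineLearnable (LeakyThr.LEncThr F lam) ∧
    ¬ ∃ L : LeakyThr.EfficientLearner (LeakyThr.LEncThr F lam), ∀ d,
        LeakyThr.AccuratePAC (1 / 4) (1 / 4) ((LeakyThr.LEncThr F lam).concepts d)
          (L.output d) ∧
        LeakyThr.DifferentiallyPrivate 1 (1 / (4 * (L.samples d : ℝ))) (L.output d) := by
  exact ⟨LeakyThr.efficientlyOnlineLearnable F heval lam hlam, fun ⟨L, hL⟩ =>
    LeakyThr.not_accurate_and_private hdec hlam' hsec L (fun d => (hL d).1) fun d => (hL d).2⟩
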